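/- \textbf{Setting.} Let $A$ be a Poisson algebra over a field $k$ and let $\mathcal A_\hbar=(A[[\hbar]],\star)$ be a differential deformation quantisation of it: $\star$ is a unital associative $k[[\hbar]]$-bilinear product with $f\star g=fg+O(\hbar)$ and $f\star g-g\star f=\{f,g\}\hbar+O(\hbar^2)$ for $f,g\in A$, whose coefficient of $\hbar^m$ is a bidifferential operator of order at most $m$ in each variable. Let $G=H\rtimes K$ be a group acting on $\mathcal A_\hbar$ by $k[[\hbar]]$-algebra automorphisms with quantum comoment map $\Phi\colon\mathfrak g\to\mathcal A_\hbar$, that is, a linear $G$-equivariant map with $[\Phi(\xi),\cdot]=\hbar\,\xi_{\mathcal A}$, where $\xi_{\mathcal A}$ is the infinitesimal action of $\xi$. Let $\gamma\colon\mathfrak g\to k[[\hbar]]$ be linear and fixed by the coadjoint action of $G$, let $\eta,\kappa$ be its restrictions to $\mathfrak h,\mathfrak k$, and let the subscript $0$ denote the value at $\hbar=0$. The quantum Hamiltonian reduction is $$\mathcal A_\hbar/\!/\!/_{\gamma}G=\bigl(\mathcal A_\hbar/\mathcal A_\hbar\{\Phi(\xi)-\gamma(\xi)\}_{\xi\in\mathfrak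 g}\bigr)^G$$ with product $[a][b]=[ab]$. It comes with the natural homomorphism $$\varphi\colon(\mathcal A_\hbar/\!/\!/_\eta H)/\!/\!/_\kappa K\to\mathcal A_\hbar/\!/\!/_\gamma G,\qquad [a]\mapsto[a].$$ Let $\mu\colon\mathfrak g\to A$ be $\Phi$ modulo $\hbar$ and put $A/\!/_{\gamma_0}G=\bigl(A/A\{\mu(\xi)-\gamma_0(\xi)\}_{\xi\in\mathfrak g}\bigr)^G$, with the action of $G$ on $A$ obtained modulo $\hbar$; similarly for $H$ and $K$. The brackets of these Poisson algebras are computed on representatives. A quantum reduction $N$ is said to be a deformation quantisation of the classical reduction $N_0$ if reduction modulo $\hbar$ is a surjective homomorphism $N\to N_0$ with kernel $\hbar N$, and $N$ has no $\hbar$-torsion. \textbf{Theorem.} (1) Let $k=\mathbb C$, and let $G=H\rtimes K$ be a linear algebraic group over $\mathbb C$ acting algebraically on $\mathcal A_\hbar$ as above. Suppose that the quantum reductions $(\mathcal A_\hbar/\!/\!/_\eta H)/\!/\!/_\kappa K$ and $\mathcal A_\hbar/\!/\!/_\gamma G$ are deformation quantisations of the classical reductions $(A/\!/_{\eta_0}H)/\!/_{\kappa_0}K$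 and $A/\!/_{\gamma_0}G$. If $\varphi$ induces an isomorphism $\overline\varphi\colon(A/\!/_{\eta_0}H)/\!/_{\kappa_0}K\to A/\!/_{\gamma_0}G$, $[a]\mapsto[a]$, then $\varphi$ is an isomorphism of $\mathbb C[[\hbar]]$-algebras. (2) Let $k=\mathbb R$ or $\mathbb C$ and let $A=C^\infty(X,k)$ for a smooth, Hausdorff, $\sigma$-compact, finite-dimensional manifold $X$ with a Poisson bracket on $A$. Let $G=H\rtimes K$ be a Lie group acting smoothly, freely and properly on $X$, such that the induced action on $A[[\hbar]]$ preserves $\star$ and has a quantum comoment map $\Phi$ as above whose classical moment map $\mu\colon X\to\mathfrak g^*$ is real. Let $\gamma$ be as above, with $\gamma_0$ real. Suppose that $\eta_0$ is a regular value of the moment map $X\to\mathfrak h^*$ of $H$ and that $\gamma_0$ is a regular value of $\mu$. Then $\overline\varphi$ is an isomorphism, and $\varphi$ is an isomorphism of $k[[\hbar]]$-algebras. -/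

import Mathlib

open scoped Manifold ContDiff PowerSeries

noncomputable section

namespace QHR

universe u v

/-! ### Poisson algebras and deformation quantisations -/

/-- A Poisson bracket on a commutative algebra. -/
structure PoissonBracket (k : Type u) (A : Type v) [Field k] [CommRing A] [Algebra k A] where
  bracket : A →ₗ[k] A →ₗ[k] A
  alternating : ∀ f, bracket f f = 0
  leibniz : ∀ f g h, bracket f (g * h) = bracket f g * h + g * bracket f h
  jacobi : ∀ f g h,
    bracket f (bracket g h) + bracket g (bracket h f) + bracket h (bracket f g) = 0

/-- Differential operators of order at most `n` on a commutative ring, by iterated commutators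
with multiplication operators. -/
def IsDiffOp {A : Type v} [CommRing A] : ℕ → (A → A) → Prop
  | 0, D => ∀ f a, D (f * a) = f * D a
  | n + 1, D => ∀ f, IsDiffOp n (fun a => D (f * a) - f * D a)

/-- A differential deformation quantisation of a Poisson algebra `A`: an associative unital
product `⋆` on `A⟦ħ⟧`, bilinear over `k⟦ħ⟧` (so continuous for the `ħ`-adic topology and
determined by its values on `A`). The formal variable `ħ` is `PowerSeries.X`. -/
structure DefQuant {k : Type u} {A : Type v} [Field k] [CommRing A] [Algebra k A]
    (P : PoissonBracket k A) where
  star : A⟦X⟧ →ₗ[k⟦X⟧] A⟦X⟧ →ₗ[k⟦X⟧] A⟦X⟧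
  assoc : ∀ a b c, star (star a b) c = star a (star b c)
  one_star : ∀ a, star 1 a = a
  star_one : ∀ a, star a 1 = a
  coeff_zero : ∀ f g : A,
    PowerSeries.coeff 0 (star (PowerSeries.C f) (PowerSeries.C g)) = f * g
  coeff_one : ∀ f g : A,
    PowerSeries.coeff 1 (star (PowerSeries.C f) (PowerSeries.C g)
      - star (PowerSeries.C g) (PowerSeries.C f)) = P.bracket f g
  diffOp_right : ∀ (n : ℕ) (f : A),
    IsDiffOp n (fun g => PowerSeries.coeff n (star (PowerSeries.C f) (PowerSeries.C g)))
  diffOp_left : ∀ (n : ℕ) (g : A),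
    IsDiffOp n (fun f => PowerSeries.coeff n (star (PowerSeries.C f) (PowerSeries.C g)))

section Alg

variable {k : Type u} {A : Type v} [Field k] [CommRing A] [Algebra k A] {P : PoissonBracket k A}

/-- The algebra `(A⟦ħ⟧, ⋆)`. -/
def DefQuant.Alg (_Q : DefQuant P) : Type v := A⟦X⟧

instance (Q : DefQuant P) : AddCommGroup Q.Alg := inferInstanceAs (AddCommGroup A⟦X⟧)

instance (Q : DefQuant P) : Module k⟦X⟧ Q.Alg := inferInstanceAs (Module k⟦X⟧ A⟦X⟧)

instance (Q : DefQuant P) : Module k Q.Alg := inferInstanceAs (Module k A⟦X⟧)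

instance (Q : DefQuant P) : Ring Q.Alg :=
  { (inferInstance : AddCommGroup Q.Alg) with
    mul := fun a b => Q.star a b
    one := (1 : A⟦X⟧)
    mul_assoc := Q.assoc
    one_mul := Q.one_star
    mul_one := Q.star_one
    left_distrib := fun a b c => (Q.star a).map_add b c
    right_distrib := Q.star.map_add₂
    zero_mul := Q.star.map_zero₂
    mul_zero := fun a => (Q.star a).map_zero }

instance (Q : DefQuant P) : Algebra k⟦X⟧ Q.Alg :=
  Algebra.ofModule
    (fun r x y => Q.star.map_smul₂ r x y)
    (fun r x y => (Q.star x).map_smul r y)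

/-- The coefficient of `ħ ^ n`. -/
def DefQuant.coeff (Q : DefQuant P) (n : ℕ) (a : Q.Alg) : A :=
  PowerSeries.coeff n (show A⟦X⟧ from a)

/-- The inclusion of `A` in `A⟦ħ⟧` as constant series. -/
def DefQuant.const (Q : DefQuant P) (f : A) : Q.Alg := (PowerSeries.C f : A⟦X⟧)

lemma DefQuant.coeff_add (Q : DefQuant P) (n : ℕ) (a b : Q.Alg) :
    Q.coeff n (a + b) = Q.coeff n a + Q.coeff n b :=
  map_add (PowerSeries.coeff (R := A) n) _ _

lemma DefQuant.const_add (Q : DefQuant P) (f g : A) :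
    Q.const (f + g) = Q.const f + Q.const g :=
  map_add (PowerSeries.C (R := A)) f g

lemma DefQuant.coeff_zero_const (Q : DefQuant P) (f : A) : Q.coeff 0 (Q.const f) = f :=
  PowerSeries.coeff_zero_C f

lemma DefQuant.coeff_zero_X_smul (Q : DefQuant P) (a : Q.Alg) :
    Q.coeff 0 ((PowerSeries.X : k⟦X⟧) • a) = 0 := by
  change PowerSeries.coeff 0 (PowerSeries.map (algebraMap k A) PowerSeries.X
    * (show A⟦X⟧ from a)) = 0
  rw [PowerSeries.map_X, PowerSeries.coeff_zero_X_mul]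

/-- Every series is its constant term plus a multiple of `ħ`. -/
lemma DefQuant.exists_eq (Q : DefQuant P) (a : Q.Alg) :
    ∃ b : Q.Alg, a = Q.const (Q.coeff 0 a) + (PowerSeries.X : k⟦X⟧) • b := by
  refine ⟨(PowerSeries.mk fun n => PowerSeries.coeff (n + 1) (show A⟦X⟧ from a) : A⟦X⟧), ?_⟩
  change (show A⟦X⟧ from a) = PowerSeries.C (PowerSeries.coeff 0 (show A⟦X⟧ from a))
    + PowerSeries.map (algebraMap k A) PowerSeries.X
      * (PowerSeries.mk fun n => PowerSeries.coeff (n + 1) (show A⟦X⟧ from a))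
  rw [PowerSeries.map_X, add_comm]
  simpa using PowerSeries.eq_X_mul_shift_add_const (show A⟦X⟧ from a)

lemma DefQuant.coeff_zero_mul (Q : DefQuant P) (a b : Q.Alg) :
    Q.coeff 0 (a * b) = Q.coeff 0 a * Q.coeff 0 b := by
  obtain ⟨a', ha⟩ := Q.exists_eq a
  obtain ⟨b', hb⟩ := Q.exists_eq b
  have h : Q.coeff 0 (Q.const (Q.coeff 0 a) * Q.const (Q.coeff 0 b))
      = Q.coeff 0 a * Q.coeff 0 b := Q.coeff_zero _ _
  rw [← h]
  conv_lhs => rw [ha, hb]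
  rw [add_mul, mul_add, smul_mul_assoc, mul_smul_comm, Q.coeff_add, Q.coeff_add,
    Q.coeff_zero_X_smul, Q.coeff_zero_X_smul, add_zero, add_zero]

/-- The endomorphism of `A = A⟦ħ⟧ / ħ A⟦ħ⟧` induced by an endomorphism of `(A⟦ħ⟧, ⋆)`. -/
def DefQuant.modHbar (Q : DefQuant P) (σ : Q.Alg →ₐ[k⟦X⟧] Q.Alg) : A →ₐ[k] A :=
  have key : ∀ a : Q.Alg, Q.coeff 0 (σ (Q.const (Q.coeff 0 a))) = Q.coeff 0 (σ a) := by
    intro a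
    obtain ⟨b, hb⟩ := Q.exists_eq a
    conv_rhs => rw [hb]
    rw [map_add, map_smul, Q.coeff_add, Q.coeff_zero_X_smul, add_zero]
  have hsc : ∀ r : k, Q.const (algebraMap k A r) = algebraMap k⟦X⟧ Q.Alg (PowerSeries.C r) := by
    intro r
    have h : (PowerSeries.C (algebraMap k A r) : A⟦X⟧)
        = PowerSeries.map (algebraMap k A) (PowerSeries.C r) * 1 := by
      rw [PowerSeries.map_C, mul_one]
    exact h.trans (Algebra.algebraMap_eq_smul_one (A := Q.Alg) (PowerSeries.C r)).symm
  { toFun := fun f => Q.coeff 0 (σ (Q.const f))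
    map_one' := by
      have h : Q.const 1 = 1 := map_one (PowerSeries.C (R := A))
      rw [h, map_one, ← h, Q.coeff_zero_const]
    map_mul' := fun f g => by
      have h := key (Q.const f * Q.const g)
      rw [Q.coeff_zero_mul, Q.coeff_zero_const, Q.coeff_zero_const] at h
      rw [h, map_mul, Q.coeff_zero_mul]
    map_zero' := by
      have h : Q.const 0 = 0 := map_zero (PowerSeries.C (R := A))
      rw [h, map_zero, ← h, Q.coeff_zero_const]
    map_add' := fun f g => by rw [Q.const_add, map_add, Q.coeff_add]
    commutes' := fun r => by
      rw [hsc, AlgHom.commutes, ← hsc, Q.coeff_zero_const] }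

end Alg

/-! ### Hamiltonian reduction, classical and quantum

All reductions of an algebra `R` are subquotients `B / L` of `R` in which the product is computed
on representatives. -/

/-- A subquotient algebra `B / (L ∩ B)` of `R`. -/
structure Subquot (S : Type u) (R : Type v) [CommRing S] [Ring R] [Algebra S R] where
  B : Subalgebra S R
  L : Submodule S R
  left_mem : ∀ b ∈ B, ∀ l ∈ L, b * l ∈ L
  right_mem : ∀ l ∈ L, ∀ b ∈ B, l * b ∈ L

namespace Subquot

variable {S : Type u} {R : Type v} [CommRing S] [Ring R] [Algebra S R]

/-- The algebra `R` itself. -/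
def whole (S : Type u) (R : Type v) [CommRing S] [Ring R] [Algebra S R] : Subquot S R where
  B := ⊤
  L := ⊥
  left_mem := by
    intro b _ l hl
    rw [Submodule.mem_bot] at hl ⊢
    rw [hl, mul_zero]
  right_mem := by
    intro l hl b _
    rw [Submodule.mem_bot] at hl ⊢
    rw [hl, zero_mul]

/-- The kernel of `B → B / (L ∩ B)`. -/
def ker (P : Subquot S R) : Ideal P.B where
  carrier := {b | (b : R) ∈ P.L}
  add_mem' := fun ha hb => P.L.add_mem ha hb
  zero_mem' := P.L.zero_mem
  smul_mem' := fun c x hx => P.left_mem c c.2 x hx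

instance (P : Subquot S R) : P.ker.IsTwoSided :=
  ⟨fun {a} b ha => P.right_mem a ha b b.2⟩

/-- The algebra `B / (L ∩ B)`. -/
abbrev Alg (P : Subquot S R) : Type v := P.B ⧸ P.ker

/-- The class in `B / (L ∩ B)` of an element of `B`. -/
def cls (P : Subquot S R) (b : P.B) : P.Alg := Ideal.Quotient.mk P.ker b

/-- The left `B`-submodule `L + B · J` of `R`: modulo `L`, the left ideal of `B / L` generated
by `J`. -/
def momentIdeal (P : Subquot S R) (J : Set R) : Submodule S R :=
  P.L ⊔ Submodule.span S {r | ∃ b ∈ P.B, ∃ j ∈ J, r = b * j}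

lemma momentIdeal_left (P : Subquot S R) (J : Set R) {b : R} (hb : b ∈ P.B) {l : R}
    (hl : l ∈ P.momentIdeal J) : b * l ∈ P.momentIdeal J := by
  obtain ⟨x, hx, y, hy, rfl⟩ := Submodule.mem_sup.1 hl
  rw [mul_add]
  refine add_mem (Submodule.mem_sup_left (P.left_mem b hb x hx)) (Submodule.mem_sup_right ?_)
  clear hl
  induction hy using Submodule.span_induction with
  | mem r hr =>
    obtain ⟨c, hc, j, hj, rfl⟩ := hr
    exact Submodule.subset_span ⟨b * c, mul_mem hb hc, j, hj, (mul_assoc _ _ _).symm⟩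
  | zero => rw [mul_zero]; exact zero_mem _
  | add r s _ _ hr hs => rw [mul_add]; exact add_mem hr hs
  | smul c r _ hr => rw [mul_smul_comm]; exact Submodule.smul_mem _ c hr

/-- Hamiltonian reduction of the algebra `B / L` under a group acting through `ρ`, with moment
constraints `J` (the elements `Φ(x) - γ(x)`): the invariants in the quotient of `B / L` by its
left ideal `L'` generated by `J`. The product of cosets of `L'` is computed on representatives;
the last clause says that it is well defined. (An infinitesimal action given by `ħ⁻¹ [Φ(x), ·]`
kills the invariants, so that `(Φ(x) - γ(x)) a = a (Φ(x) - γ(x)) + ħ (x · a)` is again in `L'` and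
the clause holds by itself; it holds trivially when `R` is commutative.) -/
def reduce (P : Subquot S R) {Γ : Type*} (ρ : Γ → R →ₐ[S] R) (J : Set R) : Subquot S R where
  B :=
    { carrier := {a | a ∈ P.B ∧ (∀ g, ρ g a ∈ P.B ∧ ρ g a - a ∈ P.momentIdeal J) ∧
        ∀ l ∈ P.momentIdeal J, l * a ∈ P.momentIdeal J}
      mul_mem' := by
        rintro a b ⟨ha, hga, hla⟩ ⟨hb, hgb, hlb⟩
        refine ⟨mul_mem ha hb, fun g => ⟨?_, ?_⟩, fun l hl => ?_⟩
        · rw [map_mul]; exact mul_mem (hga g).1 (hgb g).1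
        · have e : ρ g (a * b) - a * b = ρ g a * (ρ g b - b) + (ρ g a - a) * b := by
            rw [map_mul]; noncomm_ring
          rw [e]
          exact add_mem (P.momentIdeal_left J (hga g).1 (hgb g).2) (hlb _ (hga g).2)
        · rw [← mul_assoc]; exact hlb _ (hla l hl)
      add_mem' := by
        rintro a b ⟨ha, hga, hla⟩ ⟨hb, hgb, hlb⟩
        refine ⟨add_mem ha hb, fun g => ⟨?_, ?_⟩, fun l hl => ?_⟩
        · rw [map_add]; exact add_mem (hga g).1 (hgb g).1
        · rw [map_add, add_sub_add_comm]; exact add_mem (hga g).2 (hgb g).2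
        · rw [mul_add]; exact add_mem (hla l hl) (hlb l hl)
      algebraMap_mem' := by
        intro r
        refine ⟨P.B.algebraMap_mem r, fun g => ⟨?_, ?_⟩, fun l hl => ?_⟩
        · rw [AlgHom.commutes]; exact P.B.algebraMap_mem r
        · rw [AlgHom.commutes, sub_self]; exact zero_mem _
        · rw [← Algebra.commutes, ← Algebra.smul_def]; exact Submodule.smul_mem _ r hl }
  L := P.momentIdeal J
  left_mem := fun _ hb _ hl => P.momentIdeal_left J hb.1 hl
  right_mem := fun l hl _ hb => hb.2.2 l hl

/-- The assignment `a + L₁ ↦ a + L₂` is a well-defined isomorphism of algebras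
`B₁ / L₁ ≃ B₂ / L₂`. -/
def IsNaturalIso (P₁ P₂ : Subquot S R) : Prop :=
  ∃ φ : P₁.Alg ≃ₐ[S] P₂.Alg, ∀ a : P₁.B, ∃ h : (a : R) ∈ P₂.B, φ (P₁.cls a) = P₂.cls ⟨a, h⟩

/-- Reduction of `R` by `G` with moment constraints `J`. -/
def oneStage {G : Type*} [Group G] (ρ : G → R →ₐ[S] R) (J : Set R) : Subquot S R :=
  (whole S R).reduce ρ J

/-- Reduction of `R` by `H` with moment constraints `JH`, followed by reduction of the result by
`K` with moment constraints `JK`. -/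
def twoStage {G : Type*} [Group G] (ρ : G → R →ₐ[S] R) (H K : Subgroup G) (JH JK : Set R) :
    Subquot S R :=
  ((whole S R).reduce (fun h : H => ρ h) JH).reduce (fun g : K => ρ g) JK

end Subquot

/-- The subquotient `N` of `(A⟦ħ⟧, ⋆)` is a deformation quantisation of the subquotient `N₀` of
`A`: taking constant terms is a well-defined surjective homomorphism `N → N₀` with kernel `ħ N`,
and `N` has no `ħ`-torsion. -/
def Quantises {k : Type u} {A : Type v} [Field k] [CommRing A] [Algebra k A]
    {P : PoissonBracket k A} (Q : DefQuant P) (N : Subquot k⟦X⟧ Q.Alg) (N₀ : Subquot k A) :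
    Prop :=
  (∃ π : N.Alg →+* N₀.Alg,
    (∀ a : N.B, ∃ h : Q.coeff 0 (a : Q.Alg) ∈ N₀.B, π (N.cls a) = N₀.cls ⟨_, h⟩) ∧
    Function.Surjective π ∧
    ∀ u : N.Alg, π u = 0 ↔ ∃ w : N.Alg, u = (PowerSeries.X : k⟦X⟧) • w) ∧
  ∀ u : N.Alg, (PowerSeries.X : k⟦X⟧) • u = 0 → u = 0

/-! ### Linear algebraic groups and their quantum Hamiltonian actions -/

section Algebraic

variable {n : ℕ}

/-- Indices for the coordinate functions `g ↦ gᵢⱼ` and `g ↦ (g⁻¹)ᵢⱼ` on `GLₙ`. -/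
abbrev Coord (n : ℕ) : Type := (Fin n × Fin n) ⊕ (Fin n × Fin n)

/-- The values of the coordinate functions at `g`. -/
def pt (g : GL (Fin n) ℂ) : Coord n → ℂ :=
  Sum.elim (fun p => g.1 p.1 p.2) (fun p => (g⁻¹).1 p.1 p.2)

/-- The derivatives of the coordinate functions at the identity in the direction `ξ`. -/
def tangent (ξ : Matrix (Fin n) (Fin n) ℂ) : Coord n → ℂ :=
  Sum.elim (fun p => ξ p.1 p.2) (fun p => -ξ p.1 p.2)

/-- Value at `g` of a regular function on `GLₙ` with coefficients in `A`. -/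
def evalAt {A : Type v} [CommRing A] [Algebra ℂ A] (p : MvPolynomial (Coord n) A)
    (g : GL (Fin n) ℂ) : A :=
  MvPolynomial.eval (fun i => algebraMap ℂ A (pt g i)) p

/-- Derivative at the identity, in the direction `ξ`, of a regular function on `GLₙ` with
coefficients in `A`. -/
def derivAtOne {A : Type v} [CommRing A] [Algebra ℂ A] (p : MvPolynomial (Coord n) A)
    (ξ : Matrix (Fin n) (Fin n) ℂ) : A :=
  ∑ i, algebraMap ℂ A (tangent ξ i) * evalAt (MvPolynomial.pderiv i p) 1

/-- Zariski closed subgroups of `GLₙ(ℂ)`, that is, linear algebraic groups. -/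
def IsAlgebraicGroup (G : Subgroup (GL (Fin n) ℂ)) : Prop :=
  ∃ E : Set (MvPolynomial (Coord n) ℂ), ∀ g, g ∈ G ↔ ∀ p ∈ E, evalAt p g = 0

/-- The Lie algebra of a linear algebraic group: its tangent space at the identity. -/
def lieAlg (G : Subgroup (GL (Fin n) ℂ)) : Submodule ℂ (Matrix (Fin n) (Fin n) ℂ) where
  carrier := {ξ | ∀ p : MvPolynomial (Coord n) ℂ, (∀ g ∈ G, evalAt p g = 0) → derivAtOne p ξ = 0}
  add_mem' := by
    intro ξ ζ hξ hζ p hp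
    have h : derivAtOne p (ξ + ζ) = derivAtOne p ξ + derivAtOne p ζ := by
      unfold derivAtOne
      rw [← Finset.sum_add_distrib]
      refine Finset.sum_congr rfl fun i _ => ?_
      have : tangent (ξ + ζ) i = tangent ξ i + tangent ζ i := by
        rcases i with i | i
        · simp [tangent]
        · simp [tangent, add_comm]
      rw [this, map_add, add_mul]
    rw [h, hξ p hp, hζ p hp, add_zero]
  zero_mem' := by
    intro p _
    unfold derivAtOne
    refine Finset.sum_eq_zero fun i _ => ?_
    have : tangent (0 : Matrix (Fin n) (Fin n) ℂ) i = 0 := by rcases i with i | i <;> simp [tangent]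
    rw [this, map_zero, zero_mul]
  smul_mem' := by
    intro c ξ hξ p hp
    have h : derivAtOne p (c • ξ) = c * derivAtOne p ξ := by
      unfold derivAtOne
      rw [Finset.mul_sum]
      refine Finset.sum_congr rfl fun i _ => ?_
      have : tangent (c • ξ) i = c * tangent ξ i := by rcases i with i | i <;> simp [tangent]
      rw [this, map_mul, mul_assoc]
      rfl
    change derivAtOne p (c • ξ) = 0
    rw [h, hξ p hp, mul_zero]

/-- The algebraic group `G` is the semidirect product `H ⋊ K` of its closed subgroups `H`
(normal) and `K`: the product map `H × K → G` is an isomorphism of varieties, i.e. it is bijective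
and the projection `G → K` is regular. -/
structure IsAlgSemidirect (G : Subgroup (GL (Fin n) ℂ)) (H K : Subgroup G) : Prop where
  algebraic_G : IsAlgebraicGroup G
  algebraic_H : IsAlgebraicGroup (H.map G.subtype)
  algebraic_K : IsAlgebraicGroup (K.map G.subtype)
  normal : H.Normal
  compl : H.IsComplement' K
  proj_regular : ∃ p : Coord n → MvPolynomial (Coord n) ℂ, ∀ h ∈ H, ∀ g ∈ K, ∀ i,
    evalAt (p i) ((h * g : G) : GL (Fin n) ℂ) = pt (g : GL (Fin n) ℂ) i

variable {A : Type v} [CommRing A] [Algebra ℂ A] {P : PoissonBracket ℂ A}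

/-- A quantum Hamiltonian action of an algebraic group `G` on `(A⟦ħ⟧, ⋆)`: an algebraic action by
`ℂ⟦ħ⟧`-algebra automorphisms, with a quantum comoment map `Φ`, that is a linear `G`-equivariant
map from the Lie algebra for which `[Φ(ξ), ·] = ħ ξ_A`, where `ξ_A` is the infinitesimal action. -/
structure AlgHamiltonianAction (Q : DefQuant P) (G : Subgroup (GL (Fin n) ℂ)) where
  act : G →* (Q.Alg ≃ₐ[ℂ⟦X⟧] Q.Alg)
  algebraic : ∀ (b : Q.Alg) (m : ℕ), ∃ p : MvPolynomial (Coord n) A,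
    ∀ g : G, Q.coeff m (act g b) = evalAt p g
  comoment : lieAlg G →ₗ[ℂ] Q.Alg
  equivariant : ∀ (g : G) (ξ ζ : lieAlg G),
    (ζ : Matrix (Fin n) (Fin n) ℂ) = (g : GL (Fin n) ℂ).1 * ξ * ((g : GL (Fin n) ℂ)⁻¹).1 →
    comoment ζ = act g (comoment ξ)
  comoment_comm : ∀ (ξ : lieAlg G) (b : Q.Alg), ∃ c : Q.Alg,
    (∀ (m : ℕ) (p : MvPolynomial (Coord n) A),
      (∀ g : G, Q.coeff m (act g b) = evalAt p g) → Q.coeff m c = derivAtOne p ξ) ∧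
    comoment ξ * b - b * comoment ξ = (PowerSeries.X : ℂ⟦X⟧) • c

/-- `γ` is fixed by the coadjoint action of `G`. -/
def AlgCoadjointFixed (G : Subgroup (GL (Fin n) ℂ)) (γ : lieAlg G →ₗ[ℂ] ℂ⟦X⟧) : Prop :=
  ∀ (g : G) (ξ ζ : lieAlg G),
    (ζ : Matrix (Fin n) (Fin n) ℂ) = (g : GL (Fin n) ℂ).1 * ξ * ((g : GL (Fin n) ℂ)⁻¹).1 →
    γ ζ = γ ξ

/-- The elements `Φ(ξ) - γ(ξ)`, with `ξ` in the Lie algebra of the subgroup `H` of `G`. -/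
def AlgHamiltonianAction.constraints {Q : DefQuant P} {G : Subgroup (GL (Fin n) ℂ)}
    (T : AlgHamiltonianAction Q G) (γ : lieAlg G →ₗ[ℂ] ℂ⟦X⟧) (H : Subgroup G) : Set Q.Alg :=
  {r | ∃ ξ : lieAlg G, (ξ : Matrix (Fin n) (Fin n) ℂ) ∈ lieAlg (H.map G.subtype) ∧
    r = T.comoment ξ - algebraMap ℂ⟦X⟧ Q.Alg (γ ξ)}

end Algebraic

/-! ### Reductions attached to a group action on a deformation quantisation -/

section Reductions

variable {k : Type u} {A : Type v} [Field k] [CommRing A] [Algebra k A] {P : PoissonBracket k A}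
  (Q : DefQuant P) {G : Type*} [Group G] (act : G →* (Q.Alg ≃ₐ[k⟦X⟧] Q.Alg))

/-- The quantum reduction of `(A⟦ħ⟧, ⋆)` by `G`. -/
def quantumOneStage (J : Set Q.Alg) : Subquot k⟦X⟧ Q.Alg :=
  Subquot.oneStage (fun g => (act g : Q.Alg →ₐ[k⟦X⟧] Q.Alg)) J

/-- The quantum reduction of `(A⟦ħ⟧, ⋆)` by `H`, and then by `K`. -/
def quantumTwoStage (H K : Subgroup G) (JH JK : Set Q.Alg) : Subquot k⟦X⟧ Q.Alg :=
  Subquot.twoStage (fun g => (act g : Q.Alg →ₐ[k⟦X⟧] Q.Alg)) H K JH JK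

/-- The classical reduction of `A` by `G`, for the action and the moment map obtained modulo `ħ`.
The Poisson bracket of the reduction is computed on representatives. -/
def classicalOneStage (J : Set Q.Alg) : Subquot k A :=
  Subquot.oneStage (fun g => Q.modHbar (act g : Q.Alg →ₐ[k⟦X⟧] Q.Alg)) (Q.coeff 0 '' J)

/-- The classical reduction of `A` by `H`, and then by `K`. -/
def classicalTwoStage (H K : Subgroup G) (JH JK : Set Q.Alg) : Subquot k A :=
  Subquot.twoStage (fun g => Q.modHbar (act g : Q.Alg →ₐ[k⟦X⟧] Q.Alg)) H K
    (Q.coeff 0 '' JH) (Q.coeff 0 '' JK)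

end Reductions

/-! ### Hamiltonian actions of Lie groups on quantised Poisson manifolds -/

section Smooth

/-- The algebra of smooth `𝕜`-valued functions on a manifold, `𝕜 = ℝ` or `ℂ`. -/
def smoothFunctions (𝕜 : Type*) [RCLike 𝕜] (E : Type*) [NormedAddCommGroup E] [NormedSpace ℝ E]
    (M : Type*) [TopologicalSpace M] [ChartedSpace E M] : Subalgebra 𝕜 (M → 𝕜) where
  carrier := {f | ContMDiff 𝓘(ℝ, E) 𝓘(ℝ, 𝕜) ∞ f}
  mul_mem' := fun hf hg => contDiff_mul.comp_contMDiff (hf.prodMk_space hg)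
  add_mem' := fun hf hg => contDiff_add.comp_contMDiff (hf.prodMk_space hg)
  algebraMap_mem' := fun _ => contMDiff_const

variable {𝕜 : Type*} [RCLike 𝕜]
  {E : Type*} [NormedAddCommGroup E] [NormedSpace ℝ E]
  {M : Type*} [TopologicalSpace M] [ChartedSpace E M]
  {EG : Type*} [NormedAddCommGroup EG] [NormedSpace ℝ EG]
  {G : Type*} [TopologicalSpace G] [ChartedSpace EG G] [Group G]
  {EH : Type*} [NormedAddCommGroup EH] [NormedSpace ℝ EH]
  {H : Type*} [TopologicalSpace H] [ChartedSpace EH H] [Group H]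
  {EK : Type*} [NormedAddCommGroup EK] [NormedSpace ℝ EK]
  {K : Type*} [TopologicalSpace K] [ChartedSpace EK K] [Group K]

/-- The adjoint action of a Lie group on its Lie algebra. -/
def adjoint (g : G) (ξ : GroupLieAlgebra 𝓘(ℝ, EG) G) : GroupLieAlgebra 𝓘(ℝ, EG) G :=
  (mfderiv 𝓘(ℝ, EG) 𝓘(ℝ, EG) (fun a : G => g * a * g⁻¹) 1 ξ : EG)

/-- The Lie group `G` is the semidirect product of the Lie groups `H` and `K`, embedded by `iH`
and `iK`: the product map `H × K → G` is a diffeomorphism, and the image of `H` is normal. -/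
structure IsLieSemidirect (iH : H →* G) (iK : K →* G) : Prop where
  smooth_H : ContMDiff 𝓘(ℝ, EH) 𝓘(ℝ, EG) ∞ iH
  smooth_K : ContMDiff 𝓘(ℝ, EK) 𝓘(ℝ, EG) ∞ iK
  normal : iH.range.Normal
  diffeo : ∃ d : Diffeomorph (𝓘(ℝ, EH).prod 𝓘(ℝ, EK)) 𝓘(ℝ, EG) (H × K) G ∞,
    ∀ p : H × K, d p = iH p.1 * iK p.2

/-- The Lie algebra of `H`, inside that of `G`. -/
def lieRange (iH : H →* G) : Set (GroupLieAlgebra 𝓘(ℝ, EG) G) :=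
  {ξ | ∃ ζ : GroupLieAlgebra 𝓘(ℝ, EH) H, ξ = (mfderiv 𝓘(ℝ, EH) 𝓘(ℝ, EG) iH 1 ζ : EG)}

variable [MulAction G M] {P : PoissonBracket 𝕜 (smoothFunctions 𝕜 E M)}

/-- A quantum Hamiltonian action on a deformation quantisation of the Poisson manifold `M`,
induced by an action of the Lie group `G` on `M`: the action on functions, `(g f)(x) = f(g⁻¹ x)`,
extended coefficientwise to series, preserves `⋆`, and there is a linear `G`-equivariant quantum
comoment map `Φ` with `[Φ(ξ), ·] = ħ ξ_A`, where `ξ_A` is the infinitesimal action. The classical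
moment map `μ : M → 𝔤*`, that is `Φ` modulo `ħ`, is real. -/
structure LieHamiltonianAction (Q : DefQuant P) where
  act : G →* (Q.Alg ≃ₐ[𝕜⟦X⟧] Q.Alg)
  act_apply : ∀ (g : G) (b : Q.Alg) (m : ℕ) (x : M),
    (Q.coeff m (act g b)).1 x = (Q.coeff m b).1 (g⁻¹ • x)
  comoment : GroupLieAlgebra 𝓘(ℝ, EG) G → Q.Alg
  map_add : ∀ ξ ζ, comoment (ξ + ζ) = comoment ξ + comoment ζ
  map_smul : ∀ (c : ℝ) ξ, comoment (c • ξ) = (c : 𝕜) • comoment ξ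
  equivariant : ∀ (g : G) ξ, comoment (adjoint g ξ) = act g (comoment ξ)
  comoment_comm : ∀ ξ (b : Q.Alg), ∃ c : Q.Alg,
    (∀ (m : ℕ) (x : M), (Q.coeff m c).1 x =
      mfderiv 𝓘(ℝ, EG) 𝓘(ℝ, 𝕜) (fun g : G => (Q.coeff m b).1 (g⁻¹ • x)) 1 ξ) ∧
    comoment ξ * b - b * comoment ξ = (PowerSeries.X : 𝕜⟦X⟧) • c
  real : ∀ ξ x, RCLike.im ((Q.coeff 0 (comoment ξ)).1 x) = 0

/-- The elements `Φ(ξ) - γ(ξ)`, with `ξ` in a set `V` of elements of the Lie algebra. -/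
def LieHamiltonianAction.constraints {Q : DefQuant P}
    (T : LieHamiltonianAction (EG := EG) (G := G) Q)
    (γ : GroupLieAlgebra 𝓘(ℝ, EG) G →ₗ[ℝ] 𝕜⟦X⟧) (V : Set (GroupLieAlgebra 𝓘(ℝ, EG) G)) :
    Set Q.Alg :=
  {r | ∃ ξ ∈ V, r = T.comoment ξ - algebraMap 𝕜⟦X⟧ Q.Alg (γ ξ)}

/-- For a Lie subalgebra `V`: the value `γ₀|_V` is a regular value of the moment map
`M → V*`, `x ↦ (ξ ↦ μ_ξ(x))`. At a point of the fibre its differential `T_x M → V*` is onto if and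
only if its transpose, `ξ ↦ d(μ_ξ)_x`, is injective on `V`. -/
def LieHamiltonianAction.IsRegularValue {Q : DefQuant P}
    (T : LieHamiltonianAction (EG := EG) (G := G) Q)
    (γ : GroupLieAlgebra 𝓘(ℝ, EG) G →ₗ[ℝ] 𝕜⟦X⟧) (V : Set (GroupLieAlgebra 𝓘(ℝ, EG) G)) : Prop :=
  ∀ x : M, (∀ ξ ∈ V, (Q.coeff 0 (T.comoment ξ)).1 x = PowerSeries.coeff 0 (γ ξ)) →
    ∀ ξ ∈ V, mfderiv 𝓘(ℝ, E) 𝓘(ℝ, 𝕜) (Q.coeff 0 (T.comoment ξ)).1 x = 0 → ξ = 0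

end Smooth

end QHR

end

/-!
# Quantum Hamiltonian reduction in stages

For `G = H ⋊ K`, let `J = J_H + J_K` be the constraints `Φ(ξ) - γ(ξ)` and `R = (A⟦ħ⟧, ⋆)`. Both
reductions are subquotients `B / L` of `R`. Since every `g ∈ G` is a product and every `ξ ∈ 𝔤` a sum
of components for `H` and `K`, those of the reduction in stages lie in those of the reduction by
`G`: `B₂ ⊆ B₁` and `L₂ ⊆ L₁` (`Subquot.twoStage_B_le`, `Subquot.twoStage_L_le`). It remains to show
`B₂ ∩ L₁ ⊆ L₂` and `B₁ ⊆ B₂ + L₁`. Because the Lie algebras are finite dimensional, all these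
submodules are closed under sums `∑ ħⁱ uᵢ`, so that both inclusions follow by successive
approximation from inclusions modulo `ħ` (`DefQuant.HClosed.subset_of_approx`). Remainders
have to stay in the same set, which comes down to the absence of `ħ`-torsion.

**Algebraic groups.** The remainders are controlled by the assumption that the reductions are
deformation quantisations (`isNaturalIso_of_quantises`). The only geometric input is
`Lie G = Lie H + Lie K`, by differentiating the projections
(`IsAlgSemidirect.exists_add`).

**Lie groups.** Neither slices nor the smooth structure of the quotients are used, only the
following facts about the zero sets `Z_H ⊇ Z_G` of the classical constraints.

* At a regular value, functions vanishing on the zero set are combinations of the moments `fᵢ`, and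
  relations `∑ rᵢ fᵢ = 0` are generated by the trivial ones: the Koszul complex is exact
  (`exists_eq_sum_of_vanish`, `exists_antisymm_of_relation`). Both are local, and follow by
  integration along rays in coordinates that include the `fᵢ`.
* Exactness, with `[Φ(ξ), Φ(ζ)] = ħ Φ([ξ, ζ])` and `γ([ξ, ζ]) = 0` (`exists_comoment_bracket`),
  gives that the quotient of `R` by the left ideal of the constraints has no `ħ`-torsion
  (`IsRegularSystem.mem_of_X_smul_mem`).
* For a proper action there is a retraction of the smooth functions onto the invariant ones that is
  linear over functions constant on orbits, by averaging against a cutoff function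
  (`exists_average`).

Classically, a function that is invariant on `Z_G` agrees there with its average, which gives
surjectivity. For injectivity, a function that is `H`-invariant on `Z_H` and vanishes on `Z_G` is a
combination of moments of `H` and `K`. Averaging over `H` makes the coefficients of the moments of
`K` invariant under `H`, because these moments are themselves `H`-invariant on `Z_H`
(`IsStagedSystem.exists_eq_sum_add_sum`). The same elements serve in the quantum case: a constant
series that is invariant under a group commutes with the moments of that group, since the
commutators are `ħ` times the infinitesimal action.
-/

namespace QHR

/-! ### Subquotients and reduction in stages -/

namespace Subquot

variable {S R : Type*} [CommRing S] [Ring R] [Algebra S R]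

lemma mul_mem_momentIdeal (P : Subquot S R) {J : Set R} {b j : R} (hb : b ∈ P.B) (hj : j ∈ J) :
    b * j ∈ P.momentIdeal J :=
  Submodule.mem_sup_right (Submodule.subset_span ⟨b, hb, j, hj, rfl⟩)

lemma mem_momentIdeal_of_mem (P : Subquot S R) {J : Set R} {j : R} (hj : j ∈ J) :
    j ∈ P.momentIdeal J := by
  simpa using P.mul_mem_momentIdeal (one_mem P.B) hj

lemma L_le_momentIdeal (P : Subquot S R) (J : Set R) : P.L ≤ P.momentIdeal J := le_sup_left

lemma momentIdeal_le (P : Subquot S R) {J : Set R} {N : Submodule S R} (hL : P.L ≤ N)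
    (hJ : ∀ b ∈ P.B, ∀ j ∈ J, b * j ∈ N) : P.momentIdeal J ≤ N := by
  refine sup_le hL (Submodule.span_le.2 ?_)
  rintro r ⟨b, hb, j, hj, rfl⟩
  exact hJ b hb j hj

/-- In a reduction, stability of the left ideal under right multiplication by `a` only has to be
checked on the generators `J`. -/
lemma mem_reduce_B {P : Subquot S R} {Γ : Type*} {ρ : Γ → R →ₐ[S] R} {J : Set R} {a : R} :
    a ∈ (P.reduce ρ J).B ↔ a ∈ P.B ∧ (∀ g, ρ g a ∈ P.B ∧ ρ g a - a ∈ P.momentIdeal J) ∧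
      ∀ j ∈ J, j * a ∈ P.momentIdeal J := by
  refine ⟨fun h => ⟨h.1, h.2.1, fun j hj => h.2.2 j (P.mem_momentIdeal_of_mem hj)⟩,
    fun h => ⟨h.1, h.2.1, fun l hl => ?_⟩⟩
  have : P.momentIdeal J ≤ (P.momentIdeal J).comap (LinearMap.mulRight S a) := by
    refine P.momentIdeal_le (fun l hl => ?_) (fun b hb j hj => ?_)
    · exact P.L_le_momentIdeal J (P.right_mem l hl a h.1)
    · change b * j * a ∈ P.momentIdeal J
      rw [mul_assoc]
      exact P.momentIdeal_left J hb (h.2.2 j hj)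
  exact this hl

lemma mem_oneStage_B {G : Type*} [Group G] {ρ : G → R →ₐ[S] R} {J : Set R} {a : R} :
    a ∈ (oneStage ρ J).B ↔ (∀ g, ρ g a - a ∈ (oneStage ρ J).L) ∧
      ∀ j ∈ J, j * a ∈ (oneStage ρ J).L := by
  refine mem_reduce_B.trans ⟨fun h => ⟨fun g => (h.2.1 g).2, h.2.2⟩,
    fun h => ⟨?_, fun g => ⟨?_, h.1 g⟩, h.2⟩⟩
  · exact Algebra.mem_top
  · exact Algebra.mem_top

lemma mul_mem_oneStage_L {G : Type*} [Group G] (ρ : G → R →ₐ[S] R) {J : Set R} (b : R) {l : R}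
    (hl : l ∈ (oneStage ρ J).L) : b * l ∈ (oneStage ρ J).L :=
  (whole S R).momentIdeal_left J (b := b) Algebra.mem_top hl

lemma mem_oneStage_L_of_mem {G : Type*} [Group G] (ρ : G → R →ₐ[S] R) {J : Set R} {j : R}
    (hj : j ∈ J) : j ∈ (oneStage ρ J).L :=
  (whole S R).mem_momentIdeal_of_mem hj

lemma oneStage_L_le {G : Type*} [Group G] {ρ : G → R →ₐ[S] R} {J : Set R} {N : Submodule S R}
    (hJ : ∀ b : R, ∀ j ∈ J, b * j ∈ N) : (oneStage ρ J).L ≤ N :=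
  (whole S R).momentIdeal_le (by intro x hx; rw [(Submodule.mem_bot S).1 hx]; exact zero_mem _)
    (fun b _ => hJ b)

/-- Two subquotients are naturally isomorphic if the numerators and denominators of the first lie
in those of the second and the induced map is injective and surjective. -/
lemma isNaturalIso_of {P₁ P₂ : Subquot S R} (hB : P₁.B ≤ P₂.B) (hL : P₁.L ≤ P₂.L)
    (hinj : ∀ a ∈ P₁.B, a ∈ P₂.L → a ∈ P₁.L)
    (hsurj : ∀ a ∈ P₂.B, ∃ b ∈ P₁.B, a - b ∈ P₂.L) : P₁.IsNaturalIso P₂ := by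
  let f : P₁.B →ₐ[S] P₂.Alg :=
    (Ideal.Quotient.mkₐ S P₂.ker).comp (Subalgebra.inclusion hB)
  have hf : ∀ a : P₁.B, f a = P₂.cls ⟨a, hB a.2⟩ := fun a => rfl
  have hcls : ∀ {P : Subquot S R} (a : P.B), P.cls a = 0 ↔ (a : R) ∈ P.L := fun a =>
    Ideal.Quotient.eq_zero_iff_mem
  let φ : P₁.Alg →ₐ[S] P₂.Alg := Ideal.Quotient.liftₐ P₁.ker f
    (fun a ha => by rw [hf, hcls]; exact hL ha)
  have hφ : ∀ a : P₁.B, φ (P₁.cls a) = P₂.cls ⟨a, hB a.2⟩ := fun a => rfl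
  have hb : Function.Bijective φ := by
    constructor
    · rw [injective_iff_map_eq_zero]
      intro u hu
      obtain ⟨a, rfl⟩ := Ideal.Quotient.mk_surjective u
      change P₁.cls a = 0
      change φ (P₁.cls a) = 0 at hu
      rw [hφ, hcls] at hu
      exact (hcls a).2 (hinj a a.2 hu)
    · intro v
      obtain ⟨a, rfl⟩ := Ideal.Quotient.mk_surjective v
      obtain ⟨b, hb, hab⟩ := hsurj a a.2
      refine ⟨P₁.cls ⟨b, hb⟩, ?_⟩
      rw [hφ]
      exact (Ideal.Quotient.eq.2 (by
        change (b : R) - a ∈ P₂.L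
        rw [← neg_sub]; exact neg_mem hab))
  exact ⟨AlgEquiv.ofBijective φ hb, fun a => ⟨hB a.2, hφ a⟩⟩

section Stages

variable {G : Type*} [Group G] {ρ : G → R →ₐ[S] R} {H K : Subgroup G} {JH JK J : Set R}

lemma mem_twoStage_B {a : R} :
    a ∈ (twoStage ρ H K JH JK).B ↔ a ∈ (oneStage (fun h : H => ρ h) JH).B ∧
      (∀ g : K, ρ g a ∈ (oneStage (fun h : H => ρ h) JH).B ∧
        ρ g a - a ∈ (twoStage ρ H K JH JK).L) ∧
      ∀ j ∈ JK, j * a ∈ (twoStage ρ H K JH JK).L :=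
  mem_reduce_B

lemma oneStage_L_le_twoStage_L :
    (oneStage (fun h : H => ρ h) JH).L ≤ (twoStage ρ H K JH JK).L :=
  L_le_momentIdeal _ _

lemma mul_mem_twoStage_L {b j : R} (hb : b ∈ (oneStage (fun h : H => ρ h) JH).B) (hj : j ∈ JK) :
    b * j ∈ (twoStage ρ H K JH JK).L :=
  mul_mem_momentIdeal _ hb hj

lemma twoStage_L_le (hH : JH ⊆ J) (hK : JK ⊆ J) :
    (twoStage ρ H K JH JK).L ≤ (oneStage ρ J).L := by
  refine momentIdeal_le _ (oneStage_L_le fun b j hj => ?_) (fun b _ j hj => ?_)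
  · exact mul_mem_oneStage_L ρ b (mem_oneStage_L_of_mem ρ (hH hj))
  · exact mul_mem_oneStage_L ρ b (mem_oneStage_L_of_mem ρ (hK hj))

/-- What survives reduction in stages survives the reduction in one stage. -/
lemma twoStage_B_le (hρ : ∀ g g' a, ρ (g * g') a = ρ g (ρ g' a))
    (hG : ∀ g : G, ∃ h : H, ∃ l : K, g = h * l) (hH : JH ⊆ J) (hK : JK ⊆ J)
    (hJ : ∀ j ∈ J, ∃ x ∈ JH, ∃ y ∈ JK, j = x + y) :
    (twoStage ρ H K JH JK).B ≤ (oneStage ρ J).B := by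
  intro a ha
  obtain ⟨haH, haK, har⟩ := mem_twoStage_B.1 ha
  have hL := twoStage_L_le (ρ := ρ) (H := H) (K := K) hH hK
  have hL' := oneStage_L_le_twoStage_L (ρ := ρ) (H := H) (K := K) (JH := JH) (JK := JK)
  refine mem_oneStage_B.2 ⟨fun g => ?_, fun j hj => ?_⟩
  · obtain ⟨h, l, rfl⟩ := hG g
    have e : ρ (h * l) a - a = (ρ h (ρ l a) - ρ l a) + (ρ l a - a) := by rw [hρ]; abel
    rw [e]
    exact add_mem (hL (hL' ((mem_oneStage_B.1 (haK l).1).1 h))) (hL (haK l).2)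
  · obtain ⟨x, hx, y, hy, rfl⟩ := hJ j hj
    rw [add_mul]
    exact add_mem (hL (hL' ((mem_oneStage_B.1 haH).2 x hx))) (hL (har y hy))

end Stages

end Subquot

/-! ### Convergence in powers of `ħ` -/

section Hbar

variable {k A : Type*} [Field k] [CommRing A] [Algebra k A] {P : PoissonBracket k A}
  (Q : DefQuant P)

namespace DefQuant

lemma coeff_succ_X_smul (n : ℕ) (a : Q.Alg) :
    Q.coeff (n + 1) ((PowerSeries.X : k⟦X⟧) • a) = Q.coeff n a := by
  change PowerSeries.coeff (n + 1) (PowerSeries.map (algebraMap k A) PowerSeries.X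
    * (show A⟦X⟧ from a)) = _
  rw [PowerSeries.map_X, PowerSeries.coeff_succ_X_mul]
  rfl

variable {Q} in
@[ext] lemma alg_ext {a b : Q.Alg} (h : ∀ n, Q.coeff n a = Q.coeff n b) : a = b :=
  PowerSeries.ext h

lemma coeff_sub (n : ℕ) (a b : Q.Alg) : Q.coeff n (a - b) = Q.coeff n a - Q.coeff n b :=
  map_sub (PowerSeries.coeff (R := A) n) _ _

lemma coeff_zero' (n : ℕ) : Q.coeff n (0 : Q.Alg) = 0 :=
  map_zero (PowerSeries.coeff (R := A) n)

lemma X_smul_injective {a b : Q.Alg} (h : (PowerSeries.X : k⟦X⟧) • a = (PowerSeries.X : k⟦X⟧) • b) :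
    a = b := by
  ext n
  rw [← Q.coeff_succ_X_smul, h, Q.coeff_succ_X_smul]

lemma exists_X_smul_of_coeff_zero {a : Q.Alg} (h : Q.coeff 0 a = 0) :
    ∃ b : Q.Alg, a = (PowerSeries.X : k⟦X⟧) • b := by
  obtain ⟨b, hb⟩ := Q.exists_eq a
  refine ⟨b, ?_⟩
  have h0 : Q.const 0 = 0 := map_zero (PowerSeries.C (R := A))
  rwa [h, h0, zero_add] at hb

/-- Two sequences obeying the same recursion `s n = u n + ħ s (n + 1)` agree. -/
lemma eq_of_recursion {u s t : ℕ → Q.Alg}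
    (hs : ∀ n, s n = u n + (PowerSeries.X : k⟦X⟧) • s (n + 1))
    (ht : ∀ n, t n = u n + (PowerSeries.X : k⟦X⟧) • t (n + 1)) : s 0 = t 0 := by
  have h : ∀ m n, Q.coeff m (s n) = Q.coeff m (t n) := by
    intro m
    induction m with
    | zero => intro n; rw [hs, ht, coeff_add, coeff_add, coeff_zero_X_smul, coeff_zero_X_smul]
    | succ m ih =>
      intro n
      rw [hs, ht, coeff_add, coeff_add, coeff_succ_X_smul, coeff_succ_X_smul, ih]
  exact Q.alg_ext fun m => h m 0

/-- The `ħ`-adically convergent sum `∑ ħⁱ uᵢ`. -/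
noncomputable def hsum (u : ℕ → Q.Alg) : Q.Alg :=
  (PowerSeries.mk fun m => ∑ i ∈ Finset.range (m + 1), Q.coeff (m - i) (u i) : A⟦X⟧)

lemma coeff_hsum (u : ℕ → Q.Alg) (m : ℕ) :
    Q.coeff m (Q.hsum u) = ∑ i ∈ Finset.range (m + 1), Q.coeff (m - i) (u i) :=
  PowerSeries.coeff_mk _ _

lemma hsum_eq (u : ℕ → Q.Alg) :
    Q.hsum u = u 0 + (PowerSeries.X : k⟦X⟧) • Q.hsum fun n => u (n + 1) := by
  ext m
  rw [coeff_hsum, coeff_add]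
  cases m with
  | zero => rw [coeff_zero_X_smul]; simp
  | succ m =>
    rw [coeff_succ_X_smul, coeff_hsum, Finset.sum_range_succ', add_comm]
    simp

lemma hsum_shift (u : ℕ → Q.Alg) (n : ℕ) :
    Q.hsum (fun i => u (i + n))
      = u n + (PowerSeries.X : k⟦X⟧) • Q.hsum fun i => u (i + (n + 1)) := by
  rw [hsum_eq]
  simp only [zero_add, add_assoc, add_comm 1 n]

lemma map_hsum (φ : Q.Alg →ₗ[k⟦X⟧] Q.Alg) (u : ℕ → Q.Alg) :
    φ (Q.hsum u) = Q.hsum fun i => φ (u i) :=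
  Q.eq_of_recursion (u := fun i => φ (u i)) (s := fun n => φ (Q.hsum fun i => u (i + n)))
    (t := fun n => Q.hsum fun i => φ (u (i + n)))
    (fun n => by rw [hsum_shift, map_add, map_smul])
    (fun n => Q.hsum_shift (fun i => φ (u i)) n)

lemma hsum_add (u v : ℕ → Q.Alg) : Q.hsum (fun i => u i + v i) = Q.hsum u + Q.hsum v := by
  ext m
  simp only [coeff_add, coeff_hsum, Finset.sum_add_distrib]

/-- A set of series closed under `ħ`-adically convergent sums `∑ ħⁱ lᵢ`. -/
def HClosed (L : Set Q.Alg) : Prop := ∀ u : ℕ → Q.Alg, (∀ i, u i ∈ L) → Q.hsum u ∈ L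

variable {Q}

/-- Successive approximation: if every element of `W` lies in `L + ħ W`, where `L` is closed under
`ħ`-adic sums, then `W ⊆ L`. -/
lemma HClosed.subset_of_approx {L W : Set Q.Alg} (hL : Q.HClosed L)
    (h : ∀ a ∈ W, ∃ l ∈ L, ∃ w ∈ W, a = l + (PowerSeries.X : k⟦X⟧) • w) : W ⊆ L := by
  intro a ha
  choose l hl w hw e using h
  let s : ℕ → {x : Q.Alg // x ∈ W} :=
    fun n => Nat.rec ⟨a, ha⟩ (fun _ x => ⟨w x.1 x.2, hw x.1 x.2⟩) n
  have hs : ∀ n, (s n).1 = l (s n).1 (s n).2 + (PowerSeries.X : k⟦X⟧) • (s (n + 1)).1 :=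
    fun n => e (s n).1 (s n).2
  have key := Q.eq_of_recursion (u := fun n => l (s n).1 (s n).2) (s := fun n => (s n).1) hs
    (fun n => Q.hsum_shift (fun i => l (s i).1 (s i).2) n)
  change a = _ at key
  rw [key]
  exact hL _ fun i => hl _ _

lemma HClosed.sup {L N : Submodule k⟦X⟧ Q.Alg} (hL : Q.HClosed (L : Set Q.Alg))
    (hN : Q.HClosed (N : Set Q.Alg)) : Q.HClosed ((L ⊔ N : Submodule k⟦X⟧ Q.Alg) : Set Q.Alg) := by
  intro u hu
  choose x hx y hy e using fun i => Submodule.mem_sup.1 (hu i)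
  have : u = fun i => x i + y i := funext fun i => (e i).symm
  rw [this, hsum_add]
  exact Submodule.add_mem_sup (hL _ hx) (hN _ hy)

lemma HClosed.map {L : Submodule k⟦X⟧ Q.Alg} (hL : Q.HClosed (L : Set Q.Alg))
    (φ : Q.Alg →ₗ[k⟦X⟧] Q.Alg) : Q.HClosed ((L.map φ : Submodule k⟦X⟧ Q.Alg) : Set Q.Alg) := by
  intro u hu
  choose x hx e using fun i => Submodule.mem_map.1 (hu i)
  have : u = fun i => φ (x i) := funext fun i => (e i).symm
  rw [this, ← map_hsum]
  exact Submodule.mem_map_of_mem (hL _ hx)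

lemma HClosed.bot : Q.HClosed ((⊥ : Submodule k⟦X⟧ Q.Alg) : Set Q.Alg) := by
  have h : (⊤ : Submodule k⟦X⟧ Q.Alg).map (0 : Q.Alg →ₗ[k⟦X⟧] Q.Alg) = ⊥ := Submodule.map_zero _
  rw [← h]
  exact HClosed.map (fun _ _ => Submodule.mem_top) _

/-- A left ideal with finitely many generators is closed under `ħ`-adic sums, and so are its
analogues inside a subquotient. -/
lemma HClosed.momentIdeal {N : Subquot k⟦X⟧ Q.Alg} (hB : Q.HClosed (N.B : Set Q.Alg))
    (hL : Q.HClosed (N.L : Set Q.Alg)) {J : Set Q.Alg} {d : ℕ} {j : Fin d → Q.Alg}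
    (hj : ∀ i, j i ∈ J) (hJ : J ⊆ Submodule.span k⟦X⟧ (Set.range j)) :
    Q.HClosed (N.momentIdeal J : Set Q.Alg) := by
  -- `W = ∑ᵢ B jᵢ` is a finite sum of images of `B`
  let W : Submodule k⟦X⟧ Q.Alg := Finset.univ.sup fun i =>
    (Subalgebra.toSubmodule N.B).map (LinearMap.mulRight k⟦X⟧ (j i))
  have hW : Q.HClosed (W : Set Q.Alg) := by
    refine Finset.sup_induction (p := fun V : Submodule k⟦X⟧ Q.Alg => Q.HClosed (V : Set Q.Alg))
      HClosed.bot (fun _ h _ h' => h.sup h') (fun i _ => HClosed.map hB _)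
  have e : N.momentIdeal J = N.L ⊔ W := by
    refine le_antisymm (N.momentIdeal_le le_sup_left fun b hb x hx => ?_) (sup_le ?_ ?_)
    · refine Submodule.mem_sup_right ?_
      have hx' := hJ hx
      have : Submodule.span k⟦X⟧ (Set.range j) ≤ W.comap (LinearMap.mulLeft k⟦X⟧ b) := by
        rw [Submodule.span_le]
        rintro _ ⟨i, rfl⟩
        exact Finset.le_sup (f := fun i =>
          (Subalgebra.toSubmodule N.B).map (LinearMap.mulRight k⟦X⟧ (j i))) (Finset.mem_univ i)
          (Submodule.mem_map.2 ⟨b, hb, rfl⟩)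
      exact this hx'
    · exact N.L_le_momentIdeal J
    · refine Finset.sup_le fun i _ => ?_
      rw [Submodule.map_le_iff_le_comap]
      exact fun b hb => N.mul_mem_momentIdeal hb (hj i)
  rw [e]
  exact hL.sup hW

lemma HClosed.reduce {N : Subquot k⟦X⟧ Q.Alg} {Γ : Type*} {ρ : Γ → Q.Alg →ₐ[k⟦X⟧] Q.Alg}
    {J : Set Q.Alg} (hB : Q.HClosed (N.B : Set Q.Alg))
    (hM : Q.HClosed (N.momentIdeal J : Set Q.Alg)) :
    Q.HClosed ((N.reduce ρ J).B : Set Q.Alg) := by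
  intro u hu
  have hu' := fun i => Subquot.mem_reduce_B.1 (hu i)
  refine Subquot.mem_reduce_B.2 ⟨hB u fun i => (hu' i).1, fun g => ⟨?_, ?_⟩, fun j hj => ?_⟩
  · have := Q.map_hsum (ρ g).toLinearMap u
    simp only [AlgHom.toLinearMap_apply] at this
    rw [this]
    exact hB _ fun i => ((hu' i).2.1 g).1
  · have := Q.map_hsum ((ρ g).toLinearMap - LinearMap.id) u
    simp only [AlgHom.toLinearMap_apply, LinearMap.sub_apply, LinearMap.id_apply] at this
    rw [this]
    exact hM _ fun i => ((hu' i).2.1 g).2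
  · have := Q.map_hsum (LinearMap.mulLeft k⟦X⟧ j) u
    simp only [LinearMap.mulLeft_apply] at this
    rw [this]
    exact hM _ fun i => (hu' i).2.2 j hj

end DefQuant

open Subquot

variable {Q}

lemma C_smul_alg (c : k) (a : Q.Alg) : (PowerSeries.C c : k⟦X⟧) • a = c • a := by
  change PowerSeries.map (algebraMap k A) (PowerSeries.C c) * (show A⟦X⟧ from a)
    = c • (show A⟦X⟧ from a)
  rw [PowerSeries.map_C, ← PowerSeries.smul_eq_C_mul, algebraMap_smul]

lemma algebraMap_smul_alg (c : k) (r : k⟦X⟧) :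
    algebraMap k⟦X⟧ Q.Alg (c • r) = c • algebraMap k⟦X⟧ Q.Alg r := by
  rw [← C_smul_alg, PowerSeries.smul_eq_C_mul, map_mul, ← Algebra.smul_def]

variable {G : Type*} [Group G] {H K : Subgroup G}
  {JH JK J : Set Q.Alg}

/-- Finiteness of a set of constraints: it is spanned by finitely many of its members. -/
def FinSpanned (J : Set Q.Alg) : Prop :=
  ∃ (d : ℕ) (j : Fin d → Q.Alg), (∀ i, j i ∈ J) ∧ J ⊆ Submodule.span k⟦X⟧ (Set.range j)

lemma FinSpanned.oneStage_L {Γ : Type*} [Group Γ] (ρ : Γ → Q.Alg →ₐ[k⟦X⟧] Q.Alg)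
    (hJ : FinSpanned J) : Q.HClosed ((oneStage ρ J).L : Set Q.Alg) := by
  obtain ⟨d, j, h1, h2⟩ := hJ
  exact DefQuant.HClosed.momentIdeal (N := whole k⟦X⟧ Q.Alg) (fun _ _ => Algebra.mem_top)
    DefQuant.HClosed.bot h1 h2

lemma FinSpanned.oneStage_B {Γ : Type*} [Group Γ] (ρ : Γ → Q.Alg →ₐ[k⟦X⟧] Q.Alg)
    (hJ : FinSpanned J) : Q.HClosed ((oneStage ρ J).B : Set Q.Alg) :=
  DefQuant.HClosed.reduce (N := whole k⟦X⟧ Q.Alg) (fun _ _ => Algebra.mem_top)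
    (hJ.oneStage_L ρ)

lemma FinSpanned.twoStage_L {ρ : G → Q.Alg →ₐ[k⟦X⟧] Q.Alg} (hH : FinSpanned JH)
    (hK : FinSpanned JK) : Q.HClosed ((twoStage ρ H K JH JK).L : Set Q.Alg) := by
  obtain ⟨d, j, h1, h2⟩ := hK
  exact DefQuant.HClosed.momentIdeal (hH.oneStage_B _) (hH.oneStage_L _) h1 h2

lemma FinSpanned.twoStage_B {ρ : G → Q.Alg →ₐ[k⟦X⟧] Q.Alg} (hH : FinSpanned JH)
    (hK : FinSpanned JK) : Q.HClosed ((twoStage ρ H K JH JK).B : Set Q.Alg) :=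
  DefQuant.HClosed.reduce (hH.oneStage_B _) (FinSpanned.twoStage_L (K := K) hH hK)

end Hbar

/-! ### Lifting a classical isomorphism along deformation quantisations -/

section Lifting

variable {k A : Type*} [Field k] [CommRing A] [Algebra k A] {P : PoissonBracket k A}
  {Q : DefQuant P}

lemma Subquot.cls_eq_zero {S R : Type*} [CommRing S] [Ring R] [Algebra S R] (N : Subquot S R)
    (a : N.B) : N.cls a = 0 ↔ (a : R) ∈ N.L :=
  Ideal.Quotient.eq_zero_iff_mem

lemma Subquot.cls_surjective {S R : Type*} [CommRing S] [Ring R] [Algebra S R]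
    (N : Subquot S R) : Function.Surjective N.cls :=
  Ideal.Quotient.mk_surjective

/-- An element of a quantisation whose constant term vanishes classically is divisible by `ħ`. -/
lemma Quantises.exists_of_coeff_mem {N : Subquot k⟦X⟧ Q.Alg} {C : Subquot k A}
    (h : Quantises Q N C) {a : Q.Alg} (ha : a ∈ N.B) (ha0 : Q.coeff 0 a ∈ C.L) :
    ∃ w ∈ N.B, a - (PowerSeries.X : k⟦X⟧) • w ∈ N.L := by
  obtain ⟨⟨π, hπ, -, hker⟩, -⟩ := h
  obtain ⟨h0, e⟩ := hπ ⟨a, ha⟩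
  have hz : π (N.cls ⟨a, ha⟩) = 0 := by
    rw [e, C.cls_eq_zero]; exact ha0
  obtain ⟨w, hw⟩ := (hker _).1 hz
  obtain ⟨b, rfl⟩ := N.cls_surjective w
  refine ⟨b, b.2, ?_⟩
  have hX : (PowerSeries.X : k⟦X⟧) • N.cls b = N.cls ((PowerSeries.X : k⟦X⟧) • b) := rfl
  rw [hX] at hw
  exact Ideal.Quotient.eq.1 hw

lemma Quantises.coeff_mem {N : Subquot k⟦X⟧ Q.Alg} {C : Subquot k A}
    (h : Quantises Q N C) {a : Q.Alg} (ha : a ∈ N.B) : Q.coeff 0 a ∈ C.B :=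
  let ⟨⟨_, hπ, _, _⟩, _⟩ := h
  (hπ ⟨a, ha⟩).1

lemma Quantises.coeff_mem_L {N : Subquot k⟦X⟧ Q.Alg} {C : Subquot k A}
    (h : Quantises Q N C) {a : Q.Alg} (ha : a ∈ N.B) (hL : a ∈ N.L) : Q.coeff 0 a ∈ C.L := by
  obtain ⟨⟨π, hπ, -, -⟩, -⟩ := h
  obtain ⟨h0, e⟩ := hπ ⟨a, ha⟩
  rw [(N.cls_eq_zero ⟨a, ha⟩).2 hL, map_zero] at e
  exact (C.cls_eq_zero ⟨_, h0⟩).1 e.symm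

lemma Quantises.exists_lift {N : Subquot k⟦X⟧ Q.Alg} {C : Subquot k A}
    (h : Quantises Q N C) {f : A} (hf : f ∈ C.B) : ∃ a ∈ N.B, f - Q.coeff 0 a ∈ C.L := by
  obtain ⟨⟨π, hπ, hsurj, -⟩, -⟩ := h
  obtain ⟨u, hu⟩ := hsurj (C.cls ⟨f, hf⟩)
  obtain ⟨a, rfl⟩ := N.cls_surjective u
  obtain ⟨h0, e⟩ := hπ a
  refine ⟨a, a.2, ?_⟩
  rw [e] at hu
  exact Ideal.Quotient.eq.1 hu.symm

lemma Quantises.mem_of_X_smul_mem {N : Subquot k⟦X⟧ Q.Alg} {C : Subquot k A}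
    (h : Quantises Q N C) {a : Q.Alg} (ha : a ∈ N.B) (hL : (PowerSeries.X : k⟦X⟧) • a ∈ N.L) :
    a ∈ N.L := by
  refine (N.cls_eq_zero ⟨a, ha⟩).1 (h.2 _ ?_)
  exact (N.cls_eq_zero ((PowerSeries.X : k⟦X⟧) • ⟨a, ha⟩)).2 hL

/-- A natural map between deformation quantisations which is an isomorphism modulo `ħ` is an
isomorphism, as soon as the numerators and denominators are closed under `ħ`-adic sums. -/
theorem isNaturalIso_of_quantises {N₁ N₂ : Subquot k⟦X⟧ Q.Alg} {C₁ C₂ : Subquot k A}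
    (h₁ : Quantises Q N₁ C₁) (h₂ : Quantises Q N₂ C₂) (hB : N₁.B ≤ N₂.B) (hL : N₁.L ≤ N₂.L)
    (cB : Q.HClosed (N₁.B : Set Q.Alg)) (cL₁ : Q.HClosed (N₁.L : Set Q.Alg))
    (cL₂ : Q.HClosed (N₂.L : Set Q.Alg)) (hC : C₁.IsNaturalIso C₂) : N₁.IsNaturalIso N₂ := by
  obtain ⟨φ, hφ⟩ := hC
  refine Subquot.isNaturalIso_of hB hL (fun a ha haL => ?_) (fun a ha => ?_)
  · refine cL₁.subset_of_approx (W := {a | a ∈ N₁.B ∧ a ∈ N₂.L}) ?_ ⟨ha, haL⟩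
    rintro a ⟨ha, haL⟩
    have h0 : Q.coeff 0 a ∈ C₁.L := by
      obtain ⟨h', e⟩ := hφ ⟨_, h₁.coeff_mem ha⟩
      refine (C₁.cls_eq_zero ⟨_, h₁.coeff_mem ha⟩).1 (φ.injective ?_)
      rw [e, map_zero, C₂.cls_eq_zero]
      exact h₂.coeff_mem_L (hB ha) haL
    obtain ⟨w, hw, hwL⟩ := h₁.exists_of_coeff_mem ha h0
    refine ⟨_, hwL, w, ⟨hw, h₂.mem_of_X_smul_mem (hB hw) ?_⟩, by abel⟩
    have : (PowerSeries.X : k⟦X⟧) • w = a - (a - (PowerSeries.X : k⟦X⟧) • w) := by abel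
    rw [this]
    exact sub_mem haL (hL hwL)
  · have key : (N₂.B : Set Q.Alg) ⊆ (Subalgebra.toSubmodule N₁.B ⊔ N₂.L : Submodule _ _) := by
      refine (DefQuant.HClosed.sup cB cL₂).subset_of_approx fun a ha => ?_
      obtain ⟨u, hu⟩ := φ.surjective (C₂.cls ⟨_, h₂.coeff_mem ha⟩)
      obtain ⟨f, rfl⟩ := C₁.cls_surjective u
      obtain ⟨b, hb, hfb⟩ := h₁.exists_lift f.2
      have h0 : Q.coeff 0 (a - b) ∈ C₂.L := by
        obtain ⟨h', e⟩ := hφ ⟨_, h₁.coeff_mem hb⟩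
        have e' : C₁.cls f = C₁.cls ⟨_, h₁.coeff_mem hb⟩ := Ideal.Quotient.eq.2 hfb
        rw [e', e] at hu
        rw [Q.coeff_sub]
        exact Ideal.Quotient.eq.1 hu.symm
      obtain ⟨w, hw, hwL⟩ := h₂.exists_of_coeff_mem (sub_mem ha (hB hb)) h0
      exact ⟨_, Submodule.add_mem_sup hb hwL, w, hw, by abel⟩
    obtain ⟨b, hb, l, hl, rfl⟩ := Submodule.mem_sup.1 (key ha)
    exact ⟨b, hb, by rwa [add_sub_cancel_left]⟩

end Lifting

/-! ### The Lie algebra of an algebraic semidirect product -/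

section AlgLie

open MvPolynomial

variable {n : ℕ}

lemma derivAtOne_C (c : ℂ) (ξ : Matrix (Fin n) (Fin n) ℂ) :
    derivAtOne (C c : MvPolynomial (Coord n) ℂ) ξ = 0 := by
  simp [derivAtOne, evalAt]

lemma derivAtOne_X (i : Coord n) (ξ : Matrix (Fin n) (Fin n) ℂ) :
    derivAtOne (X i : MvPolynomial (Coord n) ℂ) ξ = tangent ξ i := by
  classical
  unfold derivAtOne evalAt
  rw [Finset.sum_eq_single i]
  · simp
  · intro j _ hj
    rw [pderiv_X_of_ne hj.symm]; simp
  · simp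

lemma derivAtOne_add (p q : MvPolynomial (Coord n) ℂ) (ξ : Matrix (Fin n) (Fin n) ℂ) :
    derivAtOne (p + q) ξ = derivAtOne p ξ + derivAtOne q ξ := by
  simp [derivAtOne, evalAt, mul_add, Finset.sum_add_distrib]

lemma derivAtOne_mul (p q : MvPolynomial (Coord n) ℂ) (ξ : Matrix (Fin n) (Fin n) ℂ) :
    derivAtOne (p * q) ξ = derivAtOne p ξ * evalAt q 1 + evalAt p 1 * derivAtOne q ξ := by
  simp only [derivAtOne, evalAt, Derivation.leibniz, smul_eq_mul, map_add, map_mul, mul_add,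
    Finset.sum_add_distrib, Finset.sum_mul, Finset.mul_sum]
  rw [add_comm]
  congr 1 <;> exact Finset.sum_congr rfl fun i _ => by ring

lemma derivAtOne_sum {ι : Type*} (s : Finset ι) (p : ι → MvPolynomial (Coord n) ℂ)
    (ξ : Matrix (Fin n) (Fin n) ℂ) :
    derivAtOne (∑ l ∈ s, p l) ξ = ∑ l ∈ s, derivAtOne (p l) ξ := by
  classical
  induction s using Finset.induction_on with
  | empty => simpa using derivAtOne_C 0 ξ
  | insert a s ha ih => rw [Finset.sum_insert ha, Finset.sum_insert ha, derivAtOne_add, ih]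

lemma evalAt_mul (p q : MvPolynomial (Coord n) ℂ) (g : GL (Fin n) ℂ) :
    evalAt (p * q) g = evalAt p g * evalAt q g := map_mul _ _ _

lemma evalAt_sum {ι : Type*} (s : Finset ι) (p : ι → MvPolynomial (Coord n) ℂ)
    (g : GL (Fin n) ℂ) : evalAt (∑ l ∈ s, p l) g = ∑ l ∈ s, evalAt (p l) g := map_sum _ _ _

lemma evalAt_X (i : Coord n) (g : GL (Fin n) ℂ) :
    evalAt (X i : MvPolynomial (Coord n) ℂ) g = pt g i := eval_X _

lemma evalAt_bind {p : Coord n → MvPolynomial (Coord n) ℂ} {g g' : GL (Fin n) ℂ}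
    (h : ∀ i, evalAt (p i) g = pt g' i) (q : MvPolynomial (Coord n) ℂ) :
    evalAt (bind₁ p q) g = evalAt q g' := by
  induction q using MvPolynomial.induction_on with
  | C a => simp [evalAt]
  | add p q hp hq =>
    rw [map_add]; unfold evalAt at *; rw [map_add, map_add, hp, hq]
  | mul_X p i hp => rw [map_mul, evalAt_mul, evalAt_mul, hp, bind₁_X_right, h, evalAt_X]

/-- The chain rule at the identity. -/
lemma derivAtOne_bind {p : Coord n → MvPolynomial (Coord n) ℂ}
    {ξ ζ : Matrix (Fin n) (Fin n) ℂ} (h1 : ∀ i, evalAt (p i) 1 = pt 1 i)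
    (hd : ∀ i, derivAtOne (p i) ξ = tangent ζ i) (q : MvPolynomial (Coord n) ℂ) :
    derivAtOne (bind₁ p q) ξ = derivAtOne q ζ := by
  induction q using MvPolynomial.induction_on with
  | C a => rw [bind₁_C_right, derivAtOne_C, derivAtOne_C]
  | add p q hp hq => rw [map_add, derivAtOne_add, derivAtOne_add, hp, hq]
  | mul_X q i hp =>
    rw [map_mul, derivAtOne_mul, derivAtOne_mul, hp, bind₁_X_right, h1, evalAt_X, hd,
      derivAtOne_X, evalAt_bind h1]

lemma pt_inl (g : GL (Fin n) ℂ) (i j : Fin n) : pt g (Sum.inl (i, j)) = g.1 i j := rfl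

lemma pt_inr (g : GL (Fin n) ℂ) (i j : Fin n) : pt g (Sum.inr (i, j)) = (g⁻¹).1 i j := rfl

/-- The differential at the identity of a regular map `f : G → GLₙ` with `f(1) = 1` maps the Lie
algebra of `G` to that of any subgroup containing the image of `f`. -/
lemma exists_tangent {G : Subgroup (GL (Fin n) ℂ)} {p : Coord n → MvPolynomial (Coord n) ℂ}
    {f : G → GL (Fin n) ℂ} (hf : ∀ (g : G) i, evalAt (p i) (g : GL (Fin n) ℂ) = pt (f g) i)
    (f1 : f 1 = 1) {ξ : Matrix (Fin n) (Fin n) ℂ} (hξ : ξ ∈ lieAlg G)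
    {G' : Subgroup (GL (Fin n) ℂ)} (hG' : ∀ g, f g ∈ G') :
    ∃ ζ ∈ lieAlg G', ∀ i, derivAtOne (p i) ξ = tangent ζ i := by
  have h1 : ∀ i, evalAt (p i) 1 = pt 1 i := fun i => by simpa [f1] using hf 1 i
  let ζ : Matrix (Fin n) (Fin n) ℂ := Matrix.of fun i j => derivAtOne (p (Sum.inl (i, j))) ξ
  have hζ : ∀ i, derivAtOne (p i) ξ = tangent ζ i := by
    rintro (⟨i, j⟩ | ⟨i, j⟩)
    · rfl
    -- `f(g) f(g)⁻¹ = 1` determines the derivatives of the entries of `f(g)⁻¹`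
    · have h := hξ (∑ l, p (Sum.inl (i, l)) * p (Sum.inr (l, j)) + C (-(if i = j then 1 else 0)))
        (fun g hg => by
          have e : (((f ⟨g, hg⟩ * (f ⟨g, hg⟩)⁻¹ : GL (Fin n) ℂ)) : Matrix (Fin n) (Fin n) ℂ) i j
              = if i = j then 1 else 0 := by
            rw [mul_inv_cancel, Units.val_one, Matrix.one_apply]
          rw [Units.val_mul, Matrix.mul_apply] at e
          have := fun i => hf ⟨g, hg⟩ i
          dsimp only at this
          rw [evalAt, map_add, ← evalAt, evalAt_sum]
          simp only [evalAt_mul, this, pt_inl, pt_inr]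
          rw [e]
          simp)
      rw [derivAtOne_add, derivAtOne_C, derivAtOne_sum, add_zero] at h
      simp only [derivAtOne_mul, h1, Finset.sum_add_distrib, pt_inl, pt_inr, inv_one,
        Units.val_one, Matrix.one_apply] at h
      simp at h
      change _ = -derivAtOne (p (Sum.inl (i, j))) ξ
      linear_combination h
  refine ⟨ζ, fun q hq => ?_, hζ⟩
  rw [← derivAtOne_bind h1 hζ]
  exact hξ _ fun g hg => by rw [evalAt_bind (hf ⟨g, hg⟩)]; exact hq _ (hG' _)

lemma lieAlg_mono {G G' : Subgroup (GL (Fin n) ℂ)} (h : G ≤ G') : lieAlg G ≤ lieAlg G' :=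
  fun _ hξ p hp => hξ p fun g hg => hp g (h hg)

variable {G : Subgroup (GL (Fin n) ℂ)} {H K : Subgroup G}

lemma IsAlgSemidirect.exists_mul (h : IsAlgSemidirect G H K) (g : G) :
    ∃ (a : H) (b : K), g = a * b := by
  obtain ⟨⟨a, b⟩, e⟩ := h.compl.2 g
  exact ⟨a, b, e.symm⟩

/-- The Lie algebra of a semidirect product is the sum of the Lie algebras of the factors: the
components of `ξ` are the differentials of the regular projections to `H` and `K`. -/
lemma IsAlgSemidirect.exists_add (h : IsAlgSemidirect G H K) {ξ : Matrix (Fin n) (Fin n) ℂ}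
    (hξ : ξ ∈ lieAlg G) : ∃ α ∈ lieAlg (H.map G.subtype), ∃ β ∈ lieAlg (K.map G.subtype),
      ξ = α + β := by
  obtain ⟨p, hp⟩ := h.proj_regular
  choose a b hab using h.exists_mul
  have hpb : ∀ (g : G) i, evalAt (p i) (g : GL (Fin n) ℂ) = pt ((b g : G) : GL (Fin n) ℂ) i := by
    intro g i
    rw [← hp (a g) (a g).2 (b g) (b g).2 i, ← hab g]
  have e1 : ((a 1 : H) : G) = 1 ∧ ((b 1 : K) : G) = 1 := by
    have := h.compl.1 (a₁ := (a 1, b 1)) (a₂ := (1, 1)) (by simp [← hab 1])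
    rw [Prod.mk.injEq] at this
    rw [this.1, this.2]; simp
  obtain ⟨β, hβ, hβ'⟩ := exists_tangent hpb (by rw [e1.2]; rfl) hξ (G' := K.map G.subtype)
    (fun g => ⟨_, (b g).2, rfl⟩)
  -- the projection to `H` is `g ↦ g b(g)⁻¹`, where `b` is the projection to `K`
  let q : Coord n → MvPolynomial (Coord n) ℂ := Sum.elim
    (fun i => ∑ l, X (Sum.inl (i.1, l)) * p (Sum.inr (l, i.2)))
    (fun i => ∑ l, p (Sum.inl (i.1, l)) * X (Sum.inr (l, i.2)))
  have hq : ∀ (g : G) i, evalAt (q i) (g : GL (Fin n) ℂ) = pt ((a g : G) : GL (Fin n) ℂ) i := by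
    intro g i
    have ea : ((a g : G) : GL (Fin n) ℂ) = (g : GL (Fin n) ℂ) * ((b g : G) : GL (Fin n) ℂ)⁻¹ := by
      have := congrArg (fun x : G => (x : GL (Fin n) ℂ)) (hab g)
      simp only [Subgroup.coe_mul] at this
      rw [eq_mul_inv_iff_mul_eq]; exact this.symm
    rw [ea]
    rcases i with ⟨i, j⟩ | ⟨i, j⟩
    · simp only [q, Sum.elim_inl, evalAt_sum, evalAt_mul, evalAt_X, hpb, pt_inl, pt_inr,
        Units.val_mul, Matrix.mul_apply]
    · simp only [q, Sum.elim_inr, evalAt_sum, evalAt_mul, evalAt_X, hpb, pt_inl, pt_inr,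
        Units.val_mul, Matrix.mul_apply, mul_inv_rev, inv_inv]
  obtain ⟨α, hα, hα'⟩ := exists_tangent hq (by rw [e1.1]; rfl) hξ (G' := H.map G.subtype)
    (fun g => ⟨_, (a g).2, rfl⟩)
  refine ⟨α, hα, β, hβ, ?_⟩
  ext i j
  have e := hα' (Sum.inl (i, j))
  have hp1 : ∀ i, evalAt (p i) 1 = pt 1 i := fun i => by
    have := hpb 1 i
    rwa [e1.2] at this
  simp only [q, Sum.elim_inl, derivAtOne_sum, derivAtOne_mul, derivAtOne_X, evalAt_X, hp1, hβ',
    pt_inl, pt_inr, inv_one, Units.val_one, Finset.sum_add_distrib, Matrix.one_apply, tangent,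
    Sum.elim_inr] at e
  simp at e
  rw [Matrix.add_apply]
  linear_combination e

end AlgLie

/-! ### Reduction in stages for algebraic groups -/

section AlgStages

variable {A : Type*} [CommRing A] [Algebra ℂ A] {P : PoissonBracket ℂ A} {Q : DefQuant P}
  {n : ℕ} {G : Subgroup (GL (Fin n) ℂ)} {H K : Subgroup G}

lemma AlgHamiltonianAction.finSpanned_constraints (T : AlgHamiltonianAction Q G)
    (γ : lieAlg G →ₗ[ℂ] ℂ⟦X⟧) (H : Subgroup G) : FinSpanned (T.constraints γ H) := by
  let V : Submodule ℂ (lieAlg G) := (lieAlg (H.map G.subtype)).comap (lieAlg G).subtype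
  obtain ⟨d, b, hb⟩ := Submodule.fg_iff_exists_fin_generating_family.1
    (IsNoetherian.noetherian V)
  refine ⟨d, fun i => T.comoment (b i) - algebraMap ℂ⟦X⟧ Q.Alg (γ (b i)), fun i => ?_, ?_⟩
  · have : b i ∈ V := by rw [← hb]; exact Submodule.subset_span ⟨i, rfl⟩
    exact ⟨b i, this, rfl⟩
  · rintro _ ⟨ξ, hξ, rfl⟩
    have hξ' : ξ ∈ V := hξ
    rw [← hb, Submodule.mem_span_range_iff_exists_fun] at hξ'
    obtain ⟨c, rfl⟩ := hξ'
    have e : T.comoment (∑ i, c i • b i) - algebraMap ℂ⟦X⟧ Q.Alg (γ (∑ i, c i • b i))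
        = ∑ i, (PowerSeries.C (c i) : ℂ⟦X⟧) • (T.comoment (b i) -
          algebraMap ℂ⟦X⟧ Q.Alg (γ (b i))) := by
      simp only [map_sum, map_smul, smul_sub, Finset.sum_sub_distrib, C_smul_alg,
        algebraMap_smul_alg]
    rw [e]
    exact sum_mem fun i _ => Submodule.smul_mem _ _ (Submodule.subset_span ⟨i, rfl⟩)

/-- For algebraic groups, quantum reduction commutes with stages if classical reduction does and
all reductions are deformation quantisations. -/
theorem algebraic_reduction_in_stages (hG : IsAlgSemidirect G H K)
    (T : AlgHamiltonianAction Q G) (γ : lieAlg G →ₗ[ℂ] ℂ⟦X⟧)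
    (h₂ : Quantises Q (quantumTwoStage Q T.act H K (T.constraints γ H) (T.constraints γ K))
      (classicalTwoStage Q T.act H K (T.constraints γ H) (T.constraints γ K)))
    (h₁ : Quantises Q (quantumOneStage Q T.act (T.constraints γ ⊤))
      (classicalOneStage Q T.act (T.constraints γ ⊤)))
    (hC : (classicalTwoStage Q T.act H K (T.constraints γ H) (T.constraints γ K)).IsNaturalIso
      (classicalOneStage Q T.act (T.constraints γ ⊤))) :
    (quantumTwoStage Q T.act H K (T.constraints γ H) (T.constraints γ K)).IsNaturalIso
      (quantumOneStage Q T.act (T.constraints γ ⊤)) := by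
  have hmono : ∀ H : Subgroup G, T.constraints γ H ⊆ T.constraints γ ⊤ := by
    rintro H _ ⟨ξ, hξ, rfl⟩
    exact ⟨ξ, lieAlg_mono (Subgroup.map_mono le_top) hξ, rfl⟩
  have hle : ∀ H : Subgroup G, H.map G.subtype ≤ G := fun H => by
    rintro _ ⟨x, -, rfl⟩; exact x.2
  have fH := T.finSpanned_constraints γ H
  have fK := T.finSpanned_constraints γ K
  refine isNaturalIso_of_quantises h₂ h₁ (Subquot.twoStage_B_le ?_ hG.exists_mul (hmono H)
    (hmono K) ?_) (Subquot.twoStage_L_le (hmono H) (hmono K)) (fH.twoStage_B fK)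
    (fH.twoStage_L fK) ((T.finSpanned_constraints γ ⊤).oneStage_L _) hC
  · intro g g' a
    change T.act (g * g') a = T.act g (T.act g' a)
    rw [map_mul]; rfl
  · rintro _ ⟨ξ, -, rfl⟩
    obtain ⟨α, hα, β, hβ, e⟩ := hG.exists_add ξ.2
    have e' : ξ = ⟨α, lieAlg_mono (hle H) hα⟩ + ⟨β, lieAlg_mono (hle K) hβ⟩ := Subtype.ext e
    refine ⟨_, ⟨⟨α, lieAlg_mono (hle H) hα⟩, hα, rfl⟩, _,
      ⟨⟨β, lieAlg_mono (hle K) hβ⟩, hβ, rfl⟩, ?_⟩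
    rw [e', map_add, map_add, map_add]
    abel

end AlgStages

/-! ### Integrals depending smoothly on parameters -/

section ParametricIntegral

open MeasureTheory Set Filter Topology

variable {E : Type*} [NormedAddCommGroup E] [NormedSpace ℝ E]
  {EN : Type*} [NormedAddCommGroup EN] [NormedSpace ℝ EN]
  {N : Type*} [TopologicalSpace N] [ChartedSpace EN N]
  {F : Type*} [NormedAddCommGroup F] [NormedSpace ℝ F]

lemma differentiableAt_of_uncurry {f : N → E → F} {h : N} {p : E}
    (hf : ContMDiffAt (𝓘(ℝ, EN).prod 𝓘(ℝ, E)) 𝓘(ℝ, F) ∞ (Function.uncurry f) (h, p)) :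
    DifferentiableAt ℝ (f h) p := by
  have : ContMDiffAt 𝓘(ℝ, E) 𝓘(ℝ, F) ∞ (f h) p :=
    ContMDiffAt.comp (x := p) (g := Function.uncurry f) (f := fun q : E => (h, q)) hf
      (contMDiffAt_const.prodMk contMDiffAt_id)
  exact this.contDiffAt.differentiableAt (by simp)

variable [IsManifold 𝓘(ℝ, EN) ∞ N]

/-- The derivative in one variable of a function of two variables is smooth in both. -/
lemma contMDiffAt_fderiv_right {f : N → E → F} {h : N} {p : E}
    (hf : ContMDiffAt (𝓘(ℝ, EN).prod 𝓘(ℝ, E)) 𝓘(ℝ, F) ∞ (Function.uncurry f) (h, p)) :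
    ContMDiffAt (𝓘(ℝ, EN).prod 𝓘(ℝ, E)) 𝓘(ℝ, E →L[ℝ] F) ∞
      (fun x : N × E => fderiv ℝ (f x.1) x.2) (h, p) := by
  have h1 : ContMDiffAt ((𝓘(ℝ, EN).prod 𝓘(ℝ, E)).prod 𝓘(ℝ, E)) 𝓘(ℝ, F) ∞
      (Function.uncurry fun (x : N × E) (q : E) => f x.1 q) ((h, p), p) := by
    have : ContMDiffAt ((𝓘(ℝ, EN).prod 𝓘(ℝ, E)).prod 𝓘(ℝ, E)) (𝓘(ℝ, EN).prod 𝓘(ℝ, E)) ∞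
        (fun y : (N × E) × E => (y.1.1, y.2)) ((h, p), p) :=
      (contMDiffAt_fst.comp _ contMDiffAt_fst).prodMk contMDiffAt_snd
    exact ContMDiffAt.comp (x := ((h, p), p)) (g := Function.uncurry f) hf this
  have h2 := ContMDiffAt.mfderiv (m := ∞) (fun (x : N × E) (q : E) => f x.1 q)
    (Prod.snd : N × E → E) h1 contMDiffAt_snd (by simp)
  have e := inTangentCoordinates_model_space (𝕜 := ℝ) (I := 𝓘(ℝ, E)) (I' := 𝓘(ℝ, F))
    (Prod.snd : N × E → E) (fun x : N × E => f x.1 x.2)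
    (fun x => (fderiv ℝ (f x.1) x.2 : E →L[ℝ] F)) (h, p)
  simp only [mfderiv_eq_fderiv] at h2
  exact e ▸ h2

variable [MeasurableSpace N] [OpensMeasurableSpace N] {μ : Measure N}
  [IsFiniteMeasureOnCompacts μ] [FiniteDimensional ℝ E]

lemma hasFDerivAt_setIntegral {f : N → E → F} {C : Set N} (hC : IsCompact C) (hC' : IsClosed C)
    {U : Set E} (hU : IsOpen U)
    (hf : ∀ h ∈ C, ∀ p ∈ U,
      ContMDiffAt (𝓘(ℝ, EN).prod 𝓘(ℝ, E)) 𝓘(ℝ, F) ∞ (Function.uncurry f) (h, p))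
    {p : E} (hp : p ∈ U) :
    IntegrableOn (fun h => fderiv ℝ (f h) p) C μ ∧
    HasFDerivAt (fun p => ∫ h in C, f h p ∂μ) (∫ h in C, fderiv ℝ (f h) p ∂μ) p := by
  have hm := hC'.measurableSet
  have hcf : ∀ q ∈ U, ContinuousOn (fun h => f h q) C := fun q hq h hh =>
    (ContinuousAt.comp (x := h) (g := Function.uncurry f) (f := fun h : N => (h, q))
      (hf h hh q hq).continuousAt (by fun_prop)).continuousWithinAt
  have hcD : ∀ q ∈ U, ContinuousOn (fun h => fderiv ℝ (f h) q) C := fun q hq h hh =>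
    (ContinuousAt.comp (x := h) (g := fun x : N × E => fderiv ℝ (f x.1) x.2)
      (f := fun h : N => (h, q))
      (contMDiffAt_fderiv_right (hf h hh q hq)).continuousAt (by fun_prop)).continuousWithinAt
  obtain ⟨ε, hε, hball⟩ := Metric.nhds_basis_closedBall.mem_iff.1 (hU.mem_nhds hp)
  have hcomp : IsCompact (C ×ˢ Metric.closedBall p ε) := hC.prod (isCompact_closedBall p ε)
  obtain ⟨B, hB⟩ := hcomp.exists_bound_of_continuousOn
    (f := fun x : N × E => fderiv ℝ (f x.1) x.2)
    (fun x hx => (contMDiffAt_fderiv_right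
      (hf x.1 hx.1 x.2 (hball hx.2))).continuousAt.continuousWithinAt)
  refine ⟨(hcD p hp).integrableOn_compact' hC hm,
    hasFDerivAt_integral_of_dominated_of_fderiv_le (𝕜 := ℝ) (F := fun q h => f h q)
      (F' := fun q h => fderiv ℝ (f h) q) (bound := fun _ => B)
      (Metric.closedBall_mem_nhds p hε) ?_ ?_ ?_ ?_ ?_ ?_⟩
  · filter_upwards [hU.mem_nhds hp] with q hq
    exact (hcf q hq).aestronglyMeasurable_of_isCompact hC hm
  · exact (hcf p hp).integrableOn_compact' hC hm
  · exact (hcD p hp).aestronglyMeasurable_of_isCompact hC hm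
  · refine (ae_restrict_iff' hm).2 (Eventually.of_forall fun h hh q hq => hB (h, q) ⟨hh, hq⟩)
  · have : IsFiniteMeasure (μ.restrict C) := ⟨by
      rw [Measure.restrict_apply_univ]; exact hC.measure_lt_top⟩
    exact integrable_const B
  · refine (ae_restrict_iff' hm).2 (Eventually.of_forall fun h hh q hq => ?_)
    exact (differentiableAt_of_uncurry (hf h hh q (hball hq))).hasFDerivAt

/-- The integral over a compact set of a function depending smoothly on all its variables depends
smoothly on the parameter. -/
theorem contDiffOn_setIntegral [CompleteSpace F] {f : N → E → F} {C : Set N} (hC : IsCompact C)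
    (hC' : IsClosed C) {U : Set E} (hU : IsOpen U)
    (hf : ∀ h ∈ C, ∀ p ∈ U,
      ContMDiffAt (𝓘(ℝ, EN).prod 𝓘(ℝ, E)) 𝓘(ℝ, F) ∞ (Function.uncurry f) (h, p)) :
    ContDiffOn ℝ ∞ (fun p => ∫ h in C, f h p ∂μ) U := by
  rw [contDiffOn_infty]
  intro n
  induction n generalizing f with
  | zero =>
    rw [Nat.cast_zero, contDiffOn_zero]
    exact fun p hp => (hasFDerivAt_setIntegral hC hC' hU hf hp).2.continuousAt.continuousWithinAt
  | succ n ih =>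
    rw [Nat.cast_succ]
    refine contDiffOn_succ_of_fderiv_apply (fun p hp => (hasFDerivAt_setIntegral hC hC' hU hf
      hp).2.differentiableAt.differentiableWithinAt) (by simp) fun v => ?_
    have := ih (f := fun h p => fderiv ℝ (f h) p v) fun h hh p hp =>
      (contMDiffAt_fderiv_right (hf h hh p hp)).clm_apply contMDiffAt_const
    refine this.congr fun p hp => ?_
    obtain ⟨hi, hd⟩ := hasFDerivAt_setIntegral (μ := μ) hC hC' hU hf hp
    rw [fderivWithin_of_isOpen hU hp, hd.fderiv, ContinuousLinearMap.integral_apply hi]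

end ParametricIntegral

/-! ### Averaging over a proper action -/

section Averaging

open MeasureTheory Set Filter Topology

variable {E : Type*} [NormedAddCommGroup E] [NormedSpace ℝ E]
  {M : Type*} [TopologicalSpace M] [ChartedSpace E M]
  {EG : Type*} [NormedAddCommGroup EG] [NormedSpace ℝ EG]
  {G : Type*} [TopologicalSpace G] [ChartedSpace EG G] [Group G] [MulAction G M]
  {F : Type*} [NormedAddCommGroup F]

/-- Locally uniformly in `y`, the function `h ↦ f (h⁻¹ y)` on the group has compact support. -/
def LocallyProper (G : Type*) [TopologicalSpace G] [Group G] [MulAction G M] {F : Type*} [Zero F]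
    (f : M → F) : Prop :=
  ∀ x : M, ∃ U ∈ 𝓝 x, ∃ C : Set G, IsCompact C ∧ IsClosed C ∧ ∀ y ∈ U, ∀ h ∉ C, f (h⁻¹ • y) = 0

lemma locallyProper_of_compact [WeaklyLocallyCompactSpace M] [IsTopologicalGroup G]
    [ProperSMul G M] {f : M → F} {D : Set M} (hD : IsCompact D) (hf : ∀ x ∉ D, f x = 0) :
    LocallyProper G f := by
  intro x
  obtain ⟨V, hV, hVx⟩ := exists_compact_mem_nhds x
  have hc := (ProperSMul.isProperMap_smul_pair (G := G) (X := M)).isCompact_preimage (hV.prod hD)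
  refine ⟨V, hVx, closure (Prod.fst '' ((fun gx : G × M => (gx.1 • gx.2, gx.2)) ⁻¹' V ×ˢ D)),
    (hc.image continuous_fst).closure, isClosed_closure, fun y hy h hh => ?_⟩
  by_contra hne
  refine hh (subset_closure ⟨(h, h⁻¹ • y), ⟨?_, ?_⟩, rfl⟩)
  · simpa using hy
  · exact by_contra fun hD => hne (hf _ hD)

lemma LocallyProper.integrable [IsTopologicalGroup G] [ContinuousSMul G M]
    [MeasurableSpace G] [OpensMeasurableSpace G] {μ : Measure G} [IsFiniteMeasureOnCompacts μ]
    {f : M → F} (h : LocallyProper G f) (hf : Continuous f) (x : M) :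
    Integrable (fun g : G => f (g⁻¹ • x)) μ := by
  obtain ⟨U, hU, C, hC, hC', h0⟩ := h x
  refine Continuous.integrable_of_hasCompactSupport (by fun_prop) ?_
  exact HasCompactSupport.intro' hC hC' fun g hg => h0 x (mem_of_mem_nhds hU) g hg

variable [NormedSpace ℝ F]

/-- Averages of locally proper smooth functions are smooth. -/
lemma LocallyProper.contMDiff_integral [FiniteDimensional ℝ E] [IsManifold 𝓘(ℝ, E) ∞ M]
    [LieGroup 𝓘(ℝ, EG) ∞ G] [CompleteSpace F]
    (hsm : ContMDiff (𝓘(ℝ, EG).prod 𝓘(ℝ, E)) 𝓘(ℝ, E) ∞ (fun p : G × M => p.1 • p.2))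
    [MeasurableSpace G] [OpensMeasurableSpace G] {μ : Measure G} [IsFiniteMeasureOnCompacts μ]
    {f : M → F} (h : LocallyProper G f) (hf : ContMDiff 𝓘(ℝ, E) 𝓘(ℝ, F) ∞ f) :
    ContMDiff 𝓘(ℝ, E) 𝓘(ℝ, F) ∞ fun x => ∫ g : G, f (g⁻¹ • x) ∂μ := by
  intro x
  have : IsTopologicalGroup G := topologicalGroup_of_lieGroup 𝓘(ℝ, EG) ∞
  obtain ⟨U, hU, C, hC, hC', h0⟩ := h x
  rw [contMDiffAt_iff_source_of_mem_source (mem_chart_source E x)]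
  have hopen : IsOpen ((extChartAt 𝓘(ℝ, E) x).target ∩
      (extChartAt 𝓘(ℝ, E) x).symm ⁻¹' interior U) :=
    (continuousOn_extChartAt_symm x).isOpen_inter_preimage (isOpen_extChartAt_target x)
      isOpen_interior
  have hmem : extChartAt 𝓘(ℝ, E) x x ∈ (extChartAt 𝓘(ℝ, E) x).target ∩
      (extChartAt 𝓘(ℝ, E) x).symm ⁻¹' interior U := by
    refine ⟨mem_extChartAt_target x, ?_⟩
    rw [mem_preimage, extChartAt_to_inv]
    exact mem_interior_iff_mem_nhds.2 hU
  have key := contDiffOn_setIntegral (μ := μ) (EN := EG)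
    (f := fun (g : G) (p : E) => f (g⁻¹ • (extChartAt 𝓘(ℝ, E) x).symm p)) hC hC' hopen ?_
  · have e : (fun p => ∫ g in C, f (g⁻¹ • (extChartAt 𝓘(ℝ, E) x).symm p) ∂μ) =ᶠ[
        𝓝 (extChartAt 𝓘(ℝ, E) x x)]
        ((fun x => ∫ g : G, f (g⁻¹ • x) ∂μ) ∘ (extChartAt 𝓘(ℝ, E) x).symm) := by
      filter_upwards [hopen.mem_nhds hmem] with p hp
      exact setIntegral_eq_integral_of_forall_compl_eq_zero
        fun g hg => h0 _ (interior_subset hp.2) g hg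
    exact ((key.contDiffAt (hopen.mem_nhds hmem)).congr_of_eventuallyEq
      e.symm).contMDiffAt.contMDiffWithinAt
  · intro g _ p hp
    have h1 : ContMDiffAt 𝓘(ℝ, E) 𝓘(ℝ, E) ∞ (extChartAt 𝓘(ℝ, E) x).symm p :=
      (contMDiffOn_extChartAt_symm x).contMDiffAt
        ((isOpen_extChartAt_target x).mem_nhds hp.1)
    have h2 : ContMDiffAt (𝓘(ℝ, EG).prod 𝓘(ℝ, E)) (𝓘(ℝ, EG).prod 𝓘(ℝ, E)) ∞
        (fun y : G × E => (y.1⁻¹, (extChartAt 𝓘(ℝ, E) x).symm y.2)) (g, p) :=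
      (((contMDiff_inv 𝓘(ℝ, EG) ∞).comp contMDiff_fst).contMDiffAt).prodMk
        (ContMDiffAt.comp (x := (g, p)) h1 contMDiffAt_snd)
    exact (hf.comp hsm).contMDiffAt.comp (x := (g, p)) h2

/-- The ingredients of a cutoff function: countably many bump functions `fₙ ≥ 0` with compact
support, one of whose averages `Φₙ` is positive at any given point, and invariant weights `χₙ` that
make `∑ χₙ fₙ` locally finite and `∑ χₙ Φₙ` positive. -/
lemma exists_invariant_weights [FiniteDimensional ℝ E] [IsManifold 𝓘(ℝ, E) ∞ M]
    [T2Space M] [SigmaCompactSpace M] [LieGroup 𝓘(ℝ, EG) ∞ G] [ProperSMul G M]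
    (hsm : ContMDiff (𝓘(ℝ, EG).prod 𝓘(ℝ, E)) 𝓘(ℝ, E) ∞ (fun p : G × M => p.1 • p.2))
    [MeasurableSpace G] [BorelSpace G] (μ : Measure G) [IsFiniteMeasureOnCompacts μ]
    [μ.IsMulLeftInvariant] [μ.IsOpenPosMeasure] :
    ∃ f χ : ℕ → M → ℝ, (∀ n, ContMDiff 𝓘(ℝ, E) 𝓘(ℝ, ℝ) ∞ (f n)) ∧
      (∀ n, ContMDiff 𝓘(ℝ, E) 𝓘(ℝ, ℝ) ∞ (χ n)) ∧ (∀ n, LocallyProper G (f n)) ∧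
      (∀ n (g : G) x, χ n (g • x) = χ n x) ∧
      (∀ n x, 0 ≤ χ n x * ∫ g : G, f n (g⁻¹ • x) ∂μ) ∧
      (∀ x, ∃ n, 0 < χ n x * ∫ g : G, f n (g⁻¹ • x) ∂μ) ∧
      ∀ x, ∃ V ∈ 𝓝 x, ∃ N, ∀ y ∈ V, ∀ n ≥ N, χ n y = 0 := by
  have : IsTopologicalGroup G := topologicalGroup_of_lieGroup 𝓘(ℝ, EG) ∞
  have : LocallyCompactSpace M := Manifold.locallyCompact_of_finiteDimensional 𝓘(ℝ, E)
  let K : CompactExhaustion M := default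
  have hf : ∀ n, ∃ f : C^∞⟮𝓘(ℝ, E), M; 𝓘(ℝ), ℝ⟯, (∀ᶠ x in 𝓝ˢ (K n), f x = 1) ∧
      (∀ x ∉ K (n + 1), f x = 0) ∧ ∀ x, f x ∈ Icc 0 1 := fun n =>
    exists_contMDiffMap_one_nhds_of_subset_interior 𝓘(ℝ, E) (K.isCompact n).isClosed
      (K.subset_interior_succ n)
  choose f hf1 hf0 hfI using hf
  have hproper : ∀ n, LocallyProper G (f n) := fun n =>
    locallyProper_of_compact (K.isCompact (n + 1)) (hf0 n)
  let Φ : ℕ → M → ℝ := fun n x => ∫ g : G, f n (g⁻¹ • x) ∂μ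
  have hΦ : ∀ n, ContMDiff 𝓘(ℝ, E) 𝓘(ℝ, ℝ) ∞ (Φ n) := fun n =>
    (hproper n).contMDiff_integral hsm (f n).contMDiff
  have hΦ0 : ∀ n x, 0 ≤ Φ n x := fun n x => integral_nonneg fun g => (hfI n _).1
  have hΦinv : ∀ n (g : G) x, Φ n (g • x) = Φ n x := fun n g x => by
    have := integral_mul_left_eq_self (μ := μ) (fun h : G => f n (h⁻¹ • x)) g⁻¹
    change ∫ h : G, f n (h⁻¹ • g • x) ∂μ = ∫ h : G, f n (h⁻¹ • x) ∂μ
    rw [← this]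
    simp [mul_smul]
  have hΦpos : ∀ x, ∃ n, 0 < Φ n x := by
    intro x
    obtain ⟨n, hn⟩ := K.exists_mem x
    refine ⟨n, ?_⟩
    obtain ⟨U, hU, C, hC, hC', h0⟩ := hproper n x
    refine Continuous.integral_pos_of_hasCompactSupport_nonneg_nonzero (x := 1)
      ((f n).contMDiff.continuous.comp (by fun_prop)) ?_ (fun g => (hfI n _).1) ?_
    · exact HasCompactSupport.intro' hC hC' fun g hg => h0 x (mem_of_mem_nhds hU) g hg
    · have := (hf1 n).self_of_nhdsSet x hn
      simp [this]
  let S : ℕ → M → ℝ := fun n x => ∑ j ∈ Finset.range n, Φ j x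
  -- the weight `χₙ` is positive exactly where `Φ₀ + … + Φₙ₋₁ < 1 / (n + 1)`: this holds at `x` for
  -- the first `n` with `Φₙ(x) > 0`, and fails near `x` for all large `n`
  refine ⟨fun n => f n, fun n x => expNegInvGlue (1 / (n + 1) - S n x), fun n => (f n).contMDiff,
    fun n => ?_, hproper, fun n g x => ?_, fun n x => ?_, fun x => ?_, fun x => ?_⟩
  · have hS : ContMDiff 𝓘(ℝ, E) 𝓘(ℝ, ℝ) ∞ (S n) := contMDiff_finsetSum fun i _ => hΦ i
    exact (expNegInvGlue.contDiff.contMDiff).comp (contMDiff_const.sub hS)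
  · simp only [S, hΦinv]
  · exact mul_nonneg (expNegInvGlue.nonneg _) (hΦ0 n x)
  · classical
    -- the first index at which the average is positive
    refine ⟨Nat.find (hΦpos x), mul_pos (expNegInvGlue.pos_of_pos ?_) (Nat.find_spec (hΦpos x))⟩
    have : S (Nat.find (hΦpos x)) x = 0 := Finset.sum_eq_zero fun j hj =>
      le_antisymm (not_lt.1 (Nat.find_min (hΦpos x) (Finset.mem_range.1 hj))) (hΦ0 j x)
    rw [this, sub_zero]
    positivity
  · obtain ⟨i, hi⟩ := hΦpos x
    obtain ⟨N, hN⟩ := exists_nat_one_div_lt (half_pos hi)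
    refine ⟨{y | Φ i x / 2 < Φ i y}, (hΦ i).continuous.continuousAt.eventually
      (lt_mem_nhds (half_lt_self hi)), max N (i + 1), fun y hy n hn => ?_⟩
    refine expNegInvGlue.zero_of_nonpos (sub_nonpos.2 ?_)
    have h1 : Φ i y ≤ S n y := Finset.single_le_sum (f := fun j => Φ j y) (fun j _ => hΦ0 j y)
      (Finset.mem_range.2 (lt_of_lt_of_le (Nat.lt_succ_self i) (le_trans (le_max_right _ _) hn)))
    have h2 : (1 : ℝ) / (n + 1) ≤ 1 / (N + 1) := by
      have : (N : ℝ) ≤ n := by exact_mod_cast le_trans (le_max_left _ _) hn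
      exact one_div_le_one_div_of_le (by positivity) (by linarith)
    have hy' : Φ i x / 2 < Φ i y := hy
    linarith

/-- A proper action admits a smooth cutoff function with average one on every orbit. -/
theorem exists_cutoff [FiniteDimensional ℝ E] [IsManifold 𝓘(ℝ, E) ∞ M]
    [T2Space M] [SigmaCompactSpace M] [LieGroup 𝓘(ℝ, EG) ∞ G] [ProperSMul G M]
    (hsm : ContMDiff (𝓘(ℝ, EG).prod 𝓘(ℝ, E)) 𝓘(ℝ, E) ∞ (fun p : G × M => p.1 • p.2))
    [MeasurableSpace G] [BorelSpace G] (μ : Measure G) [IsFiniteMeasureOnCompacts μ]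
    [μ.IsMulLeftInvariant] [μ.IsOpenPosMeasure] :
    ∃ w : M → ℝ, ContMDiff 𝓘(ℝ, E) 𝓘(ℝ, ℝ) ∞ w ∧ LocallyProper G w ∧
      ∀ x, ∫ g : G, w (g⁻¹ • x) ∂μ = 1 := by
  have : IsTopologicalGroup G := topologicalGroup_of_lieGroup 𝓘(ℝ, EG) ∞
  obtain ⟨f, χ, hf, hχ, hp, hinv, h0, hpos, hlf⟩ := exists_invariant_weights hsm μ
  let Φ : ℕ → M → ℝ := fun n x => ∫ g : G, f n (g⁻¹ • x) ∂μ
  have hΦ : ∀ n, ContMDiff 𝓘(ℝ, E) 𝓘(ℝ, ℝ) ∞ (Φ n) := fun n => (hp n).contMDiff_integral hsm (hf n)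
  have hlocfin : ∀ u : ℕ → M → ℝ,
      LocallyFinite fun n => Function.support fun x => χ n x * u n x := by
    intro u x
    obtain ⟨V, hV, N, hN⟩ := hlf x
    refine ⟨V, hV, (Set.finite_lt_nat N).subset ?_⟩
    rintro n ⟨y, hy, hyV⟩
    by_contra hn
    exact hy (by simp [hN y hyV n (not_lt.1 hn)])
  have hsum : ∀ (u : ℕ → M → ℝ) {x : M} {N : ℕ}, (∀ n ≥ N, χ n x = 0) →
      ∑ᶠ n, χ n x * u n x = ∑ n ∈ Finset.range N, χ n x * u n x := by
    intro u x N hN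
    refine finsum_eq_sum_of_support_subset _ fun n hn => ?_
    rw [Finset.coe_range, mem_Iio]
    by_contra h
    exact hn (by simp [hN n (not_lt.1 h)])
  let D : M → ℝ := fun x => ∑ᶠ n, χ n x * Φ n x
  have hD : ContMDiff 𝓘(ℝ, E) 𝓘(ℝ, ℝ) ∞ D :=
    contMDiff_finsum (fun n => (hχ n).mul (hΦ n)) (hlocfin Φ)
  have hD0 : ∀ x, 0 < D x := by
    intro x
    obtain ⟨V, hV, N, hN⟩ := hlf x
    obtain ⟨i, hi⟩ := hpos x
    have hN' := hN x (mem_of_mem_nhds hV)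
    have hiN : i < N := by
      by_contra h
      rw [hN' i (not_lt.1 h), zero_mul] at hi
      exact lt_irrefl _ hi
    change 0 < ∑ᶠ n, χ n x * Φ n x
    rw [hsum Φ hN']
    exact lt_of_lt_of_le hi (Finset.single_le_sum (f := fun n => χ n x * Φ n x)
      (fun n _ => h0 n x) (Finset.mem_range.2 hiN))
  have hDinv : ∀ (g : G) x, D (g • x) = D x := fun g x => by
    refine finsum_congr fun n => ?_
    have := integral_mul_left_eq_self (μ := μ) (fun h : G => f n (h⁻¹ • x)) g⁻¹
    have e : Φ n (g • x) = Φ n x := by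
      change ∫ h : G, f n (h⁻¹ • g • x) ∂μ = ∫ h : G, f n (h⁻¹ • x) ∂μ
      rw [← this]
      simp [mul_smul]
    rw [hinv, e]
  -- as the `χₙ` and `D` are invariant, the average of `∑ χₙ fₙ / D` is `∑ χₙ Φₙ / D = 1`
  refine ⟨fun x => (∑ᶠ n, χ n x * f n x) / D x, ?_, ?_, ?_⟩
  · exact (contMDiff_finsum (fun n => (hχ n).mul (hf n)) (hlocfin f)).div₀ hD
      fun x => (hD0 x).ne'
  · intro x
    obtain ⟨V, hV, N, hN⟩ := hlf x
    choose U hU C hC hC' hz using fun n => hp n x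
    refine ⟨V ∩ ⋂ n ∈ Finset.range N, U n, Filter.inter_mem hV
      ((Filter.biInter_finset_mem _).2 fun n _ => hU n), ⋃ n ∈ Finset.range N, C n,
      (Finset.range N).isCompact_biUnion fun n _ => hC n,
      Set.Finite.isClosed_biUnion (Finset.finite_toSet _) fun n _ => hC' n, ?_⟩
    rintro y ⟨hyV, hyU⟩ h hh
    simp only [mem_iUnion, not_exists] at hh
    simp only [mem_iInter] at hyU
    dsimp only
    rw [hsum f (N := N) fun n hn => by rw [hinv, hN y hyV n hn], Finset.sum_eq_zero, zero_div]
    intro n hn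
    rw [hz n y (hyU n hn) h (hh n hn), mul_zero]
  · intro x
    obtain ⟨V, hV, N, hN⟩ := hlf x
    have hN' := hN x (mem_of_mem_nhds hV)
    have e : ∀ g : G, (∑ᶠ n, χ n (g⁻¹ • x) * f n (g⁻¹ • x)) / D (g⁻¹ • x)
        = (∑ n ∈ Finset.range N, χ n x * f n (g⁻¹ • x)) / D x := fun g => by
      rw [hDinv, hsum f (N := N) fun n hn => by rw [hinv, hN' n hn]]
      simp only [hinv]
    simp only [e]
    rw [integral_div, integral_finsetSum _ fun n _ =>
      ((hp n).integrable (hf n).continuous x).const_mul _]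
    simp only [integral_const_mul]
    rw [div_eq_one_iff_eq (hD0 x).ne']
    exact (hsum Φ hN').symm

/-- Averaging over a proper action: a retraction of the smooth functions onto the invariant ones,
linear over functions that are constant on the orbit under consideration. -/
theorem exists_average (𝕜 : Type*) [RCLike 𝕜] [FiniteDimensional ℝ E] [IsManifold 𝓘(ℝ, E) ∞ M]
    [T2Space M] [SigmaCompactSpace M] [FiniteDimensional ℝ EG] [LieGroup 𝓘(ℝ, EG) ∞ G]
    [ProperSMul G M]
    (hsm : ContMDiff (𝓘(ℝ, EG).prod 𝓘(ℝ, E)) 𝓘(ℝ, E) ∞ (fun p : G × M => p.1 • p.2)) :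
    ∃ T : smoothFunctions 𝕜 E M → smoothFunctions 𝕜 E M, (∀ a b, T (a + b) = T a + T b) ∧
      (∀ a (g : G) x, (T a).1 (g • x) = (T a).1 x) ∧ T 1 = 1 ∧
      ∀ (a f : smoothFunctions 𝕜 E M) (x : M), (∀ g : G, f.1 (g • x) = f.1 x) →
        (T (a * f)).1 x = (T a).1 x * f.1 x := by
  have : IsTopologicalGroup G := topologicalGroup_of_lieGroup 𝓘(ℝ, EG) ∞
  have : LocallyCompactSpace G := Manifold.locallyCompact_of_finiteDimensional 𝓘(ℝ, EG)
  borelize G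
  let μ : Measure G := Measure.haar
  obtain ⟨w, hw, hwp, hw1⟩ := exists_cutoff hsm μ
  have hwa : ∀ a : smoothFunctions 𝕜 E M,
      ContMDiff 𝓘(ℝ, E) 𝓘(ℝ, 𝕜) ∞ fun x => w x • a.1 x := fun a => hw.smul a.2
  have hpa : ∀ a : smoothFunctions 𝕜 E M, LocallyProper G fun x => w x • a.1 x := by
    intro a x
    obtain ⟨U, hU, C, hC, hC', h0⟩ := hwp x
    exact ⟨U, hU, C, hC, hC', fun y hy h hh => by dsimp only; rw [h0 y hy h hh, zero_smul]⟩
  let T : smoothFunctions 𝕜 E M → smoothFunctions 𝕜 E M := fun a =>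
    ⟨fun x => ∫ g : G, w (g⁻¹ • x) • a.1 (g⁻¹ • x) ∂μ, (hpa a).contMDiff_integral hsm (hwa a)⟩
  have hmul : ∀ (a f : smoothFunctions 𝕜 E M) (x : M), (∀ g : G, f.1 (g • x) = f.1 x) →
      (T (a * f)).1 x = (T a).1 x * f.1 x := by
    intro a f x hfx
    change ∫ g : G, w (g⁻¹ • x) • (a.1 (g⁻¹ • x) * f.1 (g⁻¹ • x)) ∂μ
      = (∫ g : G, w (g⁻¹ • x) • a.1 (g⁻¹ • x) ∂μ) * f.1 x
    simp only [hfx, ← smul_mul_assoc]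
    exact integral_mul_const _ _
  refine ⟨T, fun a b => ?_, fun a g x => ?_, ?_, hmul⟩
  · refine Subtype.ext (funext fun x => ?_)
    change ∫ g : G, w (g⁻¹ • x) • (a.1 (g⁻¹ • x) + b.1 (g⁻¹ • x)) ∂μ = _
    simp only [smul_add]
    exact integral_add ((hpa a).integrable (hwa a).continuous x)
      ((hpa b).integrable (hwa b).continuous x)
  · have := integral_mul_left_eq_self (μ := μ)
      (fun h : G => w (h⁻¹ • x) • a.1 (h⁻¹ • x)) g⁻¹
    change ∫ h : G, w (h⁻¹ • g • x) • a.1 (h⁻¹ • g • x) ∂μ = _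
    refine Eq.trans ?_ this
    simp [mul_smul]
  · refine Subtype.ext (funext fun x => ?_)
    change ∫ g : G, w (g⁻¹ • x) • (1 : 𝕜) ∂μ = 1
    rw [integral_smul_const, hw1, one_smul]

end Averaging

/-! ### Functions vanishing on a regular level set, and their relations -/

section Koszul

open MeasureTheory Set Filter Topology

section Local

variable {d : ℕ} {N : Type*} [NormedAddCommGroup N]
  {F : Type*} [NormedAddCommGroup F] [NormedSpace ℝ F]

lemma smul_mem_ball {y₀ : N} {ε s : ℝ} {p : (Fin d → ℝ) × N} (hp : p ∈ Metric.ball (0, y₀) ε)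
    (hs : s ∈ Icc (0 : ℝ) 1) : (s • p.1, p.2) ∈ Metric.ball ((0 : Fin d → ℝ), y₀) ε := by
  rw [Metric.mem_ball, Prod.dist_eq, max_lt_iff] at hp ⊢
  refine ⟨lt_of_le_of_lt ?_ hp.1, hp.2⟩
  rw [dist_zero_right, dist_zero_right, norm_smul, Real.norm_of_nonneg hs.1]
  exact mul_le_of_le_one_left (norm_nonneg _) hs.2

variable [NormedSpace ℝ N]

/-- The average over the segment from `(0, y)` to `(u, y)`, with weight `w`, of the `j`-th partial
derivative of `g`. -/
noncomputable def radialAverage (w : ℝ → ℝ) (j : Fin d) (g : (Fin d → ℝ) × N → F)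
    (p : (Fin d → ℝ) × N) : F :=
  ∫ s in Icc (0 : ℝ) 1, w s • fderiv ℝ g (s • p.1, p.2) (Pi.single j 1, 0)

lemma contDiffAt_radial {y₀ : N} {ε : ℝ} {g : (Fin d → ℝ) × N → F}
    (hg : ContDiffOn ℝ ∞ g (Metric.ball (0, y₀) ε)) {w : ℝ → ℝ} (hw : ContDiff ℝ ∞ w) (j : Fin d)
    {s : ℝ} (hs : s ∈ Icc (0 : ℝ) 1) {p : (Fin d → ℝ) × N} (hp : p ∈ Metric.ball (0, y₀) ε) :
    ContDiffAt ℝ ∞ (fun x : ℝ × ((Fin d → ℝ) × N) =>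
      w x.1 • fderiv ℝ g (x.1 • x.2.1, x.2.2) (Pi.single j 1, 0)) (s, p) := by
  have h1 : ContDiffAt ℝ ∞ (fderiv ℝ g) (s • p.1, p.2) :=
    (hg.contDiffAt (Metric.isOpen_ball.mem_nhds (smul_mem_ball hp hs))).fderiv_right (by simp)
  have h2 : ContDiffAt ℝ ∞ (fun x : ℝ × ((Fin d → ℝ) × N) => (x.1 • x.2.1, x.2.2)) (s, p) := by
    fun_prop
  have h3 := ContDiffAt.comp (x := (s, p)) (g := fderiv ℝ g)
    (f := fun x : ℝ × ((Fin d → ℝ) × N) => (x.1 • x.2.1, x.2.2)) h1 h2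
  exact (hw.comp contDiff_fst).contDiffAt.smul (h3.clm_apply contDiffAt_const)

lemma fderiv_radial_eq_sum (g : (Fin d → ℝ) × N → F) (q : (Fin d → ℝ) × N) (u : Fin d → ℝ) :
    fderiv ℝ g q (u, 0) = ∑ j, u j • fderiv ℝ g q (Pi.single j 1, 0) := by
  have h : (u, (0 : N)) = ∑ j, u j • ((Pi.single j 1 : Fin d → ℝ), (0 : N)) := by
    refine Prod.ext ?_ ?_
    · rw [Prod.fst_sum]
      ext i
      simp [Finset.sum_apply, Pi.single_apply]
    · rw [Prod.snd_sum]; simp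
  rw [h, map_sum]
  simp only [map_smul]

lemma integrableOn_radial {y₀ : N} {ε : ℝ} {g : (Fin d → ℝ) × N → F}
    (hg : ContDiffOn ℝ ∞ g (Metric.ball (0, y₀) ε)) {w : ℝ → ℝ} (hw : ContDiff ℝ ∞ w) (j : Fin d)
    {p : (Fin d → ℝ) × N} (hp : p ∈ Metric.ball (0, y₀) ε) :
    IntegrableOn (fun s : ℝ => w s • fderiv ℝ g (s • p.1, p.2) (Pi.single j 1, 0))
      (Icc 0 1) := by
  refine ContinuousOn.integrableOn_compact isCompact_Icc fun s hs => ?_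
  exact (ContinuousAt.comp (x := s) (f := fun s : ℝ => (s, p))
    (g := fun x : ℝ × ((Fin d → ℝ) × N) =>
      w x.1 • fderiv ℝ g (x.1 • x.2.1, x.2.2) (Pi.single j 1, 0))
    (contDiffAt_radial hg hw j hs hp).continuousAt (by fun_prop)).continuousWithinAt

lemma hasDerivAt_radial {y₀ : N} {ε : ℝ} {g : (Fin d → ℝ) × N → F}
    (hg : ContDiffOn ℝ ∞ g (Metric.ball (0, y₀) ε)) {s : ℝ} (hs : s ∈ Icc (0 : ℝ) 1)
    {p : (Fin d → ℝ) × N} (hp : p ∈ Metric.ball (0, y₀) ε) :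
    HasDerivAt (fun s : ℝ => g (s • p.1, p.2))
      (∑ j, p.1 j • fderiv ℝ g (s • p.1, p.2) (Pi.single j 1, 0)) s := by
  have h1 : HasFDerivAt g (fderiv ℝ g (s • p.1, p.2)) (s • p.1, p.2) :=
    ((hg.contDiffAt (Metric.isOpen_ball.mem_nhds (smul_mem_ball hp hs))).differentiableAt
      (by simp)).hasFDerivAt
  have h2 : HasDerivAt (fun s : ℝ => (s • p.1, p.2)) (p.1, (0 : N)) s := by
    have := ((hasDerivAt_id s).smul_const p.1).prodMk (hasDerivAt_const s p.2)
    simpa using this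
  rw [← fderiv_radial_eq_sum]
  exact h1.comp_hasDerivAt s h2

lemma contDiffOn_radialAverage [FiniteDimensional ℝ N] [CompleteSpace F] {y₀ : N} {ε : ℝ}
    {g : (Fin d → ℝ) × N → F}
    (hg : ContDiffOn ℝ ∞ g (Metric.ball (0, y₀) ε)) {w : ℝ → ℝ} (hw : ContDiff ℝ ∞ w)
    (j : Fin d) : ContDiffOn ℝ ∞ (radialAverage w j g) (Metric.ball (0, y₀) ε) := by
  refine contDiffOn_setIntegral (EN := ℝ) (μ := volume)
    (f := fun (s : ℝ) (p : (Fin d → ℝ) × N) =>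
      w s • fderiv ℝ g (s • p.1, p.2) (Pi.single j 1, 0))
    isCompact_Icc isClosed_Icc Metric.isOpen_ball fun s hs p hp => ?_
  have := (contDiffAt_radial hg hw j hs hp).contMDiffAt
  rwa [modelWithCornersSelf_prod, ← chartedSpaceSelf_prod] at this

/-- Fundamental theorem of calculus along the segment from `(0, y)` to `(u, y)`. -/
lemma sum_radialAverage_one [CompleteSpace F] {y₀ : N} {ε : ℝ} {g : (Fin d → ℝ) × N → F}
    (hg : ContDiffOn ℝ ∞ g (Metric.ball (0, y₀) ε)) {p : (Fin d → ℝ) × N}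
    (hp : p ∈ Metric.ball (0, y₀) ε) :
    ∑ j, p.1 j • radialAverage (fun _ => 1) j g p = g p - g (0, p.2) := by
  have hi : ∀ j, IntegrableOn (fun s : ℝ => p.1 j • (1 : ℝ) •
      fderiv ℝ g (s • p.1, p.2) (Pi.single j 1, 0)) (Icc 0 1) := fun j =>
    (integrableOn_radial hg (w := fun _ => 1) contDiff_const j hp).smul (p.1 j)
  have h := intervalIntegral.integral_eq_sub_of_hasDerivAt (a := 0) (b := 1)
    (f := fun s : ℝ => g (s • p.1, p.2))
    (f' := fun s => ∑ j, p.1 j • (1 : ℝ) • fderiv ℝ g (s • p.1, p.2) (Pi.single j 1, 0))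
    (fun s hs => by
      rw [uIcc_of_le zero_le_one] at hs
      simpa using hasDerivAt_radial hg hs hp)
    (by
      rw [intervalIntegrable_iff_integrableOn_Icc_of_le zero_le_one]
      exact integrable_finsetSum _ fun j _ => hi j)
  rw [intervalIntegral.integral_of_le zero_le_one, ← integral_Icc_eq_integral_Ioc,
    integral_finsetSum _ fun j _ => hi j] at h
  simp only [integral_smul] at h
  simpa [radialAverage] using h

/-- The homotopy formula for the Koszul complex of the coordinates `u₁, …, u_d`, in degree one. -/
lemma sum_radialAverage_koszul [CompleteSpace F] {y₀ : N} {ε : ℝ}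
    {g : Fin d → (Fin d → ℝ) × N → F} (hg : ∀ i, ContDiffOn ℝ ∞ (g i) (Metric.ball (0, y₀) ε))
    (hrel : ∀ p ∈ Metric.ball ((0 : Fin d → ℝ), y₀) ε, ∑ j, p.1 j • g j p = 0)
    {p : (Fin d → ℝ) × N} (hp : p ∈ Metric.ball (0, y₀) ε) (i : Fin d) :
    ∑ j, p.1 j • (radialAverage (fun s => s) j (g i) p - radialAverage (fun s => s) i (g j) p)
      = g i p := by
  have hi := fun i j => integrableOn_radial (hg i) (w := fun s => s) contDiff_id j hp
  have hsub : ∀ j, IntegrableOn (fun s : ℝ => p.1 j •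
      (s • fderiv ℝ (g i) (s • p.1, p.2) (Pi.single j 1, 0)
        - s • fderiv ℝ (g j) (s • p.1, p.2) (Pi.single i 1, 0))) (Icc 0 1) :=
    fun j => (((hi i j).sub (hi j i)).smul (p.1 j))
  let π : Fin d → ((Fin d → ℝ) × N →L[ℝ] ℝ) := fun j =>
    (ContinuousLinearMap.proj (R := ℝ) (φ := fun _ : Fin d => ℝ) j).comp
      (ContinuousLinearMap.fst ℝ (Fin d → ℝ) N)
  -- differentiating the relation in the direction `uᵢ`
  have hd : ∀ s ∈ Icc (0 : ℝ) 1, ∑ j, p.1 j • s • fderiv ℝ (g j) (s • p.1, p.2) (Pi.single i 1, 0)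
      = -g i (s • p.1, p.2) := by
    intro s hs
    have hq := smul_mem_ball hp hs
    have hD : ∀ j, HasFDerivAt (g j) (fderiv ℝ (g j) (s • p.1, p.2)) (s • p.1, p.2) := fun j =>
      (((hg j).contDiffAt (Metric.isOpen_ball.mem_nhds hq)).differentiableAt
        (by simp)).hasFDerivAt
    have h1 : HasFDerivAt (fun q : (Fin d → ℝ) × N => ∑ j, q.1 j • g j q)
        (∑ j, ((s • p.1) j • fderiv ℝ (g j) (s • p.1, p.2) +
          (π j).smulRight (g j (s • p.1, p.2))))
        (s • p.1, p.2) := by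
      refine HasFDerivAt.fun_sum fun j _ => ?_
      exact HasFDerivAt.smul (π j).hasFDerivAt (hD j)
    have h2 : HasFDerivAt (fun q : (Fin d → ℝ) × N => ∑ j, q.1 j • g j q)
        (0 : (Fin d → ℝ) × N →L[ℝ] F) (s • p.1, p.2) := by
      refine (hasFDerivAt_const (0 : F) _).congr_of_eventuallyEq ?_
      filter_upwards [Metric.isOpen_ball.mem_nhds hq] with q hq
      exact hrel q hq
    have h3 := congrArg (fun L => L ((Pi.single i 1 : Fin d → ℝ), (0 : N))) (h1.unique h2)
    simp [π, Finset.sum_add_distrib, Pi.single_apply, mul_smul] at h3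
    simp only [smul_comm (p.1 _) s]
    exact eq_neg_of_add_eq_zero_left h3
  have h := intervalIntegral.integral_eq_sub_of_hasDerivAt (a := 0) (b := 1)
    -- by the relation, the integrand is the derivative of `s ↦ s gᵢ(su, y)`
    (f := fun s : ℝ => s • g i (s • p.1, p.2))
    (f' := fun s => ∑ j, p.1 j • (s • fderiv ℝ (g i) (s • p.1, p.2) (Pi.single j 1, 0)
      - s • fderiv ℝ (g j) (s • p.1, p.2) (Pi.single i 1, 0)))
    (fun s hs => by
      rw [uIcc_of_le zero_le_one] at hs
      have := (hasDerivAt_id s).smul (hasDerivAt_radial (hg i) hs hp)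
      refine this.congr_deriv ?_
      simp only [smul_sub, Finset.sum_sub_distrib]
      rw [hd s hs]
      simp [Finset.smul_sum, smul_comm s])
    (by
      rw [intervalIntegrable_iff_integrableOn_Icc_of_le zero_le_one]
      exact integrable_finsetSum _ fun j _ => hsub j)
  rw [intervalIntegral.integral_of_le zero_le_one, ← integral_Icc_eq_integral_Ioc,
    integral_finsetSum _ fun j _ => hsub j] at h
  simp only [integral_smul] at h
  simp only [integral_sub (hi i _) (hi _ i)] at h
  simpa [radialAverage] using h

end Local

variable {E : Type*} [NormedAddCommGroup E] [NormedSpace ℝ E]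
  {M : Type*} [TopologicalSpace M] [ChartedSpace E M] [IsManifold 𝓘(ℝ, E) ∞ M] {d : ℕ}

/-- Independence at `z` of the differentials of the functions `f₁, …, f_d`: no nontrivial linear
combination of the functions has a critical point at `z`. -/
def IndepAt (E : Type*) [NormedAddCommGroup E] [NormedSpace ℝ E] {M : Type*} [TopologicalSpace M]
    [ChartedSpace E M] {d : ℕ} (f : Fin d → M → ℝ) (z : M) : Prop :=
  ∀ c : Fin d → ℝ, mfderiv 𝓘(ℝ, E) 𝓘(ℝ, ℝ) (fun x => ∑ i, c i * f i x) z = 0 → c = 0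

lemma contDiffOn_extChart {F : Type*} [NormedAddCommGroup F] [NormedSpace ℝ F] {f : M → F}
    (hf : ContMDiff 𝓘(ℝ, E) 𝓘(ℝ, F) ∞ f) (z : M) :
    ContDiffOn ℝ ∞ (fun q => f ((extChartAt 𝓘(ℝ, E) z).symm q))
      (extChartAt 𝓘(ℝ, E) z).target :=
  contMDiffOn_iff_contDiffOn.1 (hf.comp_contMDiffOn (contMDiffOn_extChartAt_symm z))

lemma IndepAt.surjective {f : Fin d → M → ℝ}
    (hf : ∀ i, ContMDiff 𝓘(ℝ, E) 𝓘(ℝ, ℝ) ∞ (f i)) {z : M} (hreg : IndepAt E f z) :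
    Function.Surjective (fderiv ℝ (fun q i => f i ((extChartAt 𝓘(ℝ, E) z).symm q))
      (extChartAt 𝓘(ℝ, E) z z)) := by
  set φ := extChartAt 𝓘(ℝ, E) z with hφ
  set L := fderiv ℝ (fun q i => f i (φ.symm q)) (φ z) with hL
  have hT : φ.target ∈ 𝓝 (φ z) := extChartAt_target_mem_nhds z
  have hgi : ∀ i, DifferentiableAt ℝ (fun q => f i (φ.symm q)) (φ z) := fun i =>
    ((contDiffOn_extChart (hf i) z).contDiffAt hT).differentiableAt (by simp)
  -- a functional vanishing on the image gives a combination of the `fᵢ` with a critical point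
  by_contra hs
  have hlt : LinearMap.range (L : E →ₗ[ℝ] Fin d → ℝ) < ⊤ :=
    lt_top_iff_ne_top.2 fun h => hs (LinearMap.range_eq_top.1 h)
  obtain ⟨l, hl0, hl⟩ := Submodule.exists_le_ker_of_lt_top _ hlt
  let c : Fin d → ℝ := fun i => l (Pi.single i 1)
  have hlc : ∀ u : Fin d → ℝ, l u = ∑ i, u i * c i := fun u => by
    rw [LinearMap.pi_apply_eq_sum_univ l u]
    refine Finset.sum_congr rfl fun i _ => ?_
    rw [smul_eq_mul]
    congr 2
    ext j
    simp [Pi.single_apply, eq_comm]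
  have hc : c = 0 := by
    refine hreg c ?_
    have hd : MDifferentiableAt 𝓘(ℝ, E) 𝓘(ℝ, ℝ) (fun x => ∑ i, c i * f i x) z :=
      ((contMDiff_finsetSum fun i _ => contMDiff_const.mul (hf i)) :
        ContMDiff 𝓘(ℝ, E) 𝓘(ℝ, ℝ) ∞ _).mdifferentiableAt (by simp)
    have h1 : HasFDerivAt (fun q => ∑ i, c i * f i (φ.symm q))
        (∑ i, c i • fderiv ℝ (fun q => f i (φ.symm q)) (φ z)) (φ z) :=
      HasFDerivAt.fun_sum fun i _ => (hgi i).hasFDerivAt.const_mul (c i)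
    have h2 : (∑ i, c i • fderiv ℝ (fun q => f i (φ.symm q)) (φ z)) = 0 := by
      ext v
      have hv : l (L v) = 0 := hl ⟨v, rfl⟩
      rw [hlc] at hv
      have hLv : ∀ i, L v i = fderiv ℝ (fun q => f i (φ.symm q)) (φ z) v := fun i => by
        rw [hL, fderiv_pi hgi]; rfl
      simp only [hLv] at hv
      rw [_root_.sum_apply, _root_.zero_apply, ← hv]
      exact Finset.sum_congr rfl fun i _ => mul_comm _ _
    rw [h2] at h1
    rw [hd.mfderiv]
    simp only [writtenInExtChartAt, extChartAt_model_space_eq_id, PartialEquiv.refl_coe,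
      Function.id_comp, modelWithCornersSelf_coe, range_id, fderivWithin_univ]
    exact h1.fderiv
  refine hl0 (LinearMap.ext fun u => ?_)
  rw [hlc, hc]
  simp

variable [FiniteDimensional ℝ E]

/-- Near a point of a regular level set, the functions `f₁, …, f_d` are part of a coordinate
system. -/
lemma IndepAt.exists_straightening {f : Fin d → M → ℝ}
    (hf : ∀ i, ContMDiff 𝓘(ℝ, E) 𝓘(ℝ, ℝ) ∞ (f i)) {z : M} (hz : ∀ i, f i z = 0)
    (hreg : IndepAt E f z) :
    ∃ (N : Submodule ℝ E) (y₀ : N) (ε : ℝ) (U : Set M) (Ψ : M → (Fin d → ℝ) × N)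
      (Θ : (Fin d → ℝ) × N → M), U ∈ 𝓝 z ∧
      ContMDiffOn 𝓘(ℝ, E) 𝓘(ℝ, (Fin d → ℝ) × N) ∞ Ψ U ∧
      ContMDiffOn 𝓘(ℝ, (Fin d → ℝ) × N) 𝓘(ℝ, E) ∞ Θ (Metric.ball (0, y₀) ε) ∧
      (∀ x ∈ U, Ψ x ∈ Metric.ball (0, y₀) ε ∧ Θ (Ψ x) = x ∧ ∀ i, (Ψ x).1 i = f i x) ∧
      ∀ p ∈ Metric.ball ((0 : Fin d → ℝ), y₀) ε, ∀ i, f i (Θ p) = p.1 i := by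
  have hsurj := hreg.surjective hf
  set φ := extChartAt 𝓘(ℝ, E) z with hφ
  set g : E → Fin d → ℝ := fun q i => f i (φ.symm q) with hg
  set L := fderiv ℝ g (φ z) with hL
  have hTo : IsOpen φ.target := isOpen_extChartAt_target z
  have hzT : φ z ∈ φ.target := mem_extChartAt_target z
  have hgs : ContDiffOn ℝ ∞ g φ.target := contDiffOn_pi.2 fun i => contDiffOn_extChart (hf i) z
  -- the coordinates are the `fᵢ` together with a projection `q` to the kernel of their derivative
  let N : Submodule ℝ E := LinearMap.ker (L : E →ₗ[ℝ] Fin d → ℝ)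
  obtain ⟨q, hq⟩ := LinearMap.exists_leftInverse_of_injective N.subtype N.ker_subtype
  have hq' : ∀ n : N, q n = n := fun n => LinearMap.congr_fun hq n
  have hbij : Function.Bijective ((L : E →ₗ[ℝ] Fin d → ℝ).prod q) := by
    constructor
    · rw [injective_iff_map_eq_zero]
      intro v hv
      have h1 : L v = 0 := congrArg Prod.fst hv
      have h2 : q v = 0 := congrArg Prod.snd hv
      have h3 := hq' ⟨v, h1⟩
      rw [h2] at h3
      exact (congrArg Subtype.val h3).symm
    · rintro ⟨u, n⟩
      obtain ⟨v, hv⟩ := hsurj u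
      have h0 : ∀ m : N, L (m : E) = 0 := fun m => m.2
      refine ⟨v - q v + n, Prod.ext ?_ ?_⟩
      · change L (v - q v + n) = u
        rw [map_add, map_sub, h0, h0, sub_zero, add_zero, hv]
      · change q (v - q v + n) = n
        rw [map_add, map_sub, hq', hq', sub_self, zero_add]
  let Λ : E ≃L[ℝ] (Fin d → ℝ) × N := (LinearEquiv.ofBijective _ hbij).toContinuousLinearEquiv
  let h : E → (Fin d → ℝ) × N := fun p => (g p, q p)
  have hqs : ContDiff ℝ ∞ q := (LinearMap.toContinuousLinearMap q).contDiff
  have hh : ContDiffOn ℝ ∞ h φ.target := hgs.prodMk hqs.contDiffOn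
  have hhz : ContDiffAt ℝ ∞ h (φ z) := hh.contDiffAt (hTo.mem_nhds hzT)
  have hΛ : HasFDerivAt h (Λ : E →L[ℝ] (Fin d → ℝ) × N) (φ z) :=
    (((hgs.contDiffAt (hTo.mem_nhds hzT)).differentiableAt (by simp)).hasFDerivAt).prodMk
      (LinearMap.toContinuousLinearMap q).hasFDerivAt
  let e := hhz.toOpenPartialHomeomorph h hΛ (by simp)
  have hes : φ z ∈ e.source := hhz.mem_toOpenPartialHomeomorph_source hΛ (by simp)
  -- the derivative of `h` stays invertible near `φ z`
  have hinv : ∀ᶠ p in 𝓝 (φ z), p ∈ φ.target ∧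
      fderiv ℝ h p ∈ range ((↑) : (E ≃L[ℝ] (Fin d → ℝ) × N) → E →L[ℝ] (Fin d → ℝ) × N) := by
    refine Filter.Eventually.and (hTo.mem_nhds hzT) ?_
    have hc : ContinuousAt (fderiv ℝ h) (φ z) :=
      (hhz.fderiv_right (m := 0) (by simp)).continuousAt
    refine hc ?_
    rw [hΛ.fderiv]
    exact ContinuousLinearEquiv.nhds Λ
  obtain ⟨O, hO, hOo, hzO⟩ := eventually_nhds_iff.1 hinv
  have hB : e.target ∩ e.symm ⁻¹' O ∈ 𝓝 (e (φ z)) := by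
    refine (e.isOpen_inter_preimage_symm hOo).mem_nhds ⟨e.map_source hes, ?_⟩
    rw [mem_preimage, e.left_inv hes]
    exact hzO
  have hez : e (φ z) = (0, q (φ z)) := by
    refine Prod.ext (funext fun i => ?_) rfl
    change f i (φ.symm (φ z)) = 0
    rw [extChartAt_to_inv, hz]
  rw [hez] at hB
  obtain ⟨ε, hε, hball⟩ := Metric.mem_nhds_iff.1 hB
  have hΘe : ∀ p ∈ Metric.ball ((0 : Fin d → ℝ), q (φ z)) ε, e.symm p ∈ φ.target := fun p hp =>
    (hO _ (hball hp).2).1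
  have hΦ : ContMDiffOn 𝓘(ℝ, E) 𝓘(ℝ, E) ∞ φ (chartAt E z).source := contMDiffOn_extChartAt
  refine ⟨N, q (φ z), ε, φ.source ∩ φ ⁻¹' (e.source ∩ h ⁻¹' Metric.ball (0, q (φ z)) ε),
    fun x => h (φ x), fun p => φ.symm (e.symm p), ?_, ?_, ?_, ?_, ?_⟩
  · refine Filter.inter_mem (extChartAt_source_mem_nhds z) ?_
    refine (continuousAt_extChartAt z).preimage_mem_nhds (Filter.inter_mem
      (e.open_source.mem_nhds hes) (hhz.continuousAt.preimage_mem_nhds ?_))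
    rw [show h (φ z) = (0, q (φ z)) from hez]
    exact Metric.ball_mem_nhds _ hε
  · refine ContMDiffOn.comp (t := φ.target) hh.contMDiffOn
      (hΦ.mono fun x hx => by simpa [φ] using hx.1) fun x hx => ?_
    exact φ.map_source hx.1
  · refine ContMDiffOn.comp (t := φ.target) (contMDiffOn_extChartAt_symm z) ?_ hΘe
    intro p hp
    obtain ⟨hp1, hp2⟩ := hO _ (hball hp).2
    obtain ⟨Λ', hΛ'⟩ := hp2
    have hd : ContDiffAt ℝ ∞ h (e.symm p) := hh.contDiffAt (hTo.mem_nhds hp1)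
    refine (e.contDiffAt_symm (hball hp).1 (f₀' := Λ') ?_ hd).contMDiffAt.contMDiffWithinAt
    rw [hΛ']
    exact (hd.differentiableAt (by simp)).hasFDerivAt
  · rintro x ⟨hx1, hx2, hx3⟩
    refine ⟨hx3, ?_, fun i => ?_⟩
    · change φ.symm (e.symm (e (φ x))) = x
      rw [e.left_inv hx2, φ.left_inv hx1]
    · change f i (φ.symm (φ x)) = f i x
      rw [φ.left_inv hx1]
  · intro p hp i
    have := e.right_inv (hball hp).1
    exact congrFun (congrArg Prod.fst this) i

variable [T2Space M] [SigmaCompactSpace M] {F : Type*} [NormedAddCommGroup F] [NormedSpace ℝ F]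
  [CompleteSpace F]

/-- Smooth functions vanishing on a regular level set `f₁ = … = f_d = 0` are combinations of
`f₁, …, f_d`. -/
theorem exists_eq_sum_of_vanish {f : Fin d → M → ℝ}
    (hf : ∀ i, ContMDiff 𝓘(ℝ, E) 𝓘(ℝ, ℝ) ∞ (f i))
    (hreg : ∀ z, (∀ i, f i z = 0) → IndepAt E f z) {a : M → F}
    (ha : ContMDiff 𝓘(ℝ, E) 𝓘(ℝ, F) ∞ a) (h0 : ∀ x, (∀ i, f i x = 0) → a x = 0) :
    ∃ c : Fin d → M → F, (∀ i, ContMDiff 𝓘(ℝ, E) 𝓘(ℝ, F) ∞ (c i)) ∧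
      ∀ x, a x = ∑ i, f i x • c i x := by
  classical
  suffices h : ∃ c : C^∞⟮𝓘(ℝ, E), M; 𝓘(ℝ, Fin d → F), Fin d → F⟯,
      ∀ x, c x ∈ {c : Fin d → F | a x = ∑ i, f i x • c i} by
    obtain ⟨c, hc⟩ := h
    exact ⟨fun i x => c x i, fun i => contMDiff_pi_space.1 c.contMDiff i, hc⟩
  refine exists_contMDiffMap_forall_mem_convex_of_local 𝓘(ℝ, E) (fun x => ?_) (fun z => ?_)
  · intro c hc c' hc' s s' _ _ hs
    change a x = _ at hc hc'
    change a x = _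
    simp only [Pi.add_apply, Pi.smul_apply, smul_add, Finset.sum_add_distrib, smul_comm (f _ x)]
    rw [← Finset.smul_sum, ← Finset.smul_sum, ← hc, ← hc', ← add_smul, hs, one_smul]
  · by_cases hz : ∀ i, f i z = 0
    · obtain ⟨N, y₀, ε, U, Ψ, Θ, hU, hΨ, hΘ, hΨΘ, hfΘ⟩ := (hreg z hz).exists_straightening hf hz
      have hg : ContDiffOn ℝ ∞ (fun p => a (Θ p)) (Metric.ball (0, y₀) ε) :=
        contMDiffOn_iff_contDiffOn.1 (ha.comp_contMDiffOn hΘ)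
      refine ⟨U, hU, fun x i => radialAverage (fun _ => 1) i (fun p => a (Θ p)) (Ψ x), ?_,
        fun x hx => ?_⟩
      · refine contMDiffOn_pi_space.2 fun i => ?_
        exact ContMDiffOn.comp (t := Metric.ball (0, y₀) ε)
          (contDiffOn_radialAverage hg contDiff_const i).contMDiffOn hΨ fun x hx => (hΨΘ x hx).1
      · obtain ⟨h1, h2, h3⟩ := hΨΘ x hx
        have := sum_radialAverage_one hg h1
        have hmem : ((0 : Fin d → ℝ), (Ψ x).2) ∈ Metric.ball (0, y₀) ε := by
          simpa using smul_mem_ball h1 (s := 0) (by simp)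
        rw [h2, h0 (Θ (0, (Ψ x).2)) fun i => by rw [hfΘ _ hmem]; rfl, sub_zero] at this
        simp only [h3] at this
        exact this.symm
    · push Not at hz
      obtain ⟨m, hm⟩ := hz
      refine ⟨{x | f m x ≠ 0}, (hf m).continuous.continuousAt.eventually_ne hm,
        fun x => Pi.single m ((f m x)⁻¹ • a x), ?_, fun x hx => ?_⟩
      · refine contMDiffOn_pi_space.2 fun i => ?_
        by_cases h : i = m
        · subst h
          simp only [Pi.single_eq_same]
          exact ((hf i).contMDiffOn.inv₀ fun x hx => hx).smul ha.contMDiffOn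
        · simp only [Pi.single_eq_of_ne h]
          exact contMDiffOn_const
      · change a x = ∑ i, f i x • (Pi.single m ((f m x)⁻¹ • a x) : Fin d → F) i
        rw [Finset.sum_eq_single m (fun i _ hi => by simp [hi]) (by simp), Pi.single_eq_same,
          smul_inv_smul₀ hx]

/-- Exactness in degree one of the Koszul complex of functions `f₁, …, f_d` with regular zero
set. -/
theorem exists_antisymm_of_relation {f : Fin d → M → ℝ}
    (hf : ∀ i, ContMDiff 𝓘(ℝ, E) 𝓘(ℝ, ℝ) ∞ (f i))
    (hreg : ∀ z, (∀ i, f i z = 0) → IndepAt E f z) {r : Fin d → M → F}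
    (hr : ∀ i, ContMDiff 𝓘(ℝ, E) 𝓘(ℝ, F) ∞ (r i)) (h0 : ∀ x, ∑ i, f i x • r i x = 0) :
    ∃ t : Fin d → Fin d → M → F, (∀ i j, ContMDiff 𝓘(ℝ, E) 𝓘(ℝ, F) ∞ (t i j)) ∧
      ∀ i x, r i x = ∑ j, f j x • (t i j x - t j i x) := by
  classical
  suffices h : ∃ c : C^∞⟮𝓘(ℝ, E), M; 𝓘(ℝ, Fin d → Fin d → F), Fin d → Fin d → F⟯,
      ∀ x, c x ∈ {c : Fin d → Fin d → F | ∀ i, r i x = ∑ j, f j x • (c i j - c j i)} by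
    obtain ⟨c, hc⟩ := h
    exact ⟨fun i j x => c x i j,
      fun i j => contMDiff_pi_space.1 (contMDiff_pi_space.1 c.contMDiff i) j, fun i x => hc x i⟩
  refine exists_contMDiffMap_forall_mem_convex_of_local 𝓘(ℝ, E) (fun x => ?_) (fun z => ?_)
  · intro c hc c' hc' s s' _ _ hs i
    have e : ∀ j, f j x • ((s • c + s' • c') i j - (s • c + s' • c') j i)
        = s • (f j x • (c i j - c j i)) + s' • (f j x • (c' i j - c' j i)) := fun j => by
      simp only [Pi.add_apply, Pi.smul_apply]
      module
    simp only [e, Finset.sum_add_distrib]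
    rw [← Finset.smul_sum, ← Finset.smul_sum, ← hc i, ← hc' i, ← add_smul, hs, one_smul]
  · by_cases hz : ∀ i, f i z = 0
    · obtain ⟨N, y₀, ε, U, Ψ, Θ, hU, hΨ, hΘ, hΨΘ, hfΘ⟩ := (hreg z hz).exists_straightening hf hz
      have hg : ∀ i, ContDiffOn ℝ ∞ (fun p => r i (Θ p)) (Metric.ball (0, y₀) ε) := fun i =>
        contMDiffOn_iff_contDiffOn.1 ((hr i).comp_contMDiffOn hΘ)
      refine ⟨U, hU, fun x i j => radialAverage (fun s => s) j (fun p => r i (Θ p)) (Ψ x), ?_,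
        fun x hx i => ?_⟩
      · refine contMDiffOn_pi_space.2 fun i => contMDiffOn_pi_space.2 fun j => ?_
        exact ContMDiffOn.comp (t := Metric.ball (0, y₀) ε)
          (contDiffOn_radialAverage (hg i) contDiff_id j).contMDiffOn hΨ fun x hx => (hΨΘ x hx).1
      · obtain ⟨h1, h2, h3⟩ := hΨΘ x hx
        have := sum_radialAverage_koszul hg (fun p hp => by
          rw [← h0 (Θ p)]
          exact Finset.sum_congr rfl fun j _ => by rw [hfΘ p hp]) h1 i
        rw [h2] at this
        simp only [h3] at this
        exact this.symm
    · push Not at hz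
      obtain ⟨m, hm⟩ := hz
      refine ⟨{x | f m x ≠ 0}, (hf m).continuous.continuousAt.eventually_ne hm,
        fun x i => Pi.single m ((f m x)⁻¹ • r i x), ?_, fun x hx i => ?_⟩
      · refine contMDiffOn_pi_space.2 fun i => contMDiffOn_pi_space.2 fun j => ?_
        by_cases h : j = m
        · subst h
          simp only [Pi.single_eq_same]
          exact ((hf j).contMDiffOn.inv₀ fun x hx => hx).smul (hr i).contMDiffOn
        · simp only [Pi.single_eq_of_ne h]
          exact contMDiffOn_const
      · simp only [smul_sub, Finset.sum_sub_distrib]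
        rw [Finset.sum_eq_single m (fun j _ hj => by simp [hj]) (by simp), Pi.single_eq_same,
          smul_inv_smul₀ hx]
        by_cases h : i = m
        · subst h
          simp only [Pi.single_eq_same, smul_comm (f _ x)]
          rw [← Finset.smul_sum, h0, smul_zero, sub_zero]
        · simp [Pi.single_eq_of_ne h]

end Koszul

/-! ### The Lie algebra of a semidirect product of Lie groups -/

section LieFacts

open Set Filter Topology

section Der

variable {E₁ H₁ M₁ E₂ H₂ M₂ E₃ H₃ M₃ : Type*}
  [NormedAddCommGroup E₁] [NormedSpace ℝ E₁] [TopologicalSpace H₁] [TopologicalSpace M₁]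
  [ChartedSpace H₁ M₁]
  [NormedAddCommGroup E₂] [NormedSpace ℝ E₂] [TopologicalSpace H₂] [TopologicalSpace M₂]
  [ChartedSpace H₂ M₂]
  [NormedAddCommGroup E₃] [NormedSpace ℝ E₃] [TopologicalSpace H₃] [TopologicalSpace M₃]
  [ChartedSpace H₃ M₃]
  {I₁ : ModelWithCorners ℝ E₁ H₁} {I₂ : ModelWithCorners ℝ E₂ H₂} {I₃ : ModelWithCorners ℝ E₃ H₃}

/-- The manifold derivative at a point, as a map between model vector spaces. The type does not
depend on the values of `f`, so equalities between points of the target can be used freely. -/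
def HasDer (I₁ : ModelWithCorners ℝ E₁ H₁) (I₂ : ModelWithCorners ℝ E₂ H₂) (f : M₁ → M₂) (x : M₁)
    (L : E₁ →L[ℝ] E₂) : Prop :=
  HasMFDerivAt I₁ I₂ f x L

lemma HasDer.comp {g : M₂ → M₃} {f : M₁ → M₂} {x : M₁} {y : M₂} {L' : E₂ →L[ℝ] E₃}
    {L : E₁ →L[ℝ] E₂} (hg : HasDer I₂ I₃ g y L') (hf : HasDer I₁ I₂ f x L) (h : f x = y) :
    HasDer I₁ I₃ (g ∘ f) x (L'.comp L) := by
  subst h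
  exact HasMFDerivAt.comp x hg hf

lemma HasDer.unique {f : M₁ → M₂} {x : M₁} {L L' : E₁ →L[ℝ] E₂} (h : HasDer I₁ I₂ f x L)
    (h' : HasDer I₁ I₂ f x L') : L = L' :=
  hasMFDerivAt_unique h h'

lemma hasDer_const (c : M₂) (x : M₁) : HasDer I₁ I₂ (fun _ : M₁ => c) x 0 :=
  hasMFDerivAt_const c x

lemma hasDer_of_contMDiffAt {f : M₁ → M₂} {x : M₁} (h : ContMDiffAt I₁ I₂ ∞ f x) :
    HasDer I₁ I₂ f x (mfderiv I₁ I₂ f x) :=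
  (h.mdifferentiableAt (by simp)).hasMFDerivAt

lemma HasDer.mfderiv_apply {f : M₁ → M₂} {x : M₁} {L : E₁ →L[ℝ] E₂} (h : HasDer I₁ I₂ f x L)
    (v : E₁) : (mfderiv I₁ I₂ f x v : E₂) = L v :=
  congrArg (fun L : E₁ →L[ℝ] E₂ => L v) (HasMFDerivAt.mfderiv h)

end Der

variable {EG : Type*} [NormedAddCommGroup EG] [NormedSpace ℝ EG]
  {G : Type*} [TopologicalSpace G] [ChartedSpace EG G] [Group G]
  {EH : Type*} [NormedAddCommGroup EH] [NormedSpace ℝ EH]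
  {H : Type*} [TopologicalSpace H] [ChartedSpace EH H] [Group H]
  {EK : Type*} [NormedAddCommGroup EK] [NormedSpace ℝ EK]
  {K : Type*} [TopologicalSpace K] [ChartedSpace EK K] [Group K]

lemma contMDiff_conj [LieGroup 𝓘(ℝ, EG) ∞ G] :
    ContMDiff (𝓘(ℝ, EG).prod 𝓘(ℝ, EG)) 𝓘(ℝ, EG) ∞ (fun p : G × G => p.1 * p.2 * p.1⁻¹) :=
  (contMDiff_fst.mul contMDiff_snd).mul ((contMDiff_inv 𝓘(ℝ, EG) ∞).comp contMDiff_fst)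

/-- The adjoint action, as a linear endomorphism of the model space of `G`. -/
noncomputable def Ad (g : G) : EG →L[ℝ] EG :=
  mfderiv 𝓘(ℝ, EG) 𝓘(ℝ, EG) (fun a : G => g * a * g⁻¹) 1

lemma hasDer_Ad [LieGroup 𝓘(ℝ, EG) ∞ G] (g : G) :
    HasDer 𝓘(ℝ, EG) 𝓘(ℝ, EG) (fun a : G => g * a * g⁻¹) 1 (Ad g) :=
  hasDer_of_contMDiffAt
    (contMDiff_conj.comp (contMDiff_const.prodMk contMDiff_id)).contMDiffAt

/-- The adjoint action depends differentiably on the group element. -/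
lemma exists_hasDer_Ad [LieGroup 𝓘(ℝ, EG) ∞ G] (ζ : EG) : ∃ L : EG →L[ℝ] EG,
    HasDer 𝓘(ℝ, EG) 𝓘(ℝ, EG) (fun g : G => Ad g ζ) 1 L := by
  have h : ContMDiffAt 𝓘(ℝ, EG) 𝓘(ℝ, EG →L[ℝ] EG) ∞ (inTangentCoordinates 𝓘(ℝ, EG) 𝓘(ℝ, EG)
      (fun _ : G => (1 : G)) (fun x : G => x * 1 * x⁻¹) Ad 1) 1 :=
    ContMDiffAt.mfderiv (n := ∞) (m := ∞) (I := 𝓘(ℝ, EG)) (I' := 𝓘(ℝ, EG)) (x₀ := (1 : G))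
      (J := 𝓘(ℝ, EG))
      (fun g a : G => g * a * g⁻¹) (fun _ : G => (1 : G)) contMDiff_conj.contMDiffAt
      contMDiffAt_const (by simp)
  have e : inTangentCoordinates 𝓘(ℝ, EG) 𝓘(ℝ, EG) (fun _ : G => (1 : G))
      (fun x : G => x * 1 * x⁻¹) Ad 1 = Ad := by
    funext x
    have e1 : (fun x : G => x * 1 * x⁻¹) = fun _ => 1 := by ext; simp
    rw [e1]
    refine (inTangentCoordinates_eq (I := 𝓘(ℝ, EG)) (I' := 𝓘(ℝ, EG)) (fun _ : G => (1 : G))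
      (fun _ : G => (1 : G)) Ad (x₀ := (1 : G)) (x := x) (mem_chart_source EG (1 : G))
      (mem_chart_source EG (1 : G))).trans ?_
    ext v
    have h1 := fun w => (tangentBundleCore 𝓘(ℝ, EG) G).coordChange_self (achart EG (1 : G)) (1 : G)
      (mem_chart_source EG (1 : G)) w
    exact (h1 _).trans (congrArg (Ad x) (h1 v))
  rw [e] at h
  exact ⟨_, hasDer_of_contMDiffAt (h.clm_apply contMDiffAt_const)⟩

lemma hasDer_clm_Ad {F : Type*} [NormedAddCommGroup F] [NormedSpace ℝ F] {ζ : EG}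
    {L : EG →L[ℝ] EG} (hL : HasDer 𝓘(ℝ, EG) 𝓘(ℝ, EG) (fun g : G => Ad g ζ) 1 L)
    (ℓ : EG →L[ℝ] F) : HasDer 𝓘(ℝ, EG) 𝓘(ℝ, F) (fun g : G => ℓ (Ad g ζ)) 1 (ℓ.comp L) :=
  HasDer.comp (I₂ := 𝓘(ℝ, EG)) (show HasDer 𝓘(ℝ, EG) 𝓘(ℝ, F) ℓ (Ad (1 : G) ζ) ℓ from
    (ℓ.hasFDerivAt (x := Ad (1 : G) ζ)).hasMFDerivAt) hL rfl

lemma lieRange_id : lieRange (EG := EG) (EH := EG) (MonoidHom.id G) = Set.univ := by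
  refine eq_univ_of_forall fun ξ => ⟨ξ, ?_⟩
  exact (congrArg (fun L : EG →L[ℝ] EG => L ξ)
    (HasMFDerivAt.mfderiv (hasMFDerivAt_id (I := 𝓘(ℝ, EG)) (1 : G)))).symm

variable {iH : H →* G} {iK : K →* G}

lemma IsLieSemidirect.exists_mul
    (hS : IsLieSemidirect (EG := EG) (EH := EH) (EK := EK) iH iK) (g : G) :
    ∃ (a : iH.range) (b : iK.range), g = a * b := by
  obtain ⟨d, hd⟩ := hS.diffeo
  refine ⟨⟨iH (d.symm g).1, _, rfl⟩, ⟨iK (d.symm g).2, _, rfl⟩, ?_⟩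
  rw [← hd, d.apply_symm_apply]

variable [LieGroup 𝓘(ℝ, EG) ∞ G]

/-- The differential `D` at the identity of the projection `G → K` of a semidirect product. Its
kernel is the Lie algebra of `H`, and it is invariant under conjugation by elements of `H`. -/
lemma IsLieSemidirect.exists_projection
    (hS : IsLieSemidirect (EG := EG) (EH := EH) (EK := EK) iH iK) :
    ∃ D : EG →L[ℝ] EK, (∀ ξ : EG, D ξ = 0 ↔ ξ ∈ lieRange (EG := EG) (EH := EH) iH) ∧
      (∀ (h : H) (ξ : EG), D (Ad (iH h) ξ) = D ξ) ∧
      ∀ ξ : EG, ∃ x ∈ lieRange (EG := EG) (EH := EH) iH, ∃ y ∈ lieRange (EG := EG) (EH := EK) iK,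
        ξ = x + y := by
  obtain ⟨d, hd⟩ := hS.diffeo
  let p : G → K := fun g => (d.symm g).2
  have hd1 : d (1, 1) = 1 := by rw [hd]; simp
  have hd1' : d.symm 1 = (1, 1) := by rw [← hd1, d.symm_apply_apply]
  have hp1 : p 1 = 1 := by simp only [p, hd1']
  have hpd : ∀ h k, p (iH h * iK k) = k := fun h k => by
    have := d.symm_apply_apply (h, k)
    rw [hd] at this
    simp only [p, this]
  let I2 := 𝓘(ℝ, EH).prod 𝓘(ℝ, EK)
  have hps : ContMDiff 𝓘(ℝ, EG) 𝓘(ℝ, EK) ∞ p := contMDiff_snd.comp d.symm.contMDiff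
  obtain ⟨D, hD⟩ : ∃ D : EG →L[ℝ] EK, HasDer 𝓘(ℝ, EG) 𝓘(ℝ, EK) p 1 D :=
    ⟨_, hasDer_of_contMDiffAt hps.contMDiffAt⟩
  obtain ⟨d', hd'⟩ : ∃ L : EH × EK →L[ℝ] EG, HasDer I2 𝓘(ℝ, EG) d (1, 1) L :=
    ⟨_, hasDer_of_contMDiffAt d.contMDiff.contMDiffAt⟩
  obtain ⟨s', hs'⟩ : ∃ L : EG →L[ℝ] EH × EK, HasDer 𝓘(ℝ, EG) I2 d.symm 1 L :=
    ⟨_, hasDer_of_contMDiffAt d.symm.contMDiff.contMDiffAt⟩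
  have hds : d'.comp s' = ContinuousLinearMap.id ℝ EG := by
    have h1 := hd'.comp hs' hd1'
    have e : d ∘ d.symm = id := funext fun g => d.apply_symm_apply g
    rw [e] at h1
    exact h1.unique (hasMFDerivAt_id (1 : G))
  have hiH : ∀ α : EH, (mfderiv 𝓘(ℝ, EH) 𝓘(ℝ, EG) iH 1 α : EG) = d' (α, 0) := by
    have h1 : HasDer 𝓘(ℝ, EH) I2 (fun h : H => (h, (1 : K))) 1
        ((ContinuousLinearMap.id ℝ EH).prod 0) :=
      (hasMFDerivAt_id (1 : H)).prodMk (hasMFDerivAt_const (1 : K) (1 : H))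
    have h2 := hd'.comp h1 rfl
    have e : (d ∘ fun h : H => (h, (1 : K))) = iH := funext fun h => by simp [hd]
    rw [e] at h2
    exact fun α => h2.mfderiv_apply α
  have hiK : ∀ β : EK, (mfderiv 𝓘(ℝ, EK) 𝓘(ℝ, EG) iK 1 β : EG) = d' (0, β) := by
    have h1 : HasDer 𝓘(ℝ, EK) I2 (fun k : K => ((1 : H), k)) 1
        ((0 : EK →L[ℝ] EH).prod (ContinuousLinearMap.id ℝ EK)) :=
      (hasMFDerivAt_const (1 : H) (1 : K)).prodMk (hasMFDerivAt_id (1 : K))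
    have h2 := hd'.comp h1 rfl
    have e : (d ∘ fun k : K => ((1 : H), k)) = iK := funext fun h => by simp [hd]
    rw [e] at h2
    exact fun α => h2.mfderiv_apply α
  have hDd : ∀ v : EH × EK, D (d' v) = v.2 := by
    have h2 := hD.comp hd' hd1
    have e : (p ∘ d) = Prod.snd := funext fun x => by simp [p]
    rw [e] at h2
    have h3 : HasDer I2 𝓘(ℝ, EK) (Prod.snd : H × K → K) (1, 1) (ContinuousLinearMap.snd ℝ EH EK) :=
      hasMFDerivAt_snd _
    exact fun v => congrArg (fun L : EH × EK →L[ℝ] EK => L v) (h2.unique h3)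
  have hsplit : ∀ ξ : EG, ξ = d' ((s' ξ).1, 0) + d' (0, (s' ξ).2) := fun ξ => by
    rw [← map_add]
    have := congrArg (fun L : EG →L[ℝ] EG => L ξ) hds
    simpa using this.symm
  refine ⟨D, fun ξ => ⟨fun h => ?_, ?_⟩, fun h ξ => ?_, fun ξ => ?_⟩
  · have h2 := hsplit ξ
    rw [h2, map_add, hDd, hDd, zero_add] at h
    refine ⟨(s' ξ).1, ?_⟩
    rw [hiH]
    change (s' ξ).2 = 0 at h
    have h0 : d' (0, 0) = 0 := map_zero d'
    rw [h, h0, add_zero] at h2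
    exact h2
  · rintro ⟨α, rfl⟩
    exact (congrArg D (hiH α)).trans (hDd (α, 0))
  · have h2 := hD.comp (hasDer_Ad (iH h)) (mul_inv_eq_one.2 (mul_one (iH h)))
    have e : (p ∘ fun a : G => iH h * a * (iH h)⁻¹) = p := by
      funext g
      obtain ⟨⟨a, b⟩, rfl⟩ := d.surjective g
      have hn := hS.normal.conj_mem (iH h⁻¹) ⟨_, rfl⟩ (iK b)
      obtain ⟨c, hc⟩ := hn
      have : iH h * (iH a * iK b) * (iH h)⁻¹ = iH (h * a * c) * iK b := by
        simp [hc, mul_assoc]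
      change p (iH h * d (a, b) * (iH h)⁻¹) = p (d (a, b))
      simp only [hd, this, hpd]
    rw [e] at h2
    exact congrArg (fun L : EG →L[ℝ] EK => L ξ) (h2.unique hD)
  · exact ⟨_, ⟨(s' ξ).1, (hiH _).symm⟩, _, ⟨(s' ξ).2, (hiK _).symm⟩, hsplit ξ⟩

section Comoment

variable {𝕜 : Type*} [RCLike 𝕜] {E : Type*} [NormedAddCommGroup E] [NormedSpace ℝ E]
  {M : Type*} [TopologicalSpace M] [ChartedSpace E M] [MulAction G M]
  {P : PoissonBracket 𝕜 (smoothFunctions 𝕜 E M)} {Q : DefQuant P}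
  (T : LieHamiltonianAction (EG := EG) (G := G) Q)

/-- An element invariant under a Lie subgroup commutes with its moments. -/
lemma comoment_commute {i : H →* G} (hi : ContMDiff 𝓘(ℝ, EH) 𝓘(ℝ, EG) ∞ i)
    (hsm : ContMDiff (𝓘(ℝ, EG).prod 𝓘(ℝ, E)) 𝓘(ℝ, E) ∞ (fun p : G × M => p.1 • p.2))
    {b : Q.Alg} (hb : ∀ h, T.act (i h) b = b) {ξ : GroupLieAlgebra 𝓘(ℝ, EG) G}
    (hξ : ξ ∈ lieRange (EG := EG) (EH := EH) i) : T.comoment ξ * b = b * T.comoment ξ := by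
  obtain ⟨α, rfl⟩ := hξ
  obtain ⟨c, hc, e⟩ := T.comoment_comm
    (mfderiv 𝓘(ℝ, EH) 𝓘(ℝ, EG) i 1 α : EG) b
  have hc0 : c = 0 := by
    refine DefQuant.alg_ext fun m => ?_
    rw [Q.coeff_zero']
    refine Subtype.ext (funext fun x => ?_)
    rw [hc]
    have hs : ContMDiff 𝓘(ℝ, EG) 𝓘(ℝ, 𝕜) ∞ (fun g : G => (Q.coeff m b).1 (g⁻¹ • x)) :=
      ContMDiff.comp (Q.coeff m b).2
        (hsm.comp ((contMDiff_inv 𝓘(ℝ, EG) ∞).prodMk contMDiff_const))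
    have h1 := hasDer_of_contMDiffAt (hs.contMDiffAt (x := 1))
    have h := h1.comp (hasDer_of_contMDiffAt (hi.contMDiffAt (x := 1))) (map_one i)
    have e2 : ((fun g : G => (Q.coeff m b).1 (g⁻¹ • x)) ∘ i) = fun _ => (Q.coeff m b).1 x :=
      funext fun g => by
        rw [Function.comp_apply, ← T.act_apply, hb]
    rw [e2] at h
    exact congrArg (fun L : EH →L[ℝ] 𝕜 => L α)
      (h.unique (hasDer_const ((Q.coeff m b).1 x) (1 : H)))
  rw [hc0, smul_zero] at e
  exact sub_eq_zero.1 e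

variable [FiniteDimensional ℝ EG]

/-- The functional `ξ ↦ Φ(ξ)_m(x)` on the Lie algebra given by evaluating the coefficient of `ħ ^ m`
of the quantum comoment map at a point. -/
noncomputable def comomentAt (m : ℕ) (x : M) : EG →L[ℝ] 𝕜 :=
  LinearMap.toContinuousLinearMap
    { toFun := fun ξ => (Q.coeff m (T.comoment ξ)).1 x
      map_add' := fun ξ ζ =>
        congrArg (fun b => (Q.coeff m b).1 x) (T.map_add ξ ζ)
      map_smul' := fun c ξ => by
        have h : Q.coeff m ((c : 𝕜) • T.comoment ξ) = (c : 𝕜) • Q.coeff m (T.comoment ξ) :=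
          PowerSeries.coeff_smul m _ _
        refine (congrArg (fun b => (Q.coeff m b).1 x) (T.map_smul c ξ)).trans ?_
        rw [h, RingHom.id_apply, RCLike.real_smul_eq_coe_mul]
        rfl }

/-- The values of the quantum comoment map are closed under `ħ⁻¹ [·, ·]`. The element `θ` is the
Lie bracket of `ξ` and `ζ`, that is, the derivative at the identity of `g ↦ Ad_g ζ` along `ξ`;
therefore an invariant functional vanishes on it, and it lies in the ideal `𝔥` if `ξ` does. -/
lemma exists_comoment_bracket
    (hS : IsLieSemidirect (EG := EG) (EH := EH) (EK := EK) iH iK)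
    {γ : GroupLieAlgebra 𝓘(ℝ, EG) G →ₗ[ℝ] 𝕜⟦X⟧} (hγ : ∀ g ξ, γ (adjoint g ξ) = γ ξ)
    (ξ ζ : GroupLieAlgebra 𝓘(ℝ, EG) G) : ∃ θ : GroupLieAlgebra 𝓘(ℝ, EG) G,
      T.comoment ξ * T.comoment ζ - T.comoment ζ * T.comoment ξ
        = (PowerSeries.X : 𝕜⟦X⟧) • T.comoment θ ∧ γ θ = 0 ∧
      (ξ ∈ lieRange (EG := EG) (EH := EH) iH → θ ∈ lieRange (EG := EG) (EH := EH) iH) := by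
  obtain ⟨L, hL⟩ := exists_hasDer_Ad (EG := EG) (G := G) ζ
  refine ⟨(L ξ : EG), ?_, ?_, ?_⟩
  -- by equivariance, the infinitesimal action of `ξ` on `Φ(ζ)` is the derivative of `Φ(Ad_g ζ)`
  · obtain ⟨c, hc, e⟩ := T.comoment_comm ξ (T.comoment ζ)
    rw [e]
    congr 1
    refine DefQuant.alg_ext fun m => Subtype.ext (funext fun x => ?_)
    rw [hc]
    have e2 : (fun g : G => (Q.coeff m (T.comoment ζ)).1 (g⁻¹ • x))
        = fun g => comomentAt T m x (Ad g ζ) := by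
      funext g
      rw [← T.act_apply, ← T.equivariant]
      rfl
    rw [e2]
    exact (hasDer_clm_Ad hL (comomentAt T m x)).mfderiv_apply ξ
  · refine PowerSeries.ext fun m => ?_
    let ℓ : EG →L[ℝ] 𝕜 := LinearMap.toContinuousLinearMap
      (((PowerSeries.coeff (R := 𝕜) m).restrictScalars ℝ).comp γ)
    have e2 : (fun g : G => ℓ (Ad g ζ)) = fun _ => ℓ ζ := by
      funext g
      exact congrArg (PowerSeries.coeff (R := 𝕜) m) (hγ g ζ)
    have h := hasDer_clm_Ad hL ℓ
    rw [e2] at h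
    exact congrArg (fun L : EG →L[ℝ] 𝕜 => L ξ) (h.unique (hasDer_const (ℓ ζ) (1 : G)))
  · rintro ⟨α, rfl⟩
    obtain ⟨D, hD, hDA, -⟩ := hS.exists_projection
    refine (hD _).1 ?_
    have h := (hasDer_clm_Ad hL D).comp (hasDer_of_contMDiffAt hS.smooth_H.contMDiffAt) (map_one iH)
    have e2 : ((fun g : G => D (Ad g ζ)) ∘ iH) = fun _ => D ζ := funext fun g => hDA g ζ
    rw [e2] at h
    exact congrArg (fun L : EH →L[ℝ] EK => L α) (h.unique (hasDer_const (D ζ) (1 : H)))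

end Comoment

end LieFacts

/-! ### Regular systems of constraints -/

section Constraints

open Subquot

variable {𝕜 : Type*} [RCLike 𝕜]
  {E : Type*} [NormedAddCommGroup E] [NormedSpace ℝ E]
  {M : Type*} [TopologicalSpace M] [ChartedSpace E M]
  {P : PoissonBracket 𝕜 (smoothFunctions 𝕜 E M)} {Q : DefQuant P}

/-- The common zeros of the constant terms of a set of series. -/
def zeroSet (J : Set Q.Alg) : Set M := {x | ∀ j ∈ J, (Q.coeff 0 j).1 x = 0}

/-- The left ideal generated by a set `J`. -/
def leftIdeal {S R : Type*} [CommRing S] [Ring R] [Algebra S R] (J : Set R) : Submodule S R :=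
  (whole S R).momentIdeal J

/-- A set of constraints spanned by finitely many of its members, whose constant terms are real
functions with independent differentials at their common zeros. -/
def IsRegularSystem (J : Set Q.Alg) : Prop :=
  ∃ (d : ℕ) (j : Fin d → Q.Alg) (f : Fin d → M → ℝ), (∀ i, j i ∈ J) ∧
    J ⊆ Submodule.span 𝕜⟦X⟧ (Set.range j) ∧ (∀ i, ContMDiff 𝓘(ℝ, E) 𝓘(ℝ, ℝ) ∞ (f i)) ∧
    (∀ i x, (Q.coeff 0 (j i)).1 x = (f i x : 𝕜)) ∧ ∀ z, (∀ i, f i z = 0) → IndepAt E f z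

lemma mul_mem_leftIdeal {S R : Type*} [CommRing S] [Ring R] [Algebra S R] {J : Set R} (b : R)
    {l : R} (hl : l ∈ leftIdeal (S := S) J) : b * l ∈ leftIdeal (S := S) J :=
  (whole S R).momentIdeal_left J (b := b) Algebra.mem_top hl

lemma subset_leftIdeal {S R : Type*} [CommRing S] [Ring R] [Algebra S R] {J : Set R} {j : R}
    (hj : j ∈ J) : j ∈ leftIdeal (S := S) J :=
  (whole S R).mem_momentIdeal_of_mem hj

lemma leftIdeal_le {S R : Type*} [CommRing S] [Ring R] [Algebra S R] {J : Set R}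
    {N : Submodule S R} (hJ : ∀ b : R, ∀ j ∈ J, b * j ∈ N) : leftIdeal (S := S) J ≤ N :=
  (whole S R).momentIdeal_le
    (by intro x hx; rw [(Submodule.mem_bot S).1 hx]; exact zero_mem _) fun b _ => hJ b

lemma coeff_zero_smul (c : 𝕜⟦X⟧) (a : Q.Alg) :
    Q.coeff 0 (c • a) = PowerSeries.coeff 0 c • Q.coeff 0 a := by
  change PowerSeries.coeff 0 (PowerSeries.map (algebraMap 𝕜 (smoothFunctions 𝕜 E M)) c
    * (show (smoothFunctions 𝕜 E M)⟦X⟧ from a)) = _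
  rw [PowerSeries.coeff_mul, Finset.Nat.antidiagonal_zero, Finset.sum_singleton,
    PowerSeries.coeff_map, Algebra.smul_def]
  rfl

lemma coeff_sum {ι : Type*} (s : Finset ι) (m : ℕ) (a : ι → Q.Alg) :
    Q.coeff m (∑ i ∈ s, a i) = ∑ i ∈ s, Q.coeff m (a i) :=
  map_sum (PowerSeries.coeff (R := smoothFunctions 𝕜 E M) m) a s

/-- The series whose constant term vanishes on a set. -/
def vanishingOn (Z : Set M) : Submodule 𝕜⟦X⟧ Q.Alg where
  carrier := {a | ∀ x ∈ Z, (Q.coeff 0 a).1 x = 0}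
  add_mem' := fun {a b} ha hb x hx => by
    rw [Q.coeff_add]
    exact (congrArg₂ (· + ·) (ha x hx) (hb x hx)).trans (add_zero 0)
  zero_mem' := fun x _ => by rw [Q.coeff_zero']; rfl
  smul_mem' := fun c a ha x hx => by
    rw [coeff_zero_smul]
    exact (congrArg (PowerSeries.coeff 0 c * ·) (ha x hx)).trans (mul_zero _)

lemma leftIdeal_le_vanishingOn (J : Set Q.Alg) : leftIdeal J ≤ vanishingOn (zeroSet J) := by
  refine leftIdeal_le fun b j hj x hx => ?_
  rw [Q.coeff_zero_mul]
  exact (congrArg ((Q.coeff 0 b).1 x * ·) (hx j hj)).trans (mul_zero _)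

lemma vanish_of_mem_leftIdeal_image {J : Set Q.Alg} {a : smoothFunctions 𝕜 E M}
    (ha : a ∈ leftIdeal (S := 𝕜) (Q.coeff 0 '' J)) {x : M} (hx : x ∈ zeroSet J) : a.1 x = 0 := by
  let ev : smoothFunctions 𝕜 E M →ₗ[𝕜] 𝕜 :=
    (LinearMap.proj x).comp (smoothFunctions 𝕜 E M).val.toLinearMap
  have : leftIdeal (S := 𝕜) (Q.coeff 0 '' J) ≤ LinearMap.ker ev := by
    refine leftIdeal_le ?_
    rintro b _ ⟨j, hj, rfl⟩
    exact (congrArg (b.1 x * ·) (hx j hj)).trans (mul_zero _)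
  exact this ha

namespace IsRegularSystem

variable {J : Set Q.Alg}

lemma finSpanned (hJ : IsRegularSystem J) : FinSpanned J :=
  let ⟨d, j, _, h1, h2, _⟩ := hJ
  ⟨d, j, h1, h2⟩

variable [FiniteDimensional ℝ E] [IsManifold 𝓘(ℝ, E) ∞ M] [T2Space M] [SigmaCompactSpace M]

/-- A function vanishing on the common zeros of the constraints is a combination of their constant
terms. -/
lemma exists_eq_sum (hJ : IsRegularSystem J) {a : smoothFunctions 𝕜 E M}
    (ha : ∀ x ∈ zeroSet J, a.1 x = 0) :
    ∃ (d : ℕ) (c : Fin d → smoothFunctions 𝕜 E M) (j : Fin d → Q.Alg), (∀ i, j i ∈ J) ∧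
      a = ∑ i, c i * Q.coeff 0 (j i) := by
  obtain ⟨d, j, f, h1, h2, hf, hjf, hreg⟩ := hJ
  have h0 : ∀ x, (∀ i, f i x = 0) → a.1 x = 0 := fun x hx => by
    refine ha x fun r hr => ?_
    have : Submodule.span 𝕜⟦X⟧ (Set.range j) ≤ vanishingOn {x} := by
      rw [Submodule.span_le]
      rintro _ ⟨i, rfl⟩ y hy
      rw [Set.mem_singleton_iff.1 hy, hjf, hx, RCLike.ofReal_zero]
    exact this (h2 hr) x rfl
  obtain ⟨c, hc, e⟩ := exists_eq_sum_of_vanish hf hreg a.2 h0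
  refine ⟨d, fun i => ⟨c i, hc i⟩, j, h1, Subtype.ext (funext fun x => ?_)⟩
  have e2 : (∑ i, (⟨c i, hc i⟩ : smoothFunctions 𝕜 E M) * Q.coeff 0 (j i)).1 x
      = ∑ i, c i x * (Q.coeff 0 (j i)).1 x := by
    rw [AddSubmonoidClass.coe_finsetSum, Finset.sum_apply]
    rfl
  rw [e, e2]
  exact Finset.sum_congr rfl fun i _ => by rw [hjf, RCLike.real_smul_eq_coe_mul, mul_comm]

lemma mem_leftIdeal_image (hJ : IsRegularSystem J) {a : smoothFunctions 𝕜 E M} :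
    a ∈ leftIdeal (S := 𝕜) (Q.coeff 0 '' J) ↔ ∀ x ∈ zeroSet J, a.1 x = 0 := by
  refine ⟨fun h x hx => vanish_of_mem_leftIdeal_image h hx, fun h => ?_⟩
  obtain ⟨d, c, j, hj, rfl⟩ := hJ.exists_eq_sum h
  exact sum_mem fun i _ => mul_mem_leftIdeal _ (subset_leftIdeal ⟨j i, hj i, rfl⟩)

/-- The quotient by the left ideal of a regular system of constraints, closed under `ħ⁻¹ [·, ·]`,
has no `ħ`-torsion. If `∑ rᵢ ⋆ jᵢ` is a multiple of `ħ`, then exactness of the Koszul complex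
gives `rᵢ = ∑ₗ (tᵢₗ - tₗᵢ) ⋆ jₗ` modulo `ħ`, so that `∑ rᵢ ⋆ jᵢ` is `∑ tᵢₗ ⋆ [jₗ, jᵢ]` up to an
element of `ħ` times the ideal. -/
lemma mem_of_X_smul_mem (hJ : IsRegularSystem J)
    (hbr : ∀ x ∈ J, ∀ y ∈ J, ∃ w ∈ J, x * y - y * x = (PowerSeries.X : 𝕜⟦X⟧) • w) {w : Q.Alg}
    (hw : (PowerSeries.X : 𝕜⟦X⟧) • w ∈ leftIdeal (S := 𝕜⟦X⟧) J) :
    w ∈ leftIdeal (S := 𝕜⟦X⟧) J := by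
  obtain ⟨d, j, f, h1, h2, hf, hjf, hreg⟩ := hJ
  obtain ⟨r, hr⟩ : ∃ r : Fin d → Q.Alg, (PowerSeries.X : 𝕜⟦X⟧) • w = ∑ i, r i * j i := by
    let φ : (Fin d → Q.Alg) →ₗ[𝕜⟦X⟧] Q.Alg :=
      ∑ i, (LinearMap.mulRight 𝕜⟦X⟧ (j i)).comp (LinearMap.proj i)
    have hφ : ∀ r, φ r = ∑ i, r i * j i := fun r => by simp [φ]
    have : leftIdeal (S := 𝕜⟦X⟧) J ≤ LinearMap.range φ := by
      refine leftIdeal_le fun b x hx => ?_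
      have : Submodule.span 𝕜⟦X⟧ (Set.range j)
          ≤ (LinearMap.range φ).comap (LinearMap.mulLeft 𝕜⟦X⟧ b) := by
        rw [Submodule.span_le]
        rintro _ ⟨i, rfl⟩
        refine ⟨Pi.single i b, ?_⟩
        rw [hφ, Finset.sum_eq_single i (fun l _ hl => by rw [Pi.single_eq_of_ne hl, zero_mul])
          (by simp), Pi.single_eq_same]
        rfl
      exact this (h2 hx)
    obtain ⟨r, hr⟩ := this hw
    exact ⟨r, by rw [← hr, hφ]⟩
  have h0 : ∀ x, ∑ i, f i x • (Q.coeff 0 (r i)).1 x = 0 := fun x => by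
    have e : (Q.coeff 0 (∑ i, r i * j i)).1 x = ∑ i, (Q.coeff 0 (r i)).1 x * (f i x : 𝕜) := by
      rw [coeff_sum, AddSubmonoidClass.coe_finsetSum, Finset.sum_apply]
      refine Finset.sum_congr rfl fun i _ => ?_
      rw [Q.coeff_zero_mul, ← hjf]
      rfl
    rw [← hr, Q.coeff_zero_X_smul] at e
    refine Eq.trans (Finset.sum_congr rfl fun i _ => ?_) e.symm
    rw [RCLike.real_smul_eq_coe_mul, mul_comm]
  obtain ⟨t, ht, hrt⟩ := exists_antisymm_of_relation hf hreg (fun i => (Q.coeff 0 (r i)).2) h0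
  let τ : Fin d → Fin d → Q.Alg := fun i l => Q.const ⟨t i l, ht i l⟩
  have hs : ∀ i, ∃ s : Q.Alg,
      r i = ∑ l, (τ i l - τ l i) * j l + (PowerSeries.X : 𝕜⟦X⟧) • s := fun i => by
    have h3 : Q.coeff 0 (r i - ∑ l, (τ i l - τ l i) * j l) = 0 := by
      refine Subtype.ext (funext fun x => ?_)
      have e : (Q.coeff 0 (∑ l, (τ i l - τ l i) * j l)).1 x
          = ∑ l, (t i l x - t l i x) * (f l x : 𝕜) := by
        rw [coeff_sum, AddSubmonoidClass.coe_finsetSum, Finset.sum_apply]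
        refine Finset.sum_congr rfl fun l _ => ?_
        rw [Q.coeff_zero_mul, Q.coeff_sub, Q.coeff_zero_const, Q.coeff_zero_const, ← hjf]
        rfl
      rw [Q.coeff_sub]
      refine sub_eq_zero.2 ?_
      rw [e, hrt]
      exact Finset.sum_congr rfl fun l _ => by rw [RCLike.real_smul_eq_coe_mul, mul_comm]
    obtain ⟨s, hs⟩ := Q.exists_X_smul_of_coeff_zero h3
    exact ⟨s, by rw [← hs, add_sub_cancel]⟩
  choose s hs using hs
  choose u hu hbr using fun i l => hbr (j l) (h1 l) (j i) (h1 i)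
  have key : (PowerSeries.X : 𝕜⟦X⟧) • w
      = (PowerSeries.X : 𝕜⟦X⟧) • (∑ i, ∑ l, τ i l * u i l + ∑ i, s i * j i) := by
    have e1 : ∀ i, r i * j i = ∑ l, τ i l * (j l * j i) - ∑ l, τ l i * (j l * j i)
        + (PowerSeries.X : 𝕜⟦X⟧) • (s i * j i) := fun i => by
      rw [hs i, add_mul, smul_mul_assoc, Finset.sum_mul, ← Finset.sum_sub_distrib]
      simp only [sub_mul, mul_assoc]
    rw [hr, Finset.sum_congr rfl fun i _ => e1 i, Finset.sum_add_distrib, smul_add,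
      Finset.smul_sum, Finset.smul_sum, Finset.sum_sub_distrib,
      Finset.sum_comm (f := fun i l => τ l i * (j l * j i)), ← Finset.sum_sub_distrib]
    congr 1
    refine Finset.sum_congr rfl fun i _ => ?_
    rw [← Finset.sum_sub_distrib, Finset.smul_sum]
    refine Finset.sum_congr rfl fun l _ => ?_
    rw [← mul_sub, hbr, mul_smul_comm]
  rw [Q.X_smul_injective key]
  exact add_mem (sum_mem fun i _ => sum_mem fun l _ => mul_mem_leftIdeal _
    (subset_leftIdeal (hu i l))) (sum_mem fun i _ => mul_mem_leftIdeal _ (subset_leftIdeal (h1 i)))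

end IsRegularSystem

end Constraints

/-! ### Reduction in stages for regular constraints and averaging operators -/

section SmoothStages

open Subquot

variable {𝕜 : Type*} [RCLike 𝕜]
  {E : Type*} [NormedAddCommGroup E] [NormedSpace ℝ E]
  {M : Type*} [TopologicalSpace M] [ChartedSpace E M]
  {P : PoissonBracket 𝕜 (smoothFunctions 𝕜 E M)} {Q : DefQuant P}
  {G : Type*} [Group G] {act : G →* (Q.Alg ≃ₐ[𝕜⟦X⟧] Q.Alg)}

/-- Membership in the numerator of the reduction by `Γ`. -/
def InStage (act : G →* (Q.Alg ≃ₐ[𝕜⟦X⟧] Q.Alg)) (Γ : Subgroup G) (J : Set Q.Alg)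
    (a : Q.Alg) : Prop :=
  (∀ g ∈ Γ, act g a - a ∈ leftIdeal (S := 𝕜⟦X⟧) J) ∧ ∀ j ∈ J, j * a ∈ leftIdeal (S := 𝕜⟦X⟧) J

lemma inStage_iff {Γ : Subgroup G} {J : Set Q.Alg} {a : Q.Alg} :
    a ∈ (oneStage (fun g : Γ => (act g : Q.Alg →ₐ[𝕜⟦X⟧] Q.Alg)) J).B ↔ InStage act Γ J a :=
  mem_oneStage_B.trans
    ⟨fun h => ⟨fun g hg => h.1 ⟨g, hg⟩, h.2⟩, fun h => ⟨fun g => h.1 g g.2, h.2⟩⟩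

lemma inStage_top_iff {J : Set Q.Alg} {a : Q.Alg} :
    a ∈ (oneStage (fun g : G => (act g : Q.Alg →ₐ[𝕜⟦X⟧] Q.Alg)) J).B ↔ InStage act ⊤ J a :=
  mem_oneStage_B.trans
    ⟨fun h => ⟨fun g _ => h.1 g, h.2⟩, fun h => ⟨fun g => h.1 g trivial, h.2⟩⟩

variable [MulAction G M]

/-- The function `a` is invariant under the set `Γ` of group elements. -/
def InvariantOn (Γ : Set G) (a : smoothFunctions 𝕜 E M) : Prop := ∀ g ∈ Γ, ∀ x, a.1 (g • x) = a.1 x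

/-- An averaging operator for the action of a group `Γ` of transformations: an additive projection
of functions to invariant functions that is linear over functions constant on orbits, orbit by
orbit. -/
structure IsAveraging (Γ : Set G) (T : smoothFunctions 𝕜 E M → smoothFunctions 𝕜 E M) : Prop where
  map_add : ∀ a b, T (a + b) = T a + T b
  map_one : T 1 = 1
  invariant : ∀ a, InvariantOn Γ (T a)
  map_mul : ∀ (a f : smoothFunctions 𝕜 E M) (x : M), (∀ g ∈ Γ, f.1 (g • x) = f.1 x) →
    (T (a * f)).1 x = (T a).1 x * f.1 x

lemma IsAveraging.map_sum {Γ : Set G} {T : smoothFunctions 𝕜 E M → smoothFunctions 𝕜 E M}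
    (hT : IsAveraging Γ T) {ι : Type*} (s : Finset ι) (a : ι → smoothFunctions 𝕜 E M) :
    T (∑ i ∈ s, a i) = ∑ i ∈ s, T (a i) :=
  _root_.map_sum (AddMonoidHom.mk' T hT.map_add) a s

/-- An averaging operator does not change a function at points on whose orbit it is constant. -/
lemma IsAveraging.apply_eq {Γ : Set G} {T : smoothFunctions 𝕜 E M → smoothFunctions 𝕜 E M}
    (hT : IsAveraging Γ T) {a : smoothFunctions 𝕜 E M} {x : M}
    (h : ∀ g ∈ Γ, a.1 (g • x) = a.1 x) : (T a).1 x = a.1 x := by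
  have := hT.map_mul 1 a x h
  rw [one_mul, hT.map_one] at this
  exact this.trans (one_mul _)

/-- The coefficients of series are transformed as functions on `M`. -/
def ActsByTranslation (act : G →* (Q.Alg ≃ₐ[𝕜⟦X⟧] Q.Alg)) : Prop :=
  ∀ (g : G) (b : Q.Alg) (m : ℕ) (x : M), (Q.coeff m (act g b)).1 x = (Q.coeff m b).1 (g⁻¹ • x)

lemma modHbar_apply (hact : ActsByTranslation act) (g : G) (a : smoothFunctions 𝕜 E M) (x : M) :
    (Q.modHbar (act g : Q.Alg →ₐ[𝕜⟦X⟧] Q.Alg) a).1 x = a.1 (g⁻¹ • x) := by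
  change (Q.coeff 0 (act g (Q.const a))).1 x = _
  rw [hact, Q.coeff_zero_const]

lemma act_const (hact : ActsByTranslation act) {Γ : Subgroup G} {a : smoothFunctions 𝕜 E M}
    (ha : InvariantOn (Γ : Set G) a) {g : G} (hg : g ∈ Γ) : act g (Q.const a) = Q.const a := by
  refine DefQuant.alg_ext fun m => Subtype.ext (funext fun x => ?_)
  rw [hact]
  have e : Q.coeff m (Q.const a) = if m = 0 then a else 0 := PowerSeries.coeff_C m a
  rw [e]
  split_ifs
  · exact ha _ (inv_mem hg) x
  · rfl

/-- The compatibility of a group of transformations `Γ` with a set `J` of constraints: the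
constraints are regular, permuted by `Γ`, closed under `ħ⁻¹ [·, ·]` and commute with invariants of
`Γ`, and there is an averaging operator. -/
structure IsMomentSystem (act : G →* (Q.Alg ≃ₐ[𝕜⟦X⟧] Q.Alg)) (Γ : Subgroup G) (J : Set Q.Alg) :
    Prop where
  regular : IsRegularSystem J
  stable : ∀ g ∈ Γ, ∀ j ∈ J, act g j ∈ J
  bracket : ∀ x ∈ J, ∀ y ∈ J, ∃ w ∈ J, x * y - y * x = (PowerSeries.X : 𝕜⟦X⟧) • w
  commute : ∀ b, (∀ g ∈ Γ, act g b = b) → ∀ j ∈ J, j * b = b * j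
  averaging : ∃ T : smoothFunctions 𝕜 E M → smoothFunctions 𝕜 E M, IsAveraging (Γ : Set G) T

/-- On the common zeros of the constraints, the constant term of an element of the numerator is
constant along orbits. -/
lemma coeff_zero_smul_eq {Γ : Subgroup G} {J : Set Q.Alg} (hact : ActsByTranslation act)
    {a : Q.Alg}
    (ha : ∀ g ∈ Γ, act g a - a ∈ leftIdeal (S := 𝕜⟦X⟧) J) {g : G} (hg : g ∈ Γ) {x : M}
    (hx : x ∈ zeroSet J) : (Q.coeff 0 a).1 (g • x) = (Q.coeff 0 a).1 x := by
  have h := leftIdeal_le_vanishingOn J (ha g⁻¹ (inv_mem hg)) x hx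
  rw [Q.coeff_sub] at h
  have h2 := sub_eq_zero.1 h
  rwa [hact, inv_inv] at h2

namespace IsMomentSystem

variable {Γ : Subgroup G} {J : Set Q.Alg}

lemma act_leftIdeal (hJ : IsMomentSystem act Γ J) {g : G} (hg : g ∈ Γ) {l : Q.Alg}
    (hl : l ∈ leftIdeal (S := 𝕜⟦X⟧) J) : act g l ∈ leftIdeal (S := 𝕜⟦X⟧) J := by
  have : leftIdeal (S := 𝕜⟦X⟧) J ≤ (leftIdeal (S := 𝕜⟦X⟧) J).comap (act g).toLinearMap := by
    refine leftIdeal_le fun b j hj => ?_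
    change act g (b * j) ∈ leftIdeal (S := 𝕜⟦X⟧) J
    rw [map_mul]
    exact mul_mem_leftIdeal _ (subset_leftIdeal (hJ.stable g hg j hj))
  exact this hl

lemma inStage_of_mem_leftIdeal (hJ : IsMomentSystem act Γ J) {l : Q.Alg}
    (hl : l ∈ leftIdeal (S := 𝕜⟦X⟧) J) : InStage act Γ J l :=
  ⟨fun _ hg => sub_mem (hJ.act_leftIdeal hg hl) hl, fun j _ => mul_mem_leftIdeal j hl⟩

lemma inStage_of_fixed (hJ : IsMomentSystem act Γ J) {b : Q.Alg} (hb : ∀ g ∈ Γ, act g b = b) :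
    InStage act Γ J b := by
  refine ⟨fun g hg => ?_, fun j hj => ?_⟩
  · rw [hb g hg, sub_self]; exact zero_mem _
  · rw [hJ.commute b hb j hj]; exact mul_mem_leftIdeal _ (subset_leftIdeal hj)

lemma stable_zeroSet (hJ : IsMomentSystem act Γ J) (hact : ActsByTranslation act) {g : G}
    (hg : g ∈ Γ) {x : M} (hx : x ∈ zeroSet J) : g • x ∈ zeroSet J := fun j hj => by
  have := hx _ (hJ.stable g⁻¹ (inv_mem hg) j hj)
  rwa [hact, inv_inv] at this

variable [FiniteDimensional ℝ E] [IsManifold 𝓘(ℝ, E) ∞ M] [T2Space M] [SigmaCompactSpace M]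

lemma mem_of_X_smul_mem (hJ : IsMomentSystem act Γ J) {w : Q.Alg}
    (hw : (PowerSeries.X : 𝕜⟦X⟧) • w ∈ leftIdeal (S := 𝕜⟦X⟧) J) :
    w ∈ leftIdeal (S := 𝕜⟦X⟧) J :=
  hJ.regular.mem_of_X_smul_mem hJ.bracket hw

lemma inStage_of_X_smul (hJ : IsMomentSystem act Γ J) {w : Q.Alg}
    (hw : InStage act Γ J ((PowerSeries.X : 𝕜⟦X⟧) • w)) : InStage act Γ J w := by
  refine ⟨fun g hg => hJ.mem_of_X_smul_mem ?_, fun j hj => hJ.mem_of_X_smul_mem ?_⟩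
  · rw [smul_sub, ← map_smul]; exact hw.1 g hg
  · rw [← mul_smul_comm]; exact hw.2 j hj

end IsMomentSystem

/-- The relation between the constraints `JH`, `JK` and `J` of a semidirect product `H ⋊ K` and its
factors. -/
structure IsStagedSystem (act : G →* (Q.Alg ≃ₐ[𝕜⟦X⟧] Q.Alg)) (H K : Subgroup G)
    (JH JK J : Set Q.Alg) : Prop where
  translation : ActsByTranslation act
  system_H : IsMomentSystem act H JH
  system_G : IsMomentSystem act ⊤ J
  finSpanned_K : FinSpanned JK
  exists_mul : ∀ g : G, ∃ (h : H) (l : K), g = h * l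
  subset_H : JH ⊆ J
  subset_K : JK ⊆ J
  exists_add : ∀ j ∈ J, ∃ x ∈ JH, ∃ y ∈ JK, j = x + y
  act_sub : ∀ h ∈ H, ∀ j ∈ JK, act h j - j ∈ JH
  bracket : ∀ x ∈ JH, ∀ y ∈ JK, ∃ w ∈ JH, x * y - y * x = (PowerSeries.X : 𝕜⟦X⟧) • w

namespace IsStagedSystem

variable {H K : Subgroup G} {JH JK J : Set Q.Alg}

lemma inStage_of_mem_K (hS : IsStagedSystem act H K JH JK J) {j : Q.Alg} (hj : j ∈ JK) :
    InStage act H JH j := by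
  refine ⟨fun h hh => subset_leftIdeal (hS.act_sub h hh j hj), fun x hx => ?_⟩
  obtain ⟨w, hw, e⟩ := hS.bracket x hx j hj
  rw [sub_eq_iff_eq_add.1 e]
  exact add_mem (Submodule.smul_mem _ _ (subset_leftIdeal hw))
    (mul_mem_leftIdeal _ (subset_leftIdeal hx))

variable [FiniteDimensional ℝ E] [IsManifold 𝓘(ℝ, E) ∞ M] [T2Space M] [SigmaCompactSpace M]

/-- The analytic core of reduction in stages: a function whose restriction to the zero set for `H`
is `H`-invariant and which vanishes on the zero set for `G` is a combination of the moments of `H`,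
and of the moments of `K` with `H`-invariant coefficients. The coefficients of any expression by the
moments of `G` may be averaged over `H`, because the moments of `K` are `H`-invariant where those of
`H` vanish. -/
lemma exists_eq_sum_add_sum (hS : IsStagedSystem act H K JH JK J) {a : smoothFunctions 𝕜 E M}
    (hinv : ∀ h ∈ H, ∀ x ∈ zeroSet JH, a.1 (h • x) = a.1 x) (ha : ∀ x ∈ zeroSet J, a.1 x = 0) :
    ∃ (d d' : ℕ) (e : Fin d → smoothFunctions 𝕜 E M) (x : Fin d → Q.Alg)
      (c : Fin d' → smoothFunctions 𝕜 E M) (y : Fin d' → Q.Alg), (∀ i, x i ∈ JH) ∧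
      (∀ i, y i ∈ JK) ∧ (∀ i, InvariantOn (H : Set G) (c i)) ∧
      a = ∑ i, e i * Q.coeff 0 (x i) + ∑ i, c i * Q.coeff 0 (y i) := by
  obtain ⟨T, hT⟩ := hS.system_H.averaging
  obtain ⟨d', c, j, hj, rfl⟩ := hS.system_G.regular.exists_eq_sum ha
  choose x hx y hy hxy using fun i => hS.exists_add (j i) (hj i)
  set a := ∑ i, c i * Q.coeff 0 (j i) with hadef
  have hrest : ∀ z ∈ zeroSet JH, (a - ∑ i, T (c i) * Q.coeff 0 (y i)).1 z = 0 := fun z hz => by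
    refine sub_eq_zero.2 ((hT.apply_eq fun h hh => hinv h hh z hz).symm.trans ?_)
    rw [hadef, hT.map_sum, AddSubmonoidClass.coe_finsetSum, AddSubmonoidClass.coe_finsetSum,
      Finset.sum_apply, Finset.sum_apply]
    refine Finset.sum_congr rfl fun i _ => ?_
    have hjy : ∀ z ∈ zeroSet JH, (Q.coeff 0 (j i)).1 z = (Q.coeff 0 (y i)).1 z := fun z hz => by
      rw [hxy, Q.coeff_add]
      exact (congrArg (· + (Q.coeff 0 (y i)).1 z) (hz _ (hx i))).trans (zero_add _)
    rw [hT.map_mul, hjy z hz]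
    · rfl
    · intro h hh
      rw [hjy z hz, hjy _ (hS.system_H.stable_zeroSet hS.translation hh hz)]
      exact coeff_zero_smul_eq hS.translation (hS.inStage_of_mem_K (hy i)).1 hh hz
  obtain ⟨d, e, x', hx', h⟩ := hS.system_H.regular.exists_eq_sum hrest
  exact ⟨d, d', e, x', fun i => T (c i), y, hx', hy, fun i => hT.invariant _,
    (sub_eq_iff_eq_add.1 h)⟩

/-- Classical reduction in stages. -/
theorem classical (hS : IsStagedSystem act H K JH JK J) :
    (classicalTwoStage Q act H K JH JK).IsNaturalIso (classicalOneStage Q act J) := by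
  set ρ : G → smoothFunctions 𝕜 E M →ₐ[𝕜] smoothFunctions 𝕜 E M :=
    fun g => Q.modHbar (act g : Q.Alg →ₐ[𝕜⟦X⟧] Q.Alg) with hρ
  have hρa : ∀ g a x, (ρ g a).1 x = a.1 (g⁻¹ • x) := modHbar_apply hS.translation
  have hmH : ∀ {a}, a ∈ (oneStage (fun h : H => ρ h) (Q.coeff 0 '' JH)).L ↔
      ∀ x ∈ zeroSet JH, a.1 x = 0 := hS.system_H.regular.mem_leftIdeal_image
  have hmG : ∀ {a}, a ∈ (oneStage ρ (Q.coeff 0 '' J)).L ↔ ∀ x ∈ zeroSet J, a.1 x = 0 :=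
    hS.system_G.regular.mem_leftIdeal_image
  have hBH : ∀ {a}, InvariantOn (H : Set G) a →
      a ∈ (oneStage (fun h : H => ρ h) (Q.coeff 0 '' JH)).B := fun {a} ha => by
    refine mem_oneStage_B.2 ⟨fun h => hmH.2 fun x _ => ?_, fun j hj => ?_⟩
    · refine sub_eq_zero.2 ?_
      rw [hρa]
      exact ha _ (inv_mem h.2) x
    · rw [mul_comm]
      exact mul_mem_oneStage_L _ _ (mem_oneStage_L_of_mem _ hj)
  have hHG : Q.coeff 0 '' JH ⊆ Q.coeff 0 '' J := Set.image_mono hS.subset_H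
  have hKG : Q.coeff 0 '' JK ⊆ Q.coeff 0 '' J := Set.image_mono hS.subset_K
  refine isNaturalIso_of (twoStage_B_le (fun g g' a => ?_) hS.exists_mul hHG hKG ?_)
    (twoStage_L_le hHG hKG) (fun a ha haL => ?_) (fun a ha => ?_)
  · refine Subtype.ext (funext fun x => ?_)
    rw [hρa, hρa, hρa, mul_inv_rev, mul_smul]
  · rintro _ ⟨j, hj, rfl⟩
    obtain ⟨x, hx, y, hy, rfl⟩ := hS.exists_add j hj
    exact ⟨_, ⟨x, hx, rfl⟩, _, ⟨y, hy, rfl⟩, Q.coeff_add _ _ _⟩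
  · have haH := (mem_oneStage_B.1 (mem_twoStage_B.1 ha).1).1
    have hinv : ∀ h ∈ H, ∀ x ∈ zeroSet JH, a.1 (h • x) = a.1 x := fun h hh x hx => by
      have := sub_eq_zero.1 (hmH.1 (haH ⟨h⁻¹, inv_mem hh⟩) x hx)
      rwa [hρa, inv_inv] at this
    obtain ⟨d, d', e, x, c, y, hx, hy, hc, rfl⟩ := hS.exists_eq_sum_add_sum hinv (hmG.1 haL)
    refine add_mem (oneStage_L_le_twoStage_L ?_) (sum_mem fun i _ => ?_)
    · exact sum_mem fun i _ => mul_mem_oneStage_L _ _ (mem_oneStage_L_of_mem _ ⟨x i, hx i, rfl⟩)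
    · exact mul_mem_twoStage_L (hBH (hc i)) ⟨y i, hy i, rfl⟩
  · obtain ⟨T, hT⟩ := hS.system_G.averaging
    have hTa := hT.invariant a
    have hfix : ∀ g, ρ g (T a) = T a := fun g =>
      Subtype.ext (funext fun x => (hρa g _ x).trans (hTa _ trivial x))
    have hB := hBH fun h _ x => hTa h trivial x
    refine ⟨T a, mem_twoStage_B.2 ⟨hB, fun g => ?_, fun j hj => ?_⟩, hmG.2 fun x hx => ?_⟩
    · rw [hfix, sub_self]
      exact ⟨hB, zero_mem _⟩
    · rw [mul_comm]
      exact mul_mem_twoStage_L hB hj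
    · refine sub_eq_zero.2 (hT.apply_eq fun g _ => ?_).symm
      have := sub_eq_zero.1 (hmG.1 ((mem_oneStage_B.1 ha).1 g⁻¹) x hx)
      rwa [hρa, inv_inv] at this

/-- Quantum reduction in stages, from the classical case by successive approximation. -/
theorem quantum (hS : IsStagedSystem act H K JH JK J) :
    (quantumTwoStage Q act H K JH JK).IsNaturalIso (quantumOneStage Q act J) := by
  set ρ : G → Q.Alg →ₐ[𝕜⟦X⟧] Q.Alg := fun g => (act g : Q.Alg →ₐ[𝕜⟦X⟧] Q.Alg) with hρ
  have hFH := hS.system_H.regular.finSpanned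
  have hFG := hS.system_G.regular.finSpanned
  have hBle : (twoStage ρ H K JH JK).B ≤ (oneStage ρ J).B := by
    refine twoStage_B_le (fun g g' a => ?_) hS.exists_mul hS.subset_H hS.subset_K hS.exists_add
    change act (g * g') a = act g (act g' a)
    rw [map_mul]
    rfl
  have hLle : (twoStage ρ H K JH JK).L ≤ (oneStage ρ J).L :=
    twoStage_L_le hS.subset_H hS.subset_K
  refine isNaturalIso_of hBle hLle (fun a ha haL => ?_) (fun a ha => ?_)
  -- injectivity: modulo `ħ`, an element of the ideal for `G` that survives reduction by `H` is a
  -- combination of moments of `H`, and of moments of `K` with coefficients invariant under `H`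
  · have hap : {a | a ∈ (oneStage (fun h : H => ρ h) JH).B ∧ a ∈ (oneStage ρ J).L}
        ⊆ ((twoStage ρ H K JH JK).L : Set Q.Alg) := by
      refine (FinSpanned.twoStage_L hFH hS.finSpanned_K).subset_of_approx fun a ha => ?_
      obtain ⟨haH, haG⟩ := ha
      obtain ⟨d, d', e, x, c, y, hx, hy, hc, hsum⟩ := hS.exists_eq_sum_add_sum
        (fun h hh z hz => coeff_zero_smul_eq hS.translation
          (inStage_iff.1 haH).1 hh hz) (leftIdeal_le_vanishingOn J haG)
      have hcB : ∀ i, Q.const (c i) ∈ (oneStage (fun h : H => ρ h) JH).B := fun i =>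
        inStage_iff.2 (hS.system_H.inStage_of_fixed fun g hg => act_const hS.translation (hc i) hg)
      have hl₁ : ∑ i, Q.const (e i) * x i ∈ (oneStage (fun h : H => ρ h) JH).L :=
        sum_mem fun i _ => mul_mem_oneStage_L _ _ (mem_oneStage_L_of_mem _ (hx i))
      have hl₂ : ∑ i, Q.const (c i) * y i ∈ (twoStage ρ H K JH JK).L :=
        sum_mem fun i _ => mul_mem_twoStage_L (hcB i) (hy i)
      have hl : ∑ i, Q.const (e i) * x i + ∑ i, Q.const (c i) * y i
          ∈ (twoStage ρ H K JH JK).L := add_mem (oneStage_L_le_twoStage_L hl₁) hl₂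
      have hlB : ∑ i, Q.const (e i) * x i + ∑ i, Q.const (c i) * y i
          ∈ (oneStage (fun h : H => ρ h) JH).B :=
        add_mem (inStage_iff.2 (hS.system_H.inStage_of_mem_leftIdeal hl₁))
          (sum_mem fun i _ => mul_mem (hcB i) (inStage_iff.2 (hS.inStage_of_mem_K (hy i))))
      obtain ⟨w, hw⟩ := Q.exists_X_smul_of_coeff_zero (a := a - _) (by
        rw [Q.coeff_sub, Q.coeff_add, coeff_sum, coeff_sum]
        simp only [Q.coeff_zero_mul, Q.coeff_zero_const]
        rw [← hsum, sub_self] :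
        Q.coeff 0 (a - (∑ i, Q.const (e i) * x i + ∑ i, Q.const (c i) * y i)) = 0)
      refine ⟨_, hl, w, ⟨inStage_iff.2 (hS.system_H.inStage_of_X_smul ?_),
        hS.system_G.mem_of_X_smul_mem ?_⟩, by rw [← hw, add_sub_cancel]⟩
      · rw [← hw]; exact inStage_iff.1 (sub_mem haH hlB)
      · rw [← hw]; exact sub_mem haG (hLle hl)
    exact hap ⟨(mem_twoStage_B.1 ha).1, haL⟩
  -- surjectivity: modulo `ħ`, every element is congruent to its average, a constant series fixed by
  -- `G`, which therefore commutes with all moments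
  · have hap : ((oneStage ρ J).B : Set Q.Alg)
        ⊆ (Subalgebra.toSubmodule (twoStage ρ H K JH JK).B ⊔ (oneStage ρ J).L :
          Submodule 𝕜⟦X⟧ Q.Alg) := by
      have hcl : Q.HClosed (Subalgebra.toSubmodule (twoStage ρ H K JH JK).B : Set Q.Alg) :=
        FinSpanned.twoStage_B hFH hS.finSpanned_K
      refine (hcl.sup (hFG.oneStage_L ρ)).subset_of_approx fun a ha => ?_
      obtain ⟨T, hT⟩ := hS.system_G.averaging
      have ha' := inStage_top_iff.1 ha
      obtain ⟨d, c, j, hj, e⟩ := hS.system_G.regular.exists_eq_sum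
        (a := Q.coeff 0 a - T (Q.coeff 0 a)) fun x hx => sub_eq_zero.2 (hT.apply_eq fun g hg =>
          coeff_zero_smul_eq hS.translation ha'.1 hg hx).symm
      have hfix : ∀ g, act g (Q.const (T (Q.coeff 0 a))) = Q.const (T (Q.coeff 0 a)) := fun g =>
        act_const (Γ := ⊤) hS.translation (hT.invariant _) trivial
      have hbH : Q.const (T (Q.coeff 0 a)) ∈ (oneStage (fun h : H => ρ h) JH).B :=
        inStage_iff.2 (hS.system_H.inStage_of_fixed fun g _ => hfix g)
      have hb : Q.const (T (Q.coeff 0 a)) ∈ (twoStage ρ H K JH JK).B := by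
        refine mem_twoStage_B.2 ⟨hbH, fun g => ?_, fun y hy => ?_⟩
        · have hg : ρ g (Q.const (T (Q.coeff 0 a))) = _ := hfix g
          rw [hg, sub_self]
          exact ⟨hbH, zero_mem _⟩
        · rw [hS.system_G.commute _ (fun g _ => hfix g) y (hS.subset_K hy)]
          exact mul_mem_twoStage_L hbH hy
      have hl : ∑ i, Q.const (c i) * j i ∈ (oneStage ρ J).L :=
        sum_mem fun i _ => mul_mem_oneStage_L _ _ (mem_oneStage_L_of_mem _ (hj i))
      obtain ⟨w, hw⟩ := Q.exists_X_smul_of_coeff_zero (by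
        rw [Q.coeff_sub, Q.coeff_add, coeff_sum]
        simp only [Q.coeff_zero_mul, Q.coeff_zero_const]
        rw [← e]
        abel :
        Q.coeff 0 (a - (Q.const (T (Q.coeff 0 a)) + ∑ i, Q.const (c i) * j i)) = 0)
      refine ⟨_, Submodule.add_mem_sup hb hl, w, inStage_top_iff.2
        (hS.system_G.inStage_of_X_smul ?_), by rw [← hw, add_sub_cancel]⟩
      rw [← hw]
      exact inStage_top_iff.1 (sub_mem ha (add_mem (hBle hb)
        (inStage_top_iff.2 (hS.system_G.inStage_of_mem_leftIdeal hl))))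
    obtain ⟨b, hb, l, hl, e⟩ := Submodule.mem_sup.1 (hap ha)
    exact ⟨b, hb, by rw [← e, add_sub_cancel_left]; exact hl⟩

end IsStagedSystem

end SmoothStages

/-! ### Moment systems of Hamiltonian actions of Lie groups -/

section LieMoments

open Set Topology

variable {𝕜 : Type*} [RCLike 𝕜] {E : Type*} [NormedAddCommGroup E] [NormedSpace ℝ E]
  {M : Type*} [TopologicalSpace M] [ChartedSpace E M]
  {EG : Type*} [NormedAddCommGroup EG] [NormedSpace ℝ EG]
  {G : Type*} [TopologicalSpace G] [ChartedSpace EG G] [Group G]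
  {EH : Type*} [NormedAddCommGroup EH] [NormedSpace ℝ EH]
  {H : Type*} [TopologicalSpace H] [ChartedSpace EH H] [Group H]
  {EK : Type*} [NormedAddCommGroup EK] [NormedSpace ℝ EK]
  {K : Type*} [TopologicalSpace K] [ChartedSpace EK K] [Group K]
  {iH : H →* G} {iK : K →* G}
  [MulAction G M] {P : PoissonBracket 𝕜 (smoothFunctions 𝕜 E M)} {Q : DefQuant P}
  (T : LieHamiltonianAction (EG := EG) (G := G) Q) (γ : GroupLieAlgebra 𝓘(ℝ, EG) G →ₗ[ℝ] 𝕜⟦X⟧)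

/-- The Lie algebra of a Lie subgroup as a linear subspace. -/
noncomputable def lieSubspace (i : H →* G) : Submodule ℝ (GroupLieAlgebra 𝓘(ℝ, EG) G) :=
  LinearMap.range (mfderiv 𝓘(ℝ, EH) 𝓘(ℝ, EG) i 1 : EH →L[ℝ] EG).toLinearMap

lemma coe_lieSubspace (i : H →* G) :
    (lieSubspace (EG := EG) (EH := EH) i : Set (GroupLieAlgebra 𝓘(ℝ, EG) G))
      = lieRange (EG := EG) (EH := EH) i :=
  Set.ext fun _ => ⟨fun ⟨α, h⟩ => ⟨α, h.symm⟩, fun ⟨α, h⟩ => ⟨α, h.symm⟩⟩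

/-- The element `Φ(ξ) - γ(ξ)`. -/
noncomputable def constraint (ξ : GroupLieAlgebra 𝓘(ℝ, EG) G) : Q.Alg :=
  T.comoment ξ - algebraMap 𝕜⟦X⟧ Q.Alg (γ ξ)

lemma constraint_add (ξ ζ : GroupLieAlgebra 𝓘(ℝ, EG) G) :
    constraint T γ (ξ + ζ) = constraint T γ ξ + constraint T γ ζ := by
  unfold constraint
  rw [T.map_add, map_add, map_add, add_sub_add_comm]

lemma constraint_smul (c : ℝ) (ξ : GroupLieAlgebra 𝓘(ℝ, EG) G) :
    constraint T γ (c • ξ) = (PowerSeries.C (c : 𝕜) : 𝕜⟦X⟧) • constraint T γ ξ := by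
  have h : γ (c • ξ) = (c : 𝕜) • γ ξ := by
    rw [map_smul]
    refine PowerSeries.ext fun n => ?_
    have := ((PowerSeries.coeff (R := 𝕜) n).restrictScalars ℝ).map_smul c (γ ξ)
    refine this.trans ?_
    rw [PowerSeries.coeff_smul, RCLike.real_smul_eq_coe_mul]
    rfl
  unfold constraint
  rw [T.map_smul, h, algebraMap_smul_alg, C_smul_alg, smul_sub]

lemma constraint_sub (ξ ζ : GroupLieAlgebra 𝓘(ℝ, EG) G) :
    constraint T γ (ξ - ζ) = constraint T γ ξ - constraint T γ ζ := by
  rw [eq_sub_iff_add_eq, ← constraint_add, sub_add_cancel]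

variable {γ} in
lemma act_constraint (hγ : ∀ g ξ, γ (adjoint g ξ) = γ ξ) (g : G)
    (ξ : GroupLieAlgebra 𝓘(ℝ, EG) G) :
    T.act g (constraint T γ ξ) = constraint T γ (adjoint g ξ) := by
  unfold constraint
  rw [map_sub, ← T.equivariant, hγ, AlgEquiv.commutes]

lemma constraint_mem_span {V : Submodule ℝ (GroupLieAlgebra 𝓘(ℝ, EG) G)} {ι : Type*}
    (b : Module.Basis ι ℝ V) : T.constraints γ V
      ⊆ Submodule.span 𝕜⟦X⟧ (Set.range fun i => constraint T γ (b i)) := by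
  rintro _ ⟨ξ, hξ, rfl⟩
  let N := Submodule.span 𝕜⟦X⟧ (Set.range fun i => constraint T γ (b i))
  let W : Submodule ℝ (GroupLieAlgebra 𝓘(ℝ, EG) G) :=
    { carrier := {ξ | constraint T γ ξ ∈ N}
      add_mem' := fun {ξ ζ} h h' => by
        change constraint T γ (ξ + ζ) ∈ N
        rw [constraint_add]
        exact add_mem h h'
      zero_mem' := by
        change constraint T γ 0 ∈ N
        rw [← sub_self (0 : GroupLieAlgebra 𝓘(ℝ, EG) G), constraint_sub, sub_self]
        exact zero_mem _
      smul_mem' := fun c ξ h => by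
        change constraint T γ (c • ξ) ∈ N
        rw [constraint_smul]
        exact Submodule.smul_mem _ _ h }
  have h : (⊤ : Submodule ℝ V) ≤ W.comap V.subtype := by
    rw [← b.span_eq, Submodule.span_le]
    rintro _ ⟨i, rfl⟩
    exact Submodule.subset_span ⟨i, rfl⟩
  exact h (x := ⟨ξ, hξ⟩) trivial

lemma finSpanned_constraints [FiniteDimensional ℝ EG]
    (V : Submodule ℝ (GroupLieAlgebra 𝓘(ℝ, EG) G)) : FinSpanned (T.constraints γ V) := by
  have : FiniteDimensional ℝ (GroupLieAlgebra 𝓘(ℝ, EG) G) :=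
    inferInstanceAs (FiniteDimensional ℝ EG)
  let b := Module.finBasis ℝ V
  exact ⟨_, fun i => constraint T γ (b i), fun i => ⟨b i, (b i).2, rfl⟩, constraint_mem_span T γ b⟩

lemma coeff_zero_constraint (ξ : GroupLieAlgebra 𝓘(ℝ, EG) G) (x : M) :
    (Q.coeff 0 (constraint T γ ξ)).1 x
      = (Q.coeff 0 (T.comoment ξ)).1 x - PowerSeries.coeff 0 (γ ξ) := by
  unfold constraint
  rw [Q.coeff_sub, Algebra.algebraMap_eq_smul_one, coeff_zero_smul]
  have h1 : Q.coeff 0 (1 : Q.Alg) = 1 := PowerSeries.coeff_zero_one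
  rw [h1]
  refine congrArg ((Q.coeff 0 (T.comoment ξ)).1 x - ·) ?_
  exact mul_one _

/-- At a regular value, the constraints form a regular system. -/
lemma isRegularSystem_constraints [FiniteDimensional ℝ EG]
    (him : ∀ ξ, RCLike.im (PowerSeries.coeff 0 (γ ξ)) = 0)
    (V : Submodule ℝ (GroupLieAlgebra 𝓘(ℝ, EG) G)) (hreg : T.IsRegularValue γ V) :
    IsRegularSystem (T.constraints γ V) := by
  have : FiniteDimensional ℝ (GroupLieAlgebra 𝓘(ℝ, EG) G) :=
    inferInstanceAs (FiniteDimensional ℝ EG)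
  let b := Module.finBasis ℝ V
  let f : GroupLieAlgebra 𝓘(ℝ, EG) G → M → ℝ :=
    fun ξ x => RCLike.re ((Q.coeff 0 (constraint T γ ξ)).1 x)
  have hf : ∀ ξ x, (Q.coeff 0 (constraint T γ ξ)).1 x = (f ξ x : 𝕜) := fun ξ x => by
    refine (RCLike.conj_eq_iff_re.1 (RCLike.conj_eq_iff_im.2 ?_)).symm
    rw [coeff_zero_constraint, map_sub, T.real, him, sub_zero]
  have hfs : ∀ ξ, ContMDiff 𝓘(ℝ, E) 𝓘(ℝ, ℝ) ∞ (f ξ) := fun ξ =>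
    (RCLike.reCLM (K := 𝕜)).contDiff.contMDiff.comp (Q.coeff 0 (constraint T γ ξ)).2
  let F : M → GroupLieAlgebra 𝓘(ℝ, EG) G →ₗ[ℝ] ℝ := fun x =>
    { toFun := fun ξ => f ξ x
      map_add' := fun ξ ζ => by
        simp only [f]
        rw [constraint_add, Q.coeff_add]
        exact map_add RCLike.re _ _
      map_smul' := fun c ξ => by
        simp only [f]
        rw [constraint_smul, coeff_zero_smul, PowerSeries.coeff_zero_C]
        exact RCLike.re_ofReal_mul _ _ }
  have hF : ∀ (c : Fin (Module.finrank ℝ V) → ℝ) x,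
      f ((∑ i, c i • b i : V) : GroupLieAlgebra 𝓘(ℝ, EG) G) x = ∑ i, c i * f (b i) x :=
    fun c x => by
      change F x _ = ∑ i, c i * F x (b i)
      simp only [Submodule.coe_sum, Submodule.coe_smul, map_sum, map_smul, smul_eq_mul]
  refine ⟨_, fun i => constraint T γ (b i), fun i => f (b i), fun i => ⟨b i, (b i).2, rfl⟩,
    constraint_mem_span T γ b, fun i => hfs _, fun i x => hf _ x, fun z hz c hc => ?_⟩
  have hz' : ∀ ξ ∈ V, f ξ z = 0 := fun ξ hξ => by
    have h := hF (b.repr ⟨ξ, hξ⟩) z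
    rw [b.sum_repr] at h
    rw [h]
    exact Finset.sum_eq_zero fun i _ => mul_eq_zero_of_right _ (hz i)
  -- a combination of the `fᵢ` differs from the moment of `ξ = ∑ cᵢ bᵢ` by a constant
  set ξ : V := ∑ i, c i • b i with hξ
  have hd : HasDer 𝓘(ℝ, E) 𝓘(ℝ, 𝕜) (Q.coeff 0 (T.comoment ξ)).1 z
      ((RCLike.ofRealCLM (K := 𝕜)).comp (0 : E →L[ℝ] ℝ)) := by
    have h1 : HasDer 𝓘(ℝ, E) 𝓘(ℝ, ℝ) (fun x => ∑ i, c i * f (b i) x) z 0 := by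
      have hs : ContMDiff 𝓘(ℝ, E) 𝓘(ℝ, ℝ) ∞ (fun x => ∑ i, c i * f (b i) x) := by
        have e : (fun x => ∑ i, c i * f (b i) x) = f ξ := funext fun x => (hF c x).symm
        rw [e]
        exact hfs _
      have h := hasDer_of_contMDiffAt (hs.contMDiffAt (x := z))
      rwa [hc] at h
    have h2 : HasDer 𝓘(ℝ, ℝ) 𝓘(ℝ, 𝕜)
        (fun r : ℝ => (RCLike.ofRealCLM (K := 𝕜)) r + PowerSeries.coeff 0 (γ ξ))
        (∑ i, c i * f (b i) z) (RCLike.ofRealCLM (K := 𝕜)) :=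
      ((RCLike.ofRealCLM (K := 𝕜)).hasFDerivAt.add_const _).hasMFDerivAt
    have h3 := h2.comp h1 rfl
    have e : ((fun r : ℝ => (RCLike.ofRealCLM (K := 𝕜)) r + PowerSeries.coeff 0 (γ ξ)) ∘
        fun x => ∑ i, c i * f (b i) x) = (Q.coeff 0 (T.comoment ξ)).1 := by
      funext x
      have h4 := hf ξ x
      rw [coeff_zero_constraint, hF] at h4
      rw [sub_eq_iff_eq_add.1 h4]
      rfl
    rwa [e] at h3
  have h0 : (ξ : GroupLieAlgebra 𝓘(ℝ, EG) G) = 0 := by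
    refine hreg z (fun ζ hζ => ?_) ξ ξ.2 ?_
    · have h := hf ζ z
      rw [hz' ζ hζ, coeff_zero_constraint, RCLike.ofReal_zero] at h
      exact sub_eq_zero.1 h
    · exact (HasMFDerivAt.mfderiv hd).trans (ContinuousLinearMap.comp_zero _)
  have h1 : ξ = 0 := Subtype.ext h0
  funext i
  exact Fintype.linearIndependent_iff.1 b.linearIndependent c h1 i

/-- In a Hausdorff semidirect product, the factor `H` is the closed fibre over `1` of the projection
to `K`. -/
lemma IsLieSemidirect.isClosedEmbedding [T2Space G]
    (hS : IsLieSemidirect (EG := EG) (EH := EH) (EK := EK) iH iK) :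
    IsClosedEmbedding iH := by
  obtain ⟨d, hd⟩ := hS.diffeo
  have : T2Space (H × K) := d.toHomeomorph.symm.t2Space
  have : T2Space K := T2Space.of_injective_continuous (f := fun k : K => ((1 : H), k))
    (fun _ _ h => congrArg Prod.snd h) (by fun_prop)
  have h1 : IsClosedEmbedding (fun h : H => (h, (1 : K))) := by
    refine ⟨isEmbedding_prodMkLeft 1, ?_⟩
    have e : Set.range (fun h : H => (h, (1 : K))) = Prod.snd ⁻¹' {1} := by
      ext ⟨h, k⟩
      simp [eq_comm]
    rw [e]
    exact isClosed_singleton.preimage continuous_snd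
  have e : (iH : H → G) = d.toHomeomorph ∘ fun h : H => (h, (1 : K)) := funext fun h => by
    change _ = d (h, 1)
    simp [hd]
  rw [e]
  exact d.toHomeomorph.isClosedEmbedding.comp h1

lemma exists_isAveraging [FiniteDimensional ℝ E] [IsManifold 𝓘(ℝ, E) ∞ M] [T2Space M]
    [SigmaCompactSpace M] [ProperSMul G M] [FiniteDimensional ℝ EH] [LieGroup 𝓘(ℝ, EH) ∞ H]
    {i : H →* G} (hi : ContMDiff 𝓘(ℝ, EH) 𝓘(ℝ, EG) ∞ i) (hcl : Nonempty M → IsClosedEmbedding i)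
    (hsm : ContMDiff (𝓘(ℝ, EG).prod 𝓘(ℝ, E)) 𝓘(ℝ, E) ∞ (fun p : G × M => p.1 • p.2)) :
    ∃ A : smoothFunctions 𝕜 E M → smoothFunctions 𝕜 E M, IsAveraging (i.range : Set G) A := by
  -- over the empty manifold `G` need not be Hausdorff, but there is nothing to average
  rcases isEmpty_or_nonempty M with hM | hM
  · exact ⟨id, ⟨fun _ _ => rfl, rfl, fun _ _ _ x => hM.elim x, fun _ _ x => hM.elim x⟩⟩
  · let act : MulAction H M := MulAction.compHom M i
    have : ProperSMul H M := properSMul_of_isClosedEmbedding i (hcl hM) fun _ _ => rfl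
    obtain ⟨A, h1, h2, h3, h4⟩ := exists_average (G := H) (EG := EH) (E := E) (M := M) 𝕜
      (hsm.comp ((hi.comp contMDiff_fst).prodMk contMDiff_snd))
    refine ⟨A, h1, h3, ?_, fun a f x hx => h4 a f x fun h => hx _ ⟨h, rfl⟩⟩
    rintro a _ ⟨h, rfl⟩ x
    exact h2 a h x

variable [LieGroup 𝓘(ℝ, EG) ∞ G] {T γ}

lemma constraint_commute [FiniteDimensional ℝ EG] {i : H →* G}
    (hi : ContMDiff 𝓘(ℝ, EH) 𝓘(ℝ, EG) ∞ i)
    (hsm : ContMDiff (𝓘(ℝ, EG).prod 𝓘(ℝ, E)) 𝓘(ℝ, E) ∞ (fun p : G × M => p.1 • p.2))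
    {b : Q.Alg} (hb : ∀ g ∈ i.range, T.act g b = b) {j : Q.Alg}
    (hj : j ∈ T.constraints γ (lieRange (EG := EG) (EH := EH) i)) : j * b = b * j := by
  obtain ⟨ξ, hξ, rfl⟩ := hj
  rw [sub_mul, mul_sub, comoment_commute T hi hsm (fun h => hb _ ⟨h, rfl⟩) hξ, Algebra.commutes]

lemma exists_constraint_bracket [FiniteDimensional ℝ EG]
    (hS : IsLieSemidirect (EG := EG) (EH := EH) (EK := EK) iH iK)
    (hγ : ∀ g ξ, γ (adjoint g ξ) = γ ξ) (ξ ζ : GroupLieAlgebra 𝓘(ℝ, EG) G) :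
    ∃ θ : GroupLieAlgebra 𝓘(ℝ, EG) G,
      constraint T γ ξ * constraint T γ ζ - constraint T γ ζ * constraint T γ ξ
        = (PowerSeries.X : 𝕜⟦X⟧) • constraint T γ θ ∧
      (ξ ∈ lieRange (EG := EG) (EH := EH) iH → θ ∈ lieRange (EG := EG) (EH := EH) iH) := by
  obtain ⟨θ, h1, h2, h3⟩ := exists_comoment_bracket T hS hγ ξ ζ
  refine ⟨θ, ?_, h3⟩
  have e : constraint T γ θ = T.comoment θ := by
    unfold constraint
    rw [h2, map_zero, sub_zero]
  rw [e, ← h1]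
  unfold constraint
  rw [sub_mul, sub_mul, mul_sub, mul_sub, mul_sub, mul_sub, Algebra.commutes (γ ζ) (T.comoment ξ),
    Algebra.commutes (γ ξ) (T.comoment ζ), Algebra.commutes (γ ξ) (algebraMap 𝕜⟦X⟧ Q.Alg (γ ζ))]
  abel

lemma IsLieSemidirect.adjoint_mem
    (hS : IsLieSemidirect (EG := EG) (EH := EH) (EK := EK) iH iK) (h : H)
    {ξ : GroupLieAlgebra 𝓘(ℝ, EG) G} (hξ : ξ ∈ lieRange (EG := EG) (EH := EH) iH) :
    adjoint (iH h) ξ ∈ lieRange (EG := EG) (EH := EH) iH := by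
  obtain ⟨D, hD, hDA, -⟩ := hS.exists_projection
  exact (hD _).1 ((hDA h ξ).trans ((hD ξ).2 hξ))

lemma IsLieSemidirect.adjoint_sub_mem
    (hS : IsLieSemidirect (EG := EG) (EH := EH) (EK := EK) iH iK) (h : H)
    (ξ : GroupLieAlgebra 𝓘(ℝ, EG) G) :
    adjoint (iH h) ξ - ξ ∈ lieRange (EG := EG) (EH := EH) iH := by
  obtain ⟨D, hD, hDA, -⟩ := hS.exists_projection
  exact (hD _).1 ((map_sub D _ _).trans (sub_eq_zero.2 (hDA h ξ)))

variable [FiniteDimensional ℝ E] [IsManifold 𝓘(ℝ, E) ∞ M] [T2Space M] [SigmaCompactSpace M]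
  [ProperSMul G M]

/-- A Lie group with a free and proper Hamiltonian action at a regular value, together with its
factors, satisfies the hypotheses of reduction in stages. -/
theorem isStagedSystem_constraints [FiniteDimensional ℝ EG]
    [FiniteDimensional ℝ EH] [LieGroup 𝓘(ℝ, EH) ∞ H]
    (hS : IsLieSemidirect (EG := EG) (EH := EH) (EK := EK) iH iK)
    (hsm : ContMDiff (𝓘(ℝ, EG).prod 𝓘(ℝ, E)) 𝓘(ℝ, E) ∞ (fun p : G × M => p.1 • p.2))
    (hfree : ∀ (g : G) (x : M), g • x = x → g = 1)
    (hγ : ∀ g ξ, γ (adjoint g ξ) = γ ξ)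
    (him : ∀ ξ, RCLike.im (PowerSeries.coeff 0 (γ ξ)) = 0)
    (hregH : T.IsRegularValue γ (lieRange (EH := EH) iH)) (hregG : T.IsRegularValue γ Set.univ) :
    IsStagedSystem T.act iH.range iK.range (T.constraints γ (lieRange (EH := EH) iH))
      (T.constraints γ (lieRange (EH := EK) iK)) (T.constraints γ Set.univ) := by
  -- the orbit maps are injective
  have hT2 : Nonempty M → T2Space G := fun ⟨x⟩ => by
    refine T2Space.of_injective_continuous (f := fun g : G => g • x) (fun g g' h => ?_)
      (hsm.continuous.comp (Continuous.prodMk_left x))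
    have : (g'⁻¹ * g) • x = x := by
      rw [mul_smul, show g • x = g' • x from h, inv_smul_smul]
    rw [← mul_one g', ← hfree _ _ this, mul_inv_cancel_left]
  have hV : ∀ {V W : Set (GroupLieAlgebra 𝓘(ℝ, EG) G)}, V ⊆ W →
      T.constraints γ V ⊆ T.constraints γ W := fun h _ ⟨ξ, hξ, e⟩ => ⟨ξ, h hξ, e⟩
  refine ⟨T.act_apply, ⟨?_, ?_, ?_, fun b hb j hj => constraint_commute hS.smooth_H hsm hb hj, ?_⟩,
    ⟨?_, ?_, ?_, ?_, ?_⟩, ?_, hS.exists_mul,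
    hV (subset_univ _), hV (subset_univ _), ?_, ?_, ?_⟩
  · rw [← coe_lieSubspace] at hregH ⊢
    exact isRegularSystem_constraints T γ him _ hregH
  · rintro _ ⟨h, rfl⟩ _ ⟨ξ, hξ, rfl⟩
    exact ⟨_, hS.adjoint_mem h hξ, act_constraint T hγ _ ξ⟩
  · rintro _ ⟨ξ, hξ, rfl⟩ _ ⟨ζ, hζ, rfl⟩
    obtain ⟨θ, h1, h2⟩ := exists_constraint_bracket (T := T) hS hγ ξ ζ
    exact ⟨_, ⟨θ, h2 hξ, rfl⟩, h1⟩
  · exact exists_isAveraging hS.smooth_H (fun hM => have := hT2 hM; hS.isClosedEmbedding) hsm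
  · rw [← Submodule.top_coe (R := ℝ)] at hregG ⊢
    exact isRegularSystem_constraints T γ him _ hregG
  · rintro g _ _ ⟨ξ, hξ, rfl⟩
    exact ⟨_, mem_univ _, act_constraint T hγ g ξ⟩
  · rintro _ ⟨ξ, hξ, rfl⟩ _ ⟨ζ, hζ, rfl⟩
    obtain ⟨θ, h1, h2⟩ := exists_constraint_bracket (T := T) hS hγ ξ ζ
    exact ⟨_, ⟨θ, mem_univ _, rfl⟩, h1⟩
  · intro b hb j hj
    rw [← lieRange_id] at hj
    exact constraint_commute (i := MonoidHom.id G) contMDiff_id hsm (fun g _ => hb g trivial) hj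
  · obtain ⟨A, hA⟩ := exists_isAveraging (i := MonoidHom.id G) (𝕜 := 𝕜) (E := E) (M := M)
      (EH := EG) contMDiff_id (fun _ => .id) hsm
    rw [MonoidHom.range_eq_top_of_surjective _ Function.surjective_id] at hA
    exact ⟨A, hA⟩
  · rw [← coe_lieSubspace]
    exact finSpanned_constraints T γ _
  · rintro _ ⟨ξ, -, rfl⟩
    obtain ⟨-, -, -, hD⟩ := hS.exists_projection
    obtain ⟨x, hx, y, hy, rfl⟩ := hD ξ
    exact ⟨_, ⟨x, hx, rfl⟩, _, ⟨y, hy, rfl⟩, constraint_add T γ x y⟩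
  · rintro _ ⟨h, rfl⟩ _ ⟨ξ, -, rfl⟩
    refine ⟨_, hS.adjoint_sub_mem h ξ, ?_⟩
    exact (congrArg (· - constraint T γ ξ) (act_constraint T hγ (iH h) ξ)).trans
      (constraint_sub T γ _ _).symm
  · rintro _ ⟨ξ, hξ, rfl⟩ _ ⟨ζ, hζ, rfl⟩
    obtain ⟨θ, h1, h2⟩ := exists_constraint_bracket (T := T) hS hγ ξ ζ
    exact ⟨_, ⟨θ, h2 hξ, rfl⟩, h1⟩

end LieMoments

end QHR

open QHR in
theorem mainTheorem9 :
    (∀ (A : Type*) [CommRing A] [Algebra ℂ A] (P : PoissonBracket ℂ A) (Q : DefQuant P)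
      (n : ℕ) (G : Subgroup (GL (Fin n) ℂ)) (H K : Subgroup G) (_ : IsAlgSemidirect G H K)
      (T : AlgHamiltonianAction Q G) (γ : lieAlg G →ₗ[ℂ] ℂ⟦X⟧) (_ : AlgCoadjointFixed G γ),
      Quantises Q (quantumTwoStage Q T.act H K (T.constraints γ H) (T.constraints γ K))
        (classicalTwoStage Q T.act H K (T.constraints γ H) (T.constraints γ K)) →
      Quantises Q (quantumOneStage Q T.act (T.constraints γ ⊤))
        (classicalOneStage Q T.act (T.constraints γ ⊤)) →
      (classicalTwoStage Q T.act H K (T.constraints γ H) (T.constraints γ K)).IsNaturalIso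
        (classicalOneStage Q T.act (T.constraints γ ⊤)) →
      (quantumTwoStage Q T.act H K (T.constraints γ H) (T.constraints γ K)).IsNaturalIso
        (quantumOneStage Q T.act (T.constraints γ ⊤))) ∧
    (∀ (𝕜 : Type*) [RCLike 𝕜]
      (E : Type*) [NormedAddCommGroup E] [NormedSpace ℝ E] [FiniteDimensional ℝ E]
      (M : Type*) [TopologicalSpace M] [T2Space M] [SigmaCompactSpace M] [ChartedSpace E M]
      [IsManifold 𝓘(ℝ, E) ∞ M]
      (P : PoissonBracket 𝕜 (smoothFunctions 𝕜 E M)) (Q : DefQuant P)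
      (EG : Type*) [NormedAddCommGroup EG] [NormedSpace ℝ EG] [FiniteDimensional ℝ EG]
      (G : Type*) [TopologicalSpace G] [ChartedSpace EG G] [Group G] [LieGroup 𝓘(ℝ, EG) ∞ G]
      (EH : Type*) [NormedAddCommGroup EH] [NormedSpace ℝ EH] [FiniteDimensional ℝ EH]
      (H : Type*) [TopologicalSpace H] [ChartedSpace EH H] [Group H] [LieGroup 𝓘(ℝ, EH) ∞ H]
      (EK : Type*) [NormedAddCommGroup EK] [NormedSpace ℝ EK] [FiniteDimensional ℝ EK]
      (K : Type*) [TopologicalSpace K] [ChartedSpace EK K] [Group K] [LieGroup 𝓘(ℝ, EK) ∞ K]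
      (iH : H →* G) (iK : K →* G) (_ : IsLieSemidirect (EG := EG) (EH := EH) (EK := EK) iH iK)
      [MulAction G M] [ProperSMul G M]
      (_ : ContMDiff (𝓘(ℝ, EG).prod 𝓘(ℝ, E)) 𝓘(ℝ, E) ∞ (fun p : G × M => p.1 • p.2))
      (_ : ∀ (g : G) (x : M), g • x = x → g = 1)
      (T : LieHamiltonianAction (EG := EG) (G := G) Q)
      (γ : GroupLieAlgebra 𝓘(ℝ, EG) G →ₗ[ℝ] 𝕜⟦X⟧) (_ : ∀ g ξ, γ (adjoint g ξ) = γ ξ)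
      (_ : ∀ ξ, RCLike.im (PowerSeries.coeff 0 (γ ξ)) = 0)
      (_ : T.IsRegularValue γ (lieRange (EH := EH) iH)) (_ : T.IsRegularValue γ Set.univ),
      (classicalTwoStage Q T.act iH.range iK.range (T.constraints γ (lieRange (EH := EH) iH))
        (T.constraints γ (lieRange (EH := EK) iK))).IsNaturalIso
        (classicalOneStage Q T.act (T.constraints γ Set.univ)) ∧
      (quantumTwoStage Q T.act iH.range iK.range (T.constraints γ (lieRange (EH := EH) iH))
        (T.constraints γ (lieRange (EH := EK) iK))).IsNaturalIso
        (quantumOneStage Q T.act (T.constraints γ Set.univ))) := by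
  refine ⟨?_, ?_⟩
  · intro A _ _ P Q n G H K hG T γ _ h₂ h₁ hC
    exact algebraic_reduction_in_stages hG T γ h₂ h₁ hC
  · intro 𝕜 _ E _ _ _ M _ _ _ _ _ P Q EG _ _ _ G _ _ _ _ EH _ _ _ H _ _ _ _ EK _ _ _ K _ _ _ _
      iH iK hS _ _ hsm hfree T γ hγ him hregH hregG
    have h := isStagedSystem_constraints hS hsm hfree hγ him hregH hregG
    exact ⟨h.classical, h.quantum⟩
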